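/- Let $\xi$ be a real Lévy process with characteristic triplet $(a,q^2,\Lambda)$, i.e. $a,q\in\mathbb R$, $\Lambda(\{0\})=0$, $\int_{\mathbb R}(1\wedge x^2)\,\Lambda(dx)<\infty$, with characteristic exponent $$\Psi(\lambda)=\log \mathbb E[e^{i\lambda\xi_1}]=ia\lambda-\tfrac{q^2}{2}\lambda^2+\int_{\mathbb R}\bigl(e^{i\lambda x}-1-ix\lambda \mathbf 1_{\{|x|\le 1\}}\bigr)\Lambda(dx).$$ Let $p\in(0,1)$ be an admissible memory parameter, i.e. $p\beta<1$, where $\beta=2$ if $q\neq 0$ and $\beta=\inf\{r>0:\int_{[-1,1]}|x|^r\Lambda(dx)<\infty\}$ if $q=0$. Let $Y$ be the Yule–Simon process with parameter $1/p$, that is, $Y(t)=\mathbf 1_{\{U\le t\}}Z_{p(\ln t-\ln U)}$, $t\in[0,1]$, with $U$ uniform on $[0,1]$ and $Z$ an independent standard Yule process (the pure birth process started from $1$ with birth rate $k$ in state $k$). Let $\hat\xi=(\hat\xi_t)_{t\ge 0}$ be a noise reinforced Lévy process with characteristics $(a,q^2,\Lambda,p)$, i.e. a real-valued process on a probability space such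 that, for all $k$, all $0<s_1<\dots<s_k\le t$ and all $\lambda_1,\dots,\lambda_k\in\mathbb R$, $$\mathbb E\Bigl[\exp\Bigl\{i\sum_{j=1}^k\lambda_j\hat\xi_{s_j}\Bigr\}\Bigr]=\exp\Bigl\{(1-p)\,t\,\mathbb E\Bigl[\Psi\Bigl(\sum_{j=1}^k\lambda_jY(s_j/t)\Bigr)\Bigr]\Bigr\}.$$ Suppose that $\Psi$ is differentiable at $0$ with $\Psi'(0)=0$, and that $\int_{\{|x|\ge 1\}}|x|\,\Lambda(dx)<\infty$. Then the process $M=(M_t)_{t\ge 0}$ defined by $M_0=0$ and $M_t=t^{-p}\hat\xi_t$ for $t>0$ is a martingale with respect to its natural filtration. Consequently, $M$ has an rcll (right-continuous with left limits) modification. -/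

import Mathlib

open MeasureTheory ProbabilityTheory Filter Topology
open scoped NNReal ENNReal

namespace ReinforcedLevy

noncomputable section

/-! ### Lévy triplets -/

/-- The characteristic triplet `(a, q², Λ)` of a real Lévy process. -/
structure LevyTriplet where
  a : ℝ
  q : ℝ
  Λ : Measure ℝ
  Λ_zero : Λ {0} = 0
  lintegral_min_lt_top : ∫⁻ x, ENNReal.ofReal (min 1 (x ^ 2)) ∂Λ < ∞

/-- The characteristic exponent `Ψ(z) = log E[exp (i z ξ₁)]`, by the Lévy–Khintchine formula. -/
def LevyTriplet.exponent (T : LevyTriplet) (z : ℝ) : ℂ :=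
  Complex.I * T.a * z - (T.q : ℂ) ^ 2 / 2 * (z : ℂ) ^ 2 +
    ∫ x : ℝ, (Complex.exp (Complex.I * z * x) - 1 -
      ({x : ℝ | |x| ≤ 1}.indicator (fun x : ℝ => Complex.I * x * z) x)) ∂T.Λ

/-- The upper Blumenthal–Getoor index of a measure on `ℝ`. -/
def bgIndexMeasure (Λ : Measure ℝ) : ℝ :=
  sInf {r : ℝ | 0 < r ∧ ∫⁻ x in Set.Icc (-1 : ℝ) 1, ENNReal.ofReal (|x| ^ r) ∂Λ < ∞}

open Classical in
/-- The Blumenthal–Getoor index of the Lévy process with triplet `T`. -/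
def LevyTriplet.bgIndex (T : LevyTriplet) : ℝ :=
  if T.q ^ 2 = 0 then bgIndexMeasure T.Λ else 2

/-- `p` is an admissible memory parameter for the triplet `T`. -/
def LevyTriplet.Admissible (T : LevyTriplet) (p : ℝ) : Prop :=
  0 < p ∧ p < 1 ∧ p * T.bgIndex < 1

/-! ### Yule–Simon processes -/

/-- The law of the holding time of a standard Yule process in the state `j + 1`:
exponential with parameter `j + 1`. -/
def holdingLaw (j : ℕ) : Measure ℝ := expMeasure ((j : ℝ) + 1)

instance (j : ℕ) : IsProbabilityMeasure (holdingLaw j) :=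
  isProbabilityMeasure_expMeasure (by positivity)

/-- A standard Yule process (pure birth process started from `1`, with birth rate `k` in state `k`)
as a function of its successive holding times: `e j` is the time spent in state `j + 1`, so
`∑ j ∈ range (n + 1), e j` is the time of the `(n + 1)`-st birth. -/
def yule (e : ℕ → ℝ) (t : ℝ) : ℕ :=
  1 + {n : ℕ | ∑ j ∈ Finset.range (n + 1), e j ≤ t}.ncard

/-- The probability space on which the Yule–Simon process is built: a uniform variable `U` on
`[0, 1]` and an independent sequence of independent holding times. -/
def yuleSimonMeasure : Measure (ℝ × (ℕ → ℝ)) :=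
  (volume.restrict (Set.Icc (0 : ℝ) 1)).prod (Measure.infinitePi holdingLaw)

open Classical in
/-- The Yule–Simon process with parameter `1 / p`:
`Y(t) = 1_{U ≤ t} Z_{p (log t - log U)}` for `t ∈ [0, 1]`, with `Z` the standard Yule process. -/
def yuleSimon (p : ℝ) (t : ℝ) (w : ℝ × (ℕ → ℝ)) : ℕ :=
  if w.1 ≤ t then yule w.2 (p * (Real.log t - Real.log w.1)) else 0

/-! ### Noise reinforced Lévy processes -/

/-- `ξ` is, under `P`, a noise reinforced Lévy process on `ℝ₊` with characteristics
`(a, q², Λ, p)`: a process with the prescribed finite-dimensional distributions. -/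
structure IsNoiseReinforcedLevy {Ω : Type*} [MeasurableSpace Ω] (T : LevyTriplet) (p : ℝ)
    (ξ : ℝ≥0 → Ω → ℝ) (P : Measure Ω) : Prop where
  measurable : ∀ t, Measurable (ξ t)
  charFun_eq : ∀ (k : ℕ) (s : Fin k → ℝ≥0) (c : Fin k → ℝ) (t : ℝ≥0),
    StrictMono s → (∀ i, 0 < s i) → (∀ i, s i ≤ t) →
      ∫ ω, Complex.exp (Complex.I * ((∑ i, c i * ξ (s i) ω : ℝ) : ℂ)) ∂P =
        Complex.exp ((1 - (p : ℂ)) * ((t : ℝ) : ℂ) *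
          ∫ w, T.exponent (∑ i, c i * (yuleSimon p ((s i : ℝ) / (t : ℝ)) w : ℝ))
            ∂yuleSimonMeasure)

/-- The process `M₀ = 0`, `M_t = t^{-p} ξ_t` for `t > 0`. -/
def scaledProcess {Ω : Type*} (p : ℝ) (ξ : ℝ≥0 → Ω → ℝ) (t : ℝ≥0) (ω : Ω) : ℝ :=
  if t = 0 then 0 else (t : ℝ) ^ (-p) * ξ t ω

lemma scaledProcess_stronglyMeasurable {Ω : Type*} [MeasurableSpace Ω] (p : ℝ)
    {ξ : ℝ≥0 → Ω → ℝ} (h : ∀ t, Measurable (ξ t)) (t : ℝ≥0) :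
    StronglyMeasurable (scaledProcess p ξ t) := by
  by_cases ht : t = 0
  · have : scaledProcess p ξ t = fun _ => 0 := by
      funext ω
      simp [scaledProcess, ht]
    rw [this]
    exact stronglyMeasurable_const
  · have : scaledProcess p ξ t = fun ω => (t : ℝ) ^ (-p) * ξ t ω := by
      funext ω
      simp [scaledProcess, ht]
    rw [this]
    exact ((h t).const_mul _).stronglyMeasurable

/-- A path is rcll: right-continuous with (finite) left limits. -/
def IsRcll (f : ℝ≥0 → ℝ) : Prop :=
  ∀ t, ContinuousWithinAt f (Set.Ici t) t ∧ ∃ l : ℝ, Tendsto f (𝓝[<] t) (𝓝 l)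

/-- The process `M` has a modification all of whose paths are rcll. -/
def HasRcllModification {Ω : Type*} [MeasurableSpace Ω] (M : ℝ≥0 → Ω → ℝ) (P : Measure Ω) : Prop :=
  ∃ N : ℝ≥0 → Ω → ℝ, (∀ t, Measurable (N t)) ∧ (∀ t, N t =ᵐ[P] M t) ∧
    ∀ ω, IsRcll (fun t => N t ω)

end

end ReinforcedLevy

namespace ReinforcedLevy

/-! ### Exponential holding times -/

/-! The law of the process is described by `Y`, and the martingale property is inherited from the
Yule process. A standard Yule process `Z` has birth rate equal to its population, so `exp (-t) * Z
t` is a martingale (`lintegral_yule_indicator`). Conditionally on `U = x`, the variable `Y v` is `Z`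
at time `p (log v - log x)`, so `v ^ (-p) * Y v` is a martingale from time `x` on. Hence `E[Y 1 * g]
= s ^ (-p) * E[Y s * g]` for a function `g` of a linear combination of values of `Y` up to time `s`,
provided `g` vanishes at `0`, which removes the event `U > s` (`integral_yuleSimon_mul`).

Differentiating the joint characteristic function at a coefficient belonging to time `u` expresses
`E[ξ_u exp (i ∑ c ξ)]` as the characteristic function times `(1 - p) t E[Ψ'(∑ c Y) Y (u / t)]`
(`HasReinforcedLaw.integral_mul_exp`). The martingale identity for `Y` applies with `g = Ψ'`,
because `Ψ'(0) = 0`. Comparing `u = t` with `u = s` shows that `M_t - M_s` is orthogonal to every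
exponential of the past up to `s` (`HasReinforcedLaw.integral_increment_mul_exp`), and uniqueness of
Fourier transforms turns this into vanishing integrals over past events
(`setIntegral_eq_zero_of_fourier`).

The analysis rests on one exponent `r` in `(1, 2]` with `p * r < 1` for which the small jumps have
finite `r`-variation, with `r = 2` if there is a Gaussian part. Then `Y 1` has a finite moment of
order `r` (`integrable_yuleSimon_rpow`), and `Ψ`, `Ψ'` grow no faster than the powers `r` and `r -
1` at infinity. This dominates the derivatives, and integrability of `ξ_t` follows by integrating `1
- Re φ(l)` against `dl / l ^ 2` (`integrable_of_charFun_eq_exp`).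

The rcll modification comes from Doob's upcrossing and maximal inequalities along the dyadics. The
right limit along the dyadics is a modification because `M_s - M_t` tends to `0` in law as `s ↓ t`
(`hasRcllModification_of_martingale`); no right continuity of the filtration is needed. -/

lemma expMeasure_Ioi {r : ℝ} (hr : 0 < r) {s : ℝ} (hs : 0 ≤ s) :
    expMeasure r (Set.Ioi s) = ENNReal.ofReal (Real.exp (-(r * s))) := by
  have := isProbabilityMeasure_expMeasure hr
  have h := cdf_expMeasure_eq hr s
  rw [if_pos hs, cdf_eq_real] at h
  have h2 : (expMeasure r).real (Set.Ioi s) = Real.exp (-(r * s)) := by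
    rw [← Set.compl_Iic, probReal_compl_eq_one_sub measurableSet_Iic, h]; ring
  rw [← h2, ofReal_measureReal]

lemma expMeasure_eq (r : ℝ) : expMeasure r = volume.withDensity (exponentialPDF r) := rfl

lemma measurable_exponentialPDF (r : ℝ) : Measurable (exponentialPDF r) :=
  (measurable_exponentialPDFReal r).ennreal_ofReal

lemma ae_expMeasure_nonneg (r : ℝ) : ∀ᵐ x ∂(expMeasure r), 0 ≤ x := by
  rw [expMeasure_eq, ae_withDensity_iff (measurable_exponentialPDF r)]
  refine ae_of_all _ fun x hx => ?_
  by_contra h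
  exact hx (exponentialPDF_of_neg (not_le.1 h))

/-- The compensator identity for an exponential time. -/
lemma lintegral_expMeasure_eq_compensator {r : ℝ} (hr : 0 < r) {h : ℝ → ℝ≥0∞}
    (hh : Measurable h) :
    ∫⁻ x, h x ∂(expMeasure r) =
      ENNReal.ofReal r * ∫⁻ x, (∫⁻ s in Set.Ico 0 x, h s) ∂(expMeasure r) := by
  have := isProbabilityMeasure_expMeasure hr
  have key : ∀ x, ∫⁻ s in Set.Ico 0 x, h s =
      ∫⁻ s, {q : ℝ × ℝ | 0 ≤ q.2 ∧ q.2 < q.1}.indicator (fun q => h q.2) (x, s) := by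
    intro x
    rw [← lintegral_indicator measurableSet_Ico]
    rfl
  have hm : MeasurableSet {q : ℝ × ℝ | 0 ≤ q.2 ∧ q.2 < q.1} :=
    (measurableSet_le measurable_const measurable_snd).inter
      (measurableSet_lt measurable_snd measurable_fst)
  simp_rw [key]
  rw [lintegral_lintegral_swap
    (f := fun x s => {q : ℝ × ℝ | 0 ≤ q.2 ∧ q.2 < q.1}.indicator (fun q => h q.2) (x, s))
    (((hh.comp measurable_snd).indicator hm).aemeasurable), ← lintegral_const_mul' _ _ (by simp),
    expMeasure_eq, lintegral_withDensity_eq_lintegral_mul _ (measurable_exponentialPDF r) hh,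
    ← expMeasure_eq]
  -- After Tonelli the identity is pointwise: the exponential density at `s` is `r` times the tail
  -- probability of `(s, ∞)`.
  refine lintegral_congr fun s => ?_
  by_cases hs : 0 ≤ s
  · have : ∀ x, {q : ℝ × ℝ | 0 ≤ q.2 ∧ q.2 < q.1}.indicator (fun q => h q.2) (x, s) =
        (Set.Ioi s).indicator (fun _ => h s) x := by
      intro x
      by_cases hx : s < x <;> simp [Set.indicator, hs, hx]
    simp_rw [this]
    rw [lintegral_indicator_const measurableSet_Ioi, expMeasure_Ioi hr hs, Pi.mul_apply,
      exponentialPDF_of_nonneg hs, ENNReal.ofReal_mul hr.le]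
    ring
  · have : ∀ x, {q : ℝ × ℝ | 0 ≤ q.2 ∧ q.2 < q.1}.indicator (fun q => h q.2) (x, s) = 0 := by
      intro x
      simp [Set.indicator, hs]
    simp_rw [this]
    simp [exponentialPDF_of_neg (not_le.1 hs)]

/-- The law of the sequence of holding times. -/
noncomputable abbrev holdingTimes : Measure (ℕ → ℝ) := Measure.infinitePi holdingLaw

/-- The first `n` holding times, followed by zeros. -/
def firstTimes (n : ℕ) (e : ℕ → ℝ) : ℕ → ℝ := fun j => if j < n then e j else 0

lemma measurable_firstTimes (n : ℕ) : Measurable (firstTimes n) := by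
  refine measurable_pi_lambda _ fun j => ?_
  unfold firstTimes
  split_ifs
  · exact measurable_pi_apply j
  · exact measurable_const

lemma indepFun_firstTimes (n : ℕ) :
    IndepFun (firstTimes n) (fun e : ℕ → ℝ => e n) holdingTimes := by
  have h1 : iIndepFun (fun (i : ℕ) (e : ℕ → ℝ) => e i) holdingTimes :=
    iIndepFun_infinitePi (X := fun (i : ℕ) (x : ℝ) => x) (fun i => measurable_id)
  have h2 := h1.indepFun_finset (Finset.range n) {n} (by simp)
    (fun i => measurable_pi_apply i)
  have h3 : Measurable (fun (a : Finset.range n → ℝ) (j : ℕ) =>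
      if hj : j ∈ Finset.range n then a ⟨j, hj⟩ else 0) := by
    refine measurable_pi_lambda _ fun j => ?_
    by_cases hj : j ∈ Finset.range n
    · simp only [hj, dif_pos]; exact measurable_pi_apply _
    · simp only [hj]; exact measurable_const
  have h4 : Measurable (fun (a : ({n} : Finset ℕ) → ℝ) => a ⟨n, by simp⟩) :=
    measurable_pi_apply _
  have h5 := h2.comp h3 h4
  convert h5 using 1
  · funext e j
    simp [firstTimes]
  · rfl

/-- Independence lets the `n`-th holding time be integrated out with the earlier ones frozen.
Padding by zeros keeps the past inside `ℕ → ℝ`, so functionals unaffected by truncation apply to it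
unchanged. -/
lemma lintegral_firstTimes_prod (n : ℕ) {f : (ℕ → ℝ) × ℝ → ℝ≥0∞} (hf : Measurable f) :
    ∫⁻ e, f (firstTimes n e, e n) ∂holdingTimes =
      ∫⁻ e, ∫⁻ x, f (firstTimes n e, x) ∂(holdingLaw n) ∂holdingTimes := by
  have h := (indepFun_iff_map_prod_eq_prod_map_map (measurable_firstTimes n).aemeasurable
    (measurable_pi_apply n).aemeasurable).1 (indepFun_firstTimes n)
  have h2 : holdingTimes.map (fun e : ℕ → ℝ => e n) = holdingLaw n :=
    Measure.infinitePi_map_eval holdingLaw n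
  rw [h2] at h
  have hp : Measurable (fun e : ℕ → ℝ => (firstTimes n e, e n)) :=
    (measurable_firstTimes n).prodMk (measurable_pi_apply n)
  rw [← lintegral_map (g := fun e : ℕ → ℝ => (firstTimes n e, e n)) hf hp, h,
    lintegral_prod _ hf.aemeasurable,
    lintegral_map (Measurable.lintegral_prod_right' hf) (measurable_firstTimes n)]

lemma ae_holdingTimes_nonneg : ∀ᵐ e ∂holdingTimes, ∀ n, 0 ≤ e n := by
  rw [ae_all_iff]
  intro n
  have h2 : holdingTimes.map (fun e : ℕ → ℝ => e n) = holdingLaw n :=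
    Measure.infinitePi_map_eval holdingLaw n
  have h3 := ae_expMeasure_nonneg ((n : ℝ) + 1)
  change ∀ᵐ x ∂(holdingLaw n), 0 ≤ x at h3
  rw [← h2] at h3
  exact ae_of_ae_map (measurable_pi_apply n).aemeasurable h3

/-! ### Birth times -/

/-- The time of the `n`-th birth. -/
noncomputable def birthTime (e : ℕ → ℝ) (n : ℕ) : ℝ := ∑ j ∈ Finset.range n, e j

@[simp] lemma birthTime_zero (e : ℕ → ℝ) : birthTime e 0 = 0 := by simp [birthTime]

lemma birthTime_succ (e : ℕ → ℝ) (n : ℕ) : birthTime e (n + 1) = birthTime e n + e n := by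
  simp [birthTime, Finset.sum_range_succ]

lemma measurable_birthTime (n : ℕ) : Measurable (fun e => birthTime e n) :=
  Finset.measurable_sum _ fun j _ => measurable_pi_apply j

lemma birthTime_firstTimes {e : ℕ → ℝ} {m n : ℕ} (h : m ≤ n) :
    birthTime (firstTimes n e) m = birthTime e m := by
  unfold birthTime firstTimes
  refine Finset.sum_congr rfl fun j hj => ?_
  rw [if_pos ((Finset.mem_range.1 hj).trans_le h)]

lemma monotone_birthTime {e : ℕ → ℝ} (he : ∀ n, 0 ≤ e n) : Monotone (birthTime e) :=
  monotone_nat_of_le_succ fun n => by rw [birthTime_succ]; linarith [he n]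

lemma birthTime_nonneg {e : ℕ → ℝ} (he : ∀ n, 0 ≤ e n) (n : ℕ) : 0 ≤ birthTime e n :=
  Finset.sum_nonneg fun j _ => he j

lemma measurableSet_birthTime_le (n : ℕ) (t : ℝ) : MeasurableSet {e | birthTime e n ≤ t} :=
  measurableSet_le (measurable_birthTime n) measurable_const

/-- Birth times of the Yule process are distributed as maxima of independent exponential
variables. -/
lemma holdingTimes_birthTime_le (n : ℕ) {t : ℝ} (ht : 0 ≤ t) :
    holdingTimes {e | birthTime e n ≤ t} = ENNReal.ofReal ((1 - Real.exp (-t)) ^ n) := by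
  induction n generalizing t with
  | zero => simp [ht]
  | succ n ih =>
    have hle : ∀ s : ℝ, 0 ≤ s → 0 ≤ 1 - Real.exp (-s) := fun s hs => by
      have : Real.exp (-s) ≤ 1 := Real.exp_le_one_iff.2 (by linarith)
      linarith
    have hm : MeasurableSet {q : (ℕ → ℝ) × ℝ | birthTime q.1 n + q.2 ≤ t} :=
      measurableSet_le (((measurable_birthTime n).comp measurable_fst).add measurable_snd)
        measurable_const
    have h1 := lintegral_firstTimes_prod n
      (f := {q : (ℕ → ℝ) × ℝ | birthTime q.1 n + q.2 ≤ t}.indicator 1)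
      (measurable_one.indicator hm)
    have h2 : ∀ e : ℕ → ℝ, {q : (ℕ → ℝ) × ℝ | birthTime q.1 n + q.2 ≤ t}.indicator
        (1 : (ℕ → ℝ) × ℝ → ℝ≥0∞) (firstTimes n e, e n) =
        {e | birthTime e (n + 1) ≤ t}.indicator 1 e := by
      intro e
      simp [Set.indicator, birthTime_firstTimes le_rfl, birthTime_succ]
    simp_rw [h2] at h1
    rw [lintegral_indicator_one (measurableSet_birthTime_le _ _)] at h1
    rw [h1]
    have h3 : ∀ (e : ℕ → ℝ) (x : ℝ), {q : (ℕ → ℝ) × ℝ | birthTime q.1 n + q.2 ≤ t}.indicator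
        (1 : (ℕ → ℝ) × ℝ → ℝ≥0∞) (firstTimes n e, x) =
        {q : (ℕ → ℝ) × ℝ | birthTime q.1 n + q.2 ≤ t}.indicator
        (1 : (ℕ → ℝ) × ℝ → ℝ≥0∞) (e, x) := by
      intro e x
      simp [Set.indicator, birthTime_firstTimes le_rfl]
    simp_rw [h3]
    rw [lintegral_lintegral_swap
      (f := fun e x => {q : (ℕ → ℝ) × ℝ | birthTime q.1 n + q.2 ≤ t}.indicator
        (1 : (ℕ → ℝ) × ℝ → ℝ≥0∞) (e, x)) (measurable_one.indicator hm).aemeasurable]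
    have h4 : ∀ x : ℝ, 0 ≤ x → ∫⁻ e, {q : (ℕ → ℝ) × ℝ | birthTime q.1 n + q.2 ≤ t}.indicator
        (1 : (ℕ → ℝ) × ℝ → ℝ≥0∞) (e, x) ∂holdingTimes =
        (Set.Icc 0 t).indicator
          (fun x => ENNReal.ofReal ((1 - Real.exp (-(t - x))) ^ n)) x := by
      intro x hx
      have : ∀ e : ℕ → ℝ, {q : (ℕ → ℝ) × ℝ | birthTime q.1 n + q.2 ≤ t}.indicator
          (1 : (ℕ → ℝ) × ℝ → ℝ≥0∞) (e, x) = {e | birthTime e n ≤ t - x}.indicator 1 e := by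
        intro e
        simp [Set.indicator, le_sub_iff_add_le]
      simp_rw [this]
      rw [lintegral_indicator_one (measurableSet_birthTime_le _ _)]
      by_cases hxt : x ≤ t
      · rw [Set.indicator_of_mem (show x ∈ Set.Icc 0 t from ⟨hx, hxt⟩), ih (by linarith)]
      · rw [Set.indicator_of_notMem (fun h => hxt h.2)]
        refine measure_mono_null (t := {e | ∀ n, 0 ≤ e n}ᶜ) ?_ ae_holdingTimes_nonneg
        intro e he he'
        have h5 := birthTime_nonneg he' n
        change birthTime e n ≤ t - x at he
        linarith
    have h5 : ∀ᵐ x ∂(holdingLaw n), ∫⁻ e, {q : (ℕ → ℝ) × ℝ | birthTime q.1 n + q.2 ≤ t}.indicator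
        (1 : (ℕ → ℝ) × ℝ → ℝ≥0∞) (e, x) ∂holdingTimes =
        (Set.Icc 0 t).indicator
          (fun x => ENNReal.ofReal ((1 - Real.exp (-(t - x))) ^ n)) x := by
      filter_upwards [ae_expMeasure_nonneg ((n : ℝ) + 1)] with x hx using h4 x hx
    have hmeas : Measurable (fun x : ℝ => ENNReal.ofReal ((1 - Real.exp (-(t - x))) ^ n)) := by
      fun_prop
    rw [lintegral_congr_ae h5, holdingLaw, expMeasure_eq,
      lintegral_withDensity_eq_lintegral_mul _ (measurable_exponentialPDF _)
        (hmeas.indicator measurableSet_Icc)]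
    -- Of the factor `exp (-(n + 1) x)` in the density, `exp (-n x)` is absorbed into the `n`-th
    -- power; what remains is an exact derivative.
    have h6 : ∀ x, (exponentialPDF ((n : ℝ) + 1) * (Set.Icc 0 t).indicator
          (fun x => ENNReal.ofReal ((1 - Real.exp (-(t - x))) ^ n))) x =
        (Set.Icc 0 t).indicator (fun x => ENNReal.ofReal
          (((n : ℝ) + 1) * Real.exp (-x) * (Real.exp (-x) - Real.exp (-t)) ^ n)) x := by
      intro x
      by_cases hx : x ∈ Set.Icc 0 t
      · rw [Pi.mul_apply, Set.indicator_of_mem hx, Set.indicator_of_mem hx,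
          exponentialPDF_of_nonneg hx.1, ← ENNReal.ofReal_mul (by positivity)]
        congr 1
        have e1 : Real.exp (-(((n : ℝ) + 1) * x)) = Real.exp (-x) * Real.exp (-x) ^ n := by
          rw [← Real.exp_nat_mul, ← Real.exp_add]; congr 1; ring
        have e2 : Real.exp (-x) - Real.exp (-t) = Real.exp (-x) * (1 - Real.exp (-(t - x))) := by
          rw [mul_sub, mul_one, ← Real.exp_add]; congr 2; ring
        rw [e1, e2, mul_pow]; ring
      · simp [Set.indicator_of_notMem hx]
    simp_rw [h6]
    rw [lintegral_indicator measurableSet_Icc, setLIntegral_congr Ioc_ae_eq_Icc.symm,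
      ← ofReal_integral_eq_lintegral_ofReal, ← intervalIntegral.integral_of_le ht]
    · congr 1
      have hd : ∀ x ∈ Set.uIcc 0 t, HasDerivAt
          (fun x => -(Real.exp (-x) - Real.exp (-t)) ^ (n + 1))
          (((n : ℝ) + 1) * Real.exp (-x) * (Real.exp (-x) - Real.exp (-t)) ^ n) x := by
        intro x _
        have := ((((hasDerivAt_id x).neg.exp).sub_const (Real.exp (-t))).pow (n + 1)).neg
        convert! this using 1
        simp
        ring
      rw [intervalIntegral.integral_eq_sub_of_hasDerivAt hd
        (Continuous.intervalIntegrable (by fun_prop) _ _)]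
      simp
    · exact (Continuous.integrableOn_Icc (by fun_prop)).mono_set Set.Ioc_subset_Icc_self
    · refine (ae_restrict_iff' measurableSet_Ioc).2 (ae_of_all _ fun x hx => ?_)
      have : Real.exp (-t) ≤ Real.exp (-x) := Real.exp_le_exp.2 (by linarith [hx.2])
      have h8 : 0 ≤ (Real.exp (-x) - Real.exp (-t)) ^ n := pow_nonneg (by linarith) n
      simp only [Pi.zero_apply]
      positivity

end ReinforcedLevy

namespace ReinforcedLevy

/-! ### The population of a Yule process -/

/-- The population at time `t`, as an extended nonnegative number. -/
noncomputable def population (e : ℕ → ℝ) (t : ℝ) : ℝ≥0∞ :=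
  ∑' n, {e | birthTime e n ≤ t}.indicator 1 e

lemma measurable_population_prod :
    Measurable (fun q : (ℕ → ℝ) × ℝ => population q.1 q.2) := by
  unfold population
  refine Measurable.tsum fun n => ?_
  have hm : MeasurableSet {q : (ℕ → ℝ) × ℝ | birthTime q.1 n ≤ q.2} :=
    measurableSet_le ((measurable_birthTime n).comp measurable_fst) measurable_snd
  exact measurable_one.indicator hm

lemma measurable_population (t : ℝ) : Measurable (fun e => population e t) :=
  measurable_population_prod.comp (measurable_id.prodMk measurable_const)

lemma population_mono (e : ℕ → ℝ) : Monotone (population e) := by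
  intro s t hst
  refine ENNReal.tsum_le_tsum fun n => ?_
  by_cases h : birthTime e n ≤ s
  · simp [Set.indicator, h, h.trans hst]
  · simp [Set.indicator, h]

lemma one_sub_exp_neg_nonneg {t : ℝ} (ht : 0 ≤ t) : 0 ≤ 1 - Real.exp (-t) := by
  have : Real.exp (-t) ≤ 1 := Real.exp_le_one_iff.2 (by linarith)
  linarith

/-- The birth with index `n` has occurred by time `t` with probability `(1 - exp (-t)) ^ n`, so the
mean is a geometric series. Index `0` is the ancestor, born at time `0`. Finiteness of this mean is
what excludes explosion. -/
lemma lintegral_population {t : ℝ} (ht : 0 ≤ t) :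
    ∫⁻ e, population e t ∂holdingTimes = ENNReal.ofReal (Real.exp t) := by
  unfold population
  rw [lintegral_tsum fun n =>
    (measurable_one.indicator (measurableSet_birthTime_le n t)).aemeasurable]
  simp_rw [lintegral_indicator_one (measurableSet_birthTime_le _ t),
    holdingTimes_birthTime_le _ ht]
  have h1 := one_sub_exp_neg_nonneg ht
  have h2 : 1 - Real.exp (-t) < 1 := by linarith [Real.exp_pos (-t)]
  rw [← ENNReal.ofReal_tsum_of_nonneg (fun n => pow_nonneg h1 n)
    (summable_geometric_of_lt_one h1 h2), tsum_geometric_of_lt_one h1 h2]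
  congr 1
  rw [sub_sub_cancel, Real.exp_neg, inv_inv]

/-- The holding times are nonnegative and do not accumulate. -/
def Regular (e : ℕ → ℝ) : Prop := (∀ n, 0 ≤ e n) ∧ ∀ t, population e t < ∞

lemma ae_regular : ∀ᵐ e ∂holdingTimes, Regular e := by
  have h : ∀ᵐ e ∂holdingTimes, ∀ k : ℕ, population e k < ∞ := by
    rw [ae_all_iff]
    intro k
    refine ae_lt_top (measurable_population k) ?_
    rw [lintegral_population (Nat.cast_nonneg k)]
    exact ENNReal.ofReal_ne_top
  filter_upwards [h, ae_holdingTimes_nonneg] with e h1 h2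
  refine ⟨h2, fun t => ?_⟩
  obtain ⟨k, hk⟩ := exists_nat_ge t
  exact (population_mono e hk).trans_lt (h1 k)

lemma Regular.exists_birthTime_le_iff {e : ℕ → ℝ} (he : Regular e) {t : ℝ} (ht : 0 ≤ t) :
    ∃ N : ℕ, ∀ n, birthTime e n ≤ t ↔ n ≤ N := by
  have hex : ∃ n, t < birthTime e n := by
    by_contra! hcon
    have h := he.2 t
    unfold population at h
    have : ∀ n, {e | birthTime e n ≤ t}.indicator (1 : (ℕ → ℝ) → ℝ≥0∞) e = 1 := by
      intro n; simp [Set.indicator, hcon n]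
    simp_rw [this] at h
    rw [ENNReal.tsum_const_eq_top_of_ne_zero one_ne_zero] at h
    exact lt_irrefl _ h
  classical
  -- The first birth time beyond `t` has nonzero index, since `birthTime e 0 = 0 ≤ t`; the natural
  -- subtraction is therefore a true one.
  refine ⟨Nat.find hex - 1, fun n => ?_⟩
  have h0 : Nat.find hex ≠ 0 := by
    intro h0
    have := Nat.find_spec hex
    rw [h0, birthTime_zero] at this
    linarith
  constructor
  · intro h
    by_contra! h2
    have h3 := Nat.find_spec hex
    have h4 := monotone_birthTime he.1 (show Nat.find hex ≤ n by omega)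
    linarith
  · intro h
    exact not_lt.1 (Nat.find_min hex (m := n) (by omega))

lemma population_eq_of_forall_iff {e : ℕ → ℝ} {t : ℝ} {N : ℕ}
    (hN : ∀ n, birthTime e n ≤ t ↔ n ≤ N) : population e t = N + 1 := by
  unfold population
  rw [tsum_eq_sum (s := Finset.range (N + 1))]
  · rw [Finset.sum_congr rfl (g := fun _ => 1)]
    · simp
    · intro n hn
      have := (hN n).2 (by simpa [Nat.lt_succ_iff] using hn)
      simp [Set.indicator, this]
  · intro n hn
    have : ¬ birthTime e n ≤ t := fun h => hn (by simpa [Nat.lt_succ_iff] using (hN n).1 h)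
    simp [Set.indicator, this]

lemma yule_def' (e : ℕ → ℝ) (t : ℝ) : yule e t = 1 + {n : ℕ | birthTime e (n + 1) ≤ t}.ncard := rfl

lemma yule_eq_of_forall_iff {e : ℕ → ℝ} {t : ℝ} {N : ℕ}
    (hN : ∀ n, birthTime e n ≤ t ↔ n ≤ N) : yule e t = N + 1 := by
  rw [yule_def']
  have : {n : ℕ | birthTime e (n + 1) ≤ t} = ↑(Finset.range N) := by
    ext n; simp [hN]
  rw [this, Set.ncard_coe_finset, Finset.card_range, add_comm]

/-- Regularity matters: with infinitely many births `ncard` would return `0` while the sum is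
infinite. -/
lemma Regular.yule_eq_population {e : ℕ → ℝ} (he : Regular e) {t : ℝ} (ht : 0 ≤ t) :
    (yule e t : ℝ≥0∞) = population e t := by
  obtain ⟨N, hN⟩ := he.exists_birthTime_le_iff ht
  rw [yule_eq_of_forall_iff hN, population_eq_of_forall_iff hN]
  simp

lemma Regular.yule_mono {e : ℕ → ℝ} (he : Regular e) {s t : ℝ} (hs : 0 ≤ s) (hst : s ≤ t) :
    yule e s ≤ yule e t := by
  have := population_mono e hst
  rw [← he.yule_eq_population hs, ← he.yule_eq_population (hs.trans hst)] at this
  exact_mod_cast this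

/-- Paths of the Yule process are locally constant on the right. -/
lemma Regular.yule_eventuallyEq {e : ℕ → ℝ} (he : Regular e) {t : ℝ} (ht : 0 ≤ t) :
    ∀ᶠ s in 𝓝[≥] t, yule e s = yule e t := by
  obtain ⟨N, hN⟩ := he.exists_birthTime_le_iff ht
  have h1 : t < birthTime e (N + 1) := by
    by_contra! h
    have := (hN _).1 h
    omega
  filter_upwards [Ico_mem_nhdsGE h1] with s hs
  rw [yule_eq_of_forall_iff hN]
  refine yule_eq_of_forall_iff fun n => ⟨fun h => ?_, fun h => ((hN n).2 h).trans hs.1⟩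
  by_contra! h2
  have := monotone_birthTime he.1 (show N + 1 ≤ n by omega)
  linarith [hs.2]

lemma one_le_yule (e : ℕ → ℝ) (t : ℝ) : 1 ≤ yule e t := Nat.le_add_right _ _

/-- The count is recovered from a measurable sum of indicators. The identity holds at every point,
also without regularity, because `toReal` sends `∞` to `0` just as `ncard` does for infinite sets.
-/
lemma measurable_yule_prod : Measurable (fun q : (ℕ → ℝ) × ℝ => yule q.1 q.2) := by
  have h1 : ∀ q : (ℕ → ℝ) × ℝ, yule q.1 q.2 =
      1 + ⌊(∑' n, {q : (ℕ → ℝ) × ℝ | birthTime q.1 (n + 1) ≤ q.2}.indicator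
        (1 : (ℕ → ℝ) × ℝ → ℝ≥0∞) q).toReal⌋₊ := by
    intro q
    rw [yule_def']
    congr 1
    set s : Set ℕ := {n : ℕ | birthTime q.1 (n + 1) ≤ q.2} with hs
    have h2 : ∑' n, {q : (ℕ → ℝ) × ℝ | birthTime q.1 (n + 1) ≤ q.2}.indicator
        (1 : (ℕ → ℝ) × ℝ → ℝ≥0∞) q = (s.encard : ℝ≥0∞) := by
      rw [← ENNReal.tsum_set_one, tsum_subtype s (fun _ => (1 : ℝ≥0∞))]
      rfl
    rw [h2]
    rcases s.finite_or_infinite with hf | hf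
    · rw [← hf.cast_ncard_eq]
      simp
    · rw [hf.encard_eq, hf.ncard]
      simp
  simp_rw [h1]
  refine Measurable.const_add (Nat.measurable_floor.comp (Measurable.ennreal_toReal
    (Measurable.tsum fun n => ?_))) 1
  exact measurable_one.indicator (measurableSet_le
    ((measurable_birthTime _).comp measurable_fst) measurable_snd)

lemma measurable_yule (t : ℝ) : Measurable (fun e => yule e t) :=
  Measurable.comp (g := fun q : (ℕ → ℝ) × ℝ => yule q.1 q.2) (f := fun e => (e, t))
    measurable_yule_prod (measurable_id.prodMk measurable_const)

/-! ### Moments -/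

/-- The square `(N + 1) ^ 2` is at most `∑ n ≤ N, 2 (n + 1)`, so the second moment is bounded by
twice the series `∑ (n + 1) x ^ n = (1 - x) ^ (-2)` at `x = 1 - exp (-t)`. -/
lemma lintegral_yule_sq_le {t : ℝ} (ht : 0 ≤ t) :
    ∫⁻ e, (yule e t : ℝ≥0∞) ^ 2 ∂holdingTimes ≤ ENNReal.ofReal (2 * Real.exp t ^ 2) := by
  have h1 := one_sub_exp_neg_nonneg ht
  have h2 : 1 - Real.exp (-t) < 1 := by linarith [Real.exp_pos (-t)]
  calc ∫⁻ e, (yule e t : ℝ≥0∞) ^ 2 ∂holdingTimes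
      ≤ ∫⁻ e, ∑' n : ℕ, (2 * ((n : ℝ≥0∞) + 1)) *
          {e | birthTime e n ≤ t}.indicator 1 e ∂holdingTimes := by
        refine lintegral_mono_ae ?_
        filter_upwards [ae_regular] with e he
        obtain ⟨N, hN⟩ := he.exists_birthTime_le_iff ht
        rw [yule_eq_of_forall_iff hN]
        refine le_trans ?_ (ENNReal.sum_le_tsum (Finset.range (N + 1)))
        have h3 : ∀ n ∈ Finset.range (N + 1), (2 * ((n : ℝ≥0∞) + 1)) *
            {e | birthTime e n ≤ t}.indicator 1 e = ((2 * (n + 1) : ℕ) : ℝ≥0∞) := by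
          intro n hn
          have := (hN n).2 (by simpa [Nat.lt_succ_iff] using hn)
          simp [Set.indicator, this]
        rw [Finset.sum_congr rfl h3, ← Nat.cast_sum, ← Nat.cast_pow]
        refine Nat.cast_le.2 ?_
        clear h3 hN
        induction N with
        | zero => simp
        | succ N ih => rw [Finset.sum_range_succ]; nlinarith
    _ = ∑' n : ℕ, ENNReal.ofReal (2 * (((n + 1).choose 1 : ℝ) * (1 - Real.exp (-t)) ^ n)) := by
        rw [lintegral_tsum fun n => ((measurable_one.indicator
          (measurableSet_birthTime_le n t)).const_mul _).aemeasurable]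
        congr 1
        funext n
        rw [lintegral_const_mul _ (measurable_one.indicator (measurableSet_birthTime_le n t)),
          lintegral_indicator_one (measurableSet_birthTime_le n t),
          holdingTimes_birthTime_le n ht, Nat.choose_one_right, ← mul_assoc,
          ENNReal.ofReal_mul (by positivity)]
        congr 1
        rw [ENNReal.ofReal_mul (by norm_num), ENNReal.ofReal_natCast]
        simp
    _ = ENNReal.ofReal (2 * Real.exp t ^ 2) := by
        have h4 : ‖1 - Real.exp (-t)‖ < 1 := by rwa [Real.norm_of_nonneg h1]
        have h5 := hasSum_choose_mul_geometric_of_norm_lt_one 1 h4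
        have h6 := h5.mul_left 2
        rw [← ENNReal.ofReal_tsum_of_nonneg (fun n => by positivity) h6.summable, h6.tsum_eq]
        congr 2
        rw [sub_sub_cancel, Real.exp_neg]
        simp

/-! ### The martingale property of the Yule process -/

/-- The population among the first `n + 1` individuals. -/
noncomputable def truncYule (n : ℕ) (e : ℕ → ℝ) (t : ℝ) : ℕ :=
  1 + ∑ m ∈ Finset.range n, {e | birthTime e (m + 1) ≤ t}.indicator 1 e

lemma measurable_truncYule (n : ℕ) (t : ℝ) : Measurable (fun e => truncYule n e t) :=
  (Finset.measurable_sum _ fun _ _ =>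
    measurable_one.indicator (measurableSet_birthTime_le _ t)).const_add 1

lemma truncYule_firstTimes (n : ℕ) (e : ℕ → ℝ) (t : ℝ) :
    truncYule n (firstTimes n e) t = truncYule n e t := by
  unfold truncYule
  congr 1
  refine Finset.sum_congr rfl fun m hm => ?_
  simp [Set.indicator, birthTime_firstTimes (Nat.succ_le_iff.2 (Finset.mem_range.1 hm))]

/-- As long as birth `n + 1` lies after `u`, the path up to `u` depends on the first `n` holding
times alone, hence is independent of the next one. -/
lemma truncYule_eq_yule {n : ℕ} {e : ℕ → ℝ} (he : ∀ n, 0 ≤ e n) {u v : ℝ} (hv : v ≤ u)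
    (hu : u < birthTime e (n + 1)) : truncYule n e v = yule e v := by
  rw [yule_def']
  unfold truncYule
  congr 1
  classical
  have : {m : ℕ | birthTime e (m + 1) ≤ v} =
      ↑((Finset.range n).filter fun m => birthTime e (m + 1) ≤ v) := by
    ext m
    simp only [Set.mem_ofPred_eq, Finset.coe_filter, Finset.mem_range, iff_and_self]
    intro h
    by_contra! h2
    have := monotone_birthTime he (show n + 1 ≤ m + 1 by omega)
    linarith
  rw [this, Set.ncard_coe_finset, Finset.card_filter]
  simp [Set.indicator]

variable {ι : Type*} [Finite ι]

/-- Given the first `n` holding times, the next one is exponential of rate `n + 1`; its compensator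
identity replaces the birth in `(u, t]` by `n + 1` times the time spent there in state `n + 1`. The
past is frozen by passing to `truncYule`, legitimate on the event that the birth comes after `u`. -/
lemma lintegral_birth_eq (n : ℕ) {u t : ℝ} {v : ι → ℝ} (hv : ∀ i, v i ≤ u)
    (A : Set (ι → ℕ)) :
    ∫⁻ e, {e | u < birthTime e (n + 1) ∧ birthTime e (n + 1) ≤ t}.indicator 1 e *
        A.indicator 1 (fun i => yule e (v i)) ∂holdingTimes =
      ((n : ℝ≥0∞) + 1) * ∫⁻ e, (∫⁻ s in Set.Ioc u t,
        {s | birthTime e n ≤ s ∧ s < birthTime e (n + 1)}.indicator 1 s *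
          A.indicator 1 (fun i => yule e (v i))) ∂holdingTimes := by
  set V : (ℕ → ℝ) → ι → ℕ := fun e i => truncYule n e (v i) with hV
  have hVm : Measurable V := measurable_pi_lambda _ fun i => measurable_truncYule n (v i)
  have hA : MeasurableSet A := A.to_countable.measurableSet
  have hAm : Measurable (fun e => A.indicator (1 : (ι → ℕ) → ℝ≥0∞) (V e)) :=
    (measurable_one.indicator hA).comp hVm
  have hVf : ∀ e, V (firstTimes n e) = V e := fun e => by
    funext i; exact truncYule_firstTimes n e (v i)
  have hVy : ∀ e : ℕ → ℝ, (∀ n, 0 ≤ e n) → u < birthTime e (n + 1) →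
      V e = fun i => yule e (v i) := fun e he hu => by
    funext i; exact truncYule_eq_yule he (hv i) hu
  set h : (ℕ → ℝ) → ℝ → ℝ≥0∞ := fun e x =>
    (Set.Ioc u t).indicator 1 (birthTime e n + x) with hh
  have hhm : Measurable (fun q : (ℕ → ℝ) × ℝ => h q.1 q.2) :=
    (measurable_one.indicator measurableSet_Ioc).comp
      (((measurable_birthTime n).comp measurable_fst).add measurable_snd)
  have hhf : ∀ e, h (firstTimes n e) = h e := fun e => by
    funext x; simp only [hh, birthTime_firstTimes le_rfl]
  set f : (ℕ → ℝ) × ℝ → ℝ≥0∞ := fun q => h q.1 q.2 * A.indicator 1 (V q.1) with hf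
  have hfm : Measurable f := hhm.mul (hAm.comp measurable_fst)
  set k : (ℕ → ℝ) × ℝ → ℝ≥0∞ := fun q =>
    (∫⁻ s in Set.Ico 0 q.2, h q.1 s) * A.indicator 1 (V q.1) with hk
  have hkm : Measurable k := by
    refine Measurable.mul ?_ (hAm.comp measurable_fst)
    have h1 : ∀ q : (ℕ → ℝ) × ℝ, ∫⁻ s in Set.Ico 0 q.2, h q.1 s =
        ∫⁻ s, {z : ((ℕ → ℝ) × ℝ) × ℝ | 0 ≤ z.2 ∧ z.2 < z.1.2}.indicator
          (fun z => h z.1.1 z.2) (q, s) := by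
      intro q
      rw [← lintegral_indicator measurableSet_Ico]
      rfl
    simp_rw [h1]
    refine Measurable.lintegral_prod_right' (f := fun z : ((ℕ → ℝ) × ℝ) × ℝ =>
      {z : ((ℕ → ℝ) × ℝ) × ℝ | 0 ≤ z.2 ∧ z.2 < z.1.2}.indicator (fun z => h z.1.1 z.2) z) ?_
    refine Measurable.indicator ?_ ((measurableSet_le measurable_const measurable_snd).inter
      (measurableSet_lt measurable_snd (measurable_snd.comp measurable_fst)))
    exact hhm.comp ((measurable_fst.comp measurable_fst).prodMk measurable_snd)
  calc ∫⁻ e, {e | u < birthTime e (n + 1) ∧ birthTime e (n + 1) ≤ t}.indicator 1 e *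
        A.indicator 1 (fun i => yule e (v i)) ∂holdingTimes
      = ∫⁻ e, f (firstTimes n e, e n) ∂holdingTimes := by
        refine lintegral_congr_ae ?_
        filter_upwards [ae_holdingTimes_nonneg] with e he
        simp only [hf, hhf, hVf]
        simp only [hh, ← birthTime_succ]
        by_cases hu : u < birthTime e (n + 1)
        · rw [hVy e he hu]
          rfl
        · simp [Set.indicator, hu]
    _ = ∫⁻ e, ∫⁻ x, f (firstTimes n e, x) ∂(holdingLaw n) ∂holdingTimes :=
        lintegral_firstTimes_prod n hfm
    _ = ∫⁻ e, ((n : ℝ≥0∞) + 1) * ∫⁻ x, k (firstTimes n e, x) ∂(holdingLaw n) ∂holdingTimes := by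
        refine lintegral_congr fun e => ?_
        simp only [hf, hk, hhf, hVf]
        have h1 : Measurable (h e) := hhm.comp (measurable_const.prodMk measurable_id)
        rw [lintegral_mul_const _ h1, holdingLaw,
          lintegral_expMeasure_eq_compensator (by positivity) h1,
          lintegral_mul_const' _ _ (by
            simp only [Set.indicator]; split_ifs <;> simp), mul_assoc]
        congr 1
        rw [ENNReal.ofReal_add (by positivity) zero_le_one]
        simp
    _ = ((n : ℝ≥0∞) + 1) * ∫⁻ e, k (firstTimes n e, e n) ∂holdingTimes := by
        rw [lintegral_const_mul' _ _ (by simp), lintegral_firstTimes_prod n hkm]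
    _ = _ := by
        congr 1
        refine lintegral_congr_ae ?_
        filter_upwards [ae_holdingTimes_nonneg] with e he
        simp only [hk, hhf, hVf]
        rw [lintegral_mul_const' _ _ (by simp only [Set.indicator]; split_ifs <;> simp)]
        have h1 : ∫⁻ s in Set.Ico 0 (e n), h e s =
            ∫⁻ s in Set.Ioc u t,
              {s | birthTime e n ≤ s ∧ s < birthTime e (n + 1)}.indicator 1 s := by
          rw [← lintegral_indicator measurableSet_Ico, ← lintegral_indicator measurableSet_Ioc]
          refine Eq.trans ?_ (lintegral_add_left_eq_self _ (birthTime e n))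
          refine lintegral_congr fun s => ?_
          simp only [hh, Set.indicator, Set.mem_Ico, Set.mem_Ioc, Set.mem_ofPred_eq,
            birthTime_succ, le_add_iff_nonneg_right, add_lt_add_iff_left, Pi.one_apply]
          split_ifs <;> rfl
        rw [h1]
        -- Where `truncYule` and `yule` may differ, the occupation time of `(u, t]` is zero, so the
        -- past factor is irrelevant.
        by_cases hu : u < birthTime e (n + 1)
        · rw [hVy e he hu]
        · have : ∫⁻ s in Set.Ioc u t,
              {s | birthTime e n ≤ s ∧ s < birthTime e (n + 1)}.indicator
                (1 : ℝ → ℝ≥0∞) s = 0 := by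
            rw [setLIntegral_congr_fun (g := 0) measurableSet_Ioc]
            · simp
            · intro s hs
              have : ¬ s < birthTime e (n + 1) := fun h => hu (hs.1.trans h)
              simp [Set.indicator, this]
          rw [this, zero_mul, zero_mul]

end ReinforcedLevy

/-! ### The integral equation for the mean population and the Yule martingale -/

namespace ReinforcedLevy

/-- Solutions of `F t = F u + ∫ s in u..t, F s` are exponential. -/
lemma eq_exp_mul_of_lintegral_eq {F : ℝ → ℝ≥0∞} {u : ℝ} (hmono : MonotoneOn F (Set.Ici u))
    (hfin : ∀ t, u ≤ t → F t ≠ ∞)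
    (hF : ∀ t, u ≤ t → F t = F u + ∫⁻ s in Set.Ioc u t, F s) {t : ℝ} (ht : u ≤ t) :
    F t = ENNReal.ofReal (Real.exp (t - u)) * F u := by
  -- Freezing `F` to the left of `u` gives a function monotone on the whole line, hence interval
  -- integrable before any continuity is known.
  set f : ℝ → ℝ := fun s => (F (max s u)).toReal with hf
  have hfmono : Monotone f := fun a b hab => by
    refine ENNReal.toReal_mono (hfin _ (le_max_right _ _)) ?_
    exact hmono (Set.mem_Ici.2 (le_max_right _ _)) (Set.mem_Ici.2 (le_max_right _ _)) (max_le_max_right u hab)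
  have hint : ∀ a b, IntervalIntegrable f volume a b := fun a b =>
    (hfmono.monotoneOn _).intervalIntegrable
  set G : ℝ → ℝ := fun s => ∫ x in u..s, f x with hG
  have hGc : Continuous G := intervalIntegral.continuous_primitive hint u
  have hfG : ∀ s, u ≤ s → f s = f u + G s := by
    intro s hs
    have h1 : ENNReal.ofReal (G s) = ∫⁻ x in Set.Ioc u s, F x := by
      rw [hG]
      simp only
      rw [intervalIntegral.integral_of_le hs, ofReal_integral_eq_lintegral_ofReal
        ((intervalIntegrable_iff_integrableOn_Ioc_of_le hs).1 (hint u s))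
        (ae_of_all _ fun x => ENNReal.toReal_nonneg)]
      refine setLIntegral_congr_fun measurableSet_Ioc fun x hx => ?_
      simp only [hf]
      rw [ENNReal.ofReal_toReal (hfin _ (le_max_right _ _)), max_eq_left hx.1.le]
    have h2 : 0 ≤ G s := intervalIntegral.integral_nonneg hs fun x _ => ENNReal.toReal_nonneg
    simp only [hf]
    rw [max_eq_left hs, max_self, hF s hs, ← h1,
      ENNReal.toReal_add (hfin u le_rfl) ENNReal.ofReal_ne_top, ENNReal.toReal_ofReal h2]
  -- Bootstrap: `f` is a constant plus a primitive, so it is continuous, and then the primitive is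
  -- differentiable with derivative `f`.
  have hfc : Continuous f := by
    have : f = fun s => f u + G (max s u) := by
      funext s
      rw [← hfG _ (le_max_right s u)]
      simp [hf]
    rw [this]
    exact continuous_const.add (hGc.comp (continuous_id.max continuous_const))
  have hGd : ∀ s, HasDerivAt G (f s) s := fun s =>
    intervalIntegral.integral_hasDerivAt_right (hint u s)
      hfc.stronglyMeasurable.stronglyMeasurableAtFilter hfc.continuousAt
  have hH : ∀ s, HasDerivAt (fun s => (f u + G s) * Real.exp (-(s - u)))
      (f s * Real.exp (-(s - u)) + (f u + G s) * (Real.exp (-(s - u)) * (-1))) s := fun s =>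
    ((hGd s).const_add (f u)).mul (((hasDerivAt_id s).sub_const u).neg.exp)
  have hconst := constant_of_has_deriv_right_zero (a := u) (b := t)
    (f := fun s => (f u + G s) * Real.exp (-(s - u)))
    (fun s _ => (hH s).continuousAt.continuousWithinAt) (fun s hs => by
      have h := (hH s).hasDerivWithinAt (s := Set.Ici s)
      rw [← hfG s hs.1] at h
      convert h using 1
      ring) t ⟨ht, le_rfl⟩
  simp only [← hfG t ht] at hconst
  have hGu : G u = 0 := by simp [hG]
  rw [hGu] at hconst
  simp only [sub_self, neg_zero, Real.exp_zero, mul_one, add_zero] at hconst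
  have h3 : f t = Real.exp (t - u) * f u := by
    rw [← hconst, mul_comm (f t), ← mul_assoc, ← Real.exp_add]
    simp
  simp only [hf, max_self, max_eq_left ht] at h3
  rw [← ENNReal.ofReal_toReal (hfin t ht), h3, ENNReal.ofReal_mul (Real.exp_pos _).le,
    ENNReal.ofReal_toReal (hfin u le_rfl)]

variable {ι : Type*} [Finite ι]

lemma measurable_indicator_yule (v : ι → ℝ) (A : Set (ι → ℕ)) :
    Measurable (fun e => A.indicator (1 : (ι → ℕ) → ℝ≥0∞) (fun i => yule e (v i))) :=
  (measurable_one.indicator A.to_countable.measurableSet).comp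
    (measurable_pi_lambda _ fun i => measurable_yule (v i))

lemma population_eq_add (e : ℕ → ℝ) {u t : ℝ} (hu : 0 ≤ u) (hut : u ≤ t) :
    population e t = population e u +
      ∑' n, {e | u < birthTime e (n + 1) ∧ birthTime e (n + 1) ≤ t}.indicator 1 e := by
  have h1 : ∑' n, {e | u < birthTime e (n + 1) ∧ birthTime e (n + 1) ≤ t}.indicator
      (1 : (ℕ → ℝ) → ℝ≥0∞) e =
      ∑' n, {e | u < birthTime e n ∧ birthTime e n ≤ t}.indicator 1 e := by
    rw [tsum_eq_zero_add' (f := fun n =>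
      {e | u < birthTime e n ∧ birthTime e n ≤ t}.indicator (1 : (ℕ → ℝ) → ℝ≥0∞) e)
      ENNReal.summable]
    simp [Set.indicator, not_lt.2 hu]
  rw [h1]
  unfold population
  rw [← ENNReal.tsum_add]
  congr 1
  funext n
  by_cases h2 : birthTime e n ≤ u
  · simp [Set.indicator, h2, h2.trans hut, not_lt.2 h2]
  · by_cases h3 : birthTime e n ≤ t <;> simp [Set.indicator, h2, h3, not_le.1 h2]

/-- At time `s` exactly one index satisfies `T_n ≤ s < T_{n+1}`, and its birth rate `n + 1` is the
population. -/
lemma Regular.tsum_occupation {e : ℕ → ℝ} (he : Regular e) {s : ℝ} (hs : 0 ≤ s) :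
    ∑' n : ℕ, ((n : ℝ≥0∞) + 1) *
      {s | birthTime e n ≤ s ∧ s < birthTime e (n + 1)}.indicator 1 s = population e s := by
  obtain ⟨N, hN⟩ := he.exists_birthTime_le_iff hs
  rw [population_eq_of_forall_iff hN, tsum_eq_single N]
  · have h1 := (hN N).2 le_rfl
    have h2 : s < birthTime e (N + 1) := by
      by_contra! h
      have := (hN _).1 h
      omega
    simp [Set.indicator, h1, h2]
  · intro n hn
    have : ¬ (birthTime e n ≤ s ∧ s < birthTime e (n + 1)) := by
      rintro ⟨h1, h2⟩
      have h3 := (hN _).1 h1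
      have h4 := mt (hN _).2 (not_le.2 h2)
      omega
    simp [Set.indicator, this]

/-- The population at `t` is that at `u` plus the births in `(u, t]`. Summing the compensators of
all births makes the total birth rate appear, which is again the population: this is the linear
integral equation solved by the exponential. -/
lemma lintegral_population_indicator_eq {u t : ℝ} (hu : 0 ≤ u) (hut : u ≤ t) {v : ι → ℝ}
    (hv : ∀ i, v i ≤ u) (A : Set (ι → ℕ)) :
    ∫⁻ e, population e t * A.indicator 1 (fun i => yule e (v i)) ∂holdingTimes =
      ∫⁻ e, population e u * A.indicator 1 (fun i => yule e (v i)) ∂holdingTimes +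
      ∫⁻ s in Set.Ioc u t,
        ∫⁻ e, population e s * A.indicator 1 (fun i => yule e (v i)) ∂holdingTimes := by
  have hA := measurable_indicator_yule v A
  have hocc : ∀ n, Measurable (fun q : (ℕ → ℝ) × ℝ =>
      {s | birthTime q.1 n ≤ s ∧ s < birthTime q.1 (n + 1)}.indicator (1 : ℝ → ℝ≥0∞) q.2) := by
    intro n
    have hm : MeasurableSet {q : (ℕ → ℝ) × ℝ | birthTime q.1 n ≤ q.2 ∧
        q.2 < birthTime q.1 (n + 1)} :=
      (measurableSet_le ((measurable_birthTime n).comp measurable_fst) measurable_snd).inter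
      (measurableSet_lt measurable_snd ((measurable_birthTime (n + 1)).comp measurable_fst))
    exact measurable_one.indicator hm
  have hmb : ∀ n, Measurable (fun e => {e | u < birthTime e (n + 1) ∧
      birthTime e (n + 1) ≤ t}.indicator (1 : (ℕ → ℝ) → ℝ≥0∞) e) := fun n =>
    measurable_one.indicator ((measurableSet_lt measurable_const
      (measurable_birthTime (n + 1))).inter (measurableSet_birthTime_le _ _))
  simp_rw [population_eq_add _ hu hut, add_mul]
  rw [lintegral_add_left ((measurable_population u).fun_mul hA)]
  congr 1
  simp_rw [← ENNReal.tsum_mul_right]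
  rw [lintegral_tsum fun n => ((hmb n).fun_mul hA).aemeasurable]
  simp_rw [lintegral_birth_eq _ hv A]
  have hsw : ∀ n : ℕ, ((n : ℝ≥0∞) + 1) * ∫⁻ e, (∫⁻ s in Set.Ioc u t,
        {s | birthTime e n ≤ s ∧ s < birthTime e (n + 1)}.indicator 1 s *
          A.indicator 1 (fun i => yule e (v i))) ∂holdingTimes =
      ∫⁻ s in Set.Ioc u t, ∫⁻ e, ((n : ℝ≥0∞) + 1) *
        ({s | birthTime e n ≤ s ∧ s < birthTime e (n + 1)}.indicator 1 s *
          A.indicator 1 (fun i => yule e (v i))) ∂holdingTimes := by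
    intro n
    rw [lintegral_lintegral_swap ((hocc n).mul (hA.comp measurable_fst)).aemeasurable,
      ← lintegral_const_mul' _ _ (by simp)]
    refine lintegral_congr fun s => ?_
    rw [lintegral_const_mul' _ _ (by simp)]
  simp_rw [hsw]
  have hm3 : ∀ n : ℕ, Measurable (fun q : ℝ × (ℕ → ℝ) => ((n : ℝ≥0∞) + 1) *
        ({s | birthTime q.2 n ≤ s ∧ s < birthTime q.2 (n + 1)}.indicator 1 q.1 *
          A.indicator 1 (fun i => yule q.2 (v i)))) := fun n =>
    (((hocc n).comp measurable_swap).mul (hA.comp measurable_snd)).const_mul _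
  rw [← lintegral_tsum fun n => (Measurable.lintegral_prod_right' (hm3 n)).aemeasurable]
  refine setLIntegral_congr_fun measurableSet_Ioc fun s hs => ?_
  have hm4 : ∀ n : ℕ, Measurable (fun e : ℕ → ℝ => ((n : ℝ≥0∞) + 1) *
        ({s | birthTime e n ≤ s ∧ s < birthTime e (n + 1)}.indicator 1 s *
          A.indicator 1 (fun i => yule e (v i)))) := fun n => by
    have h := (hm3 n).comp (measurable_prodMk_left (x := s))
    exact h
  simp only
  rw [← lintegral_tsum fun n => (hm4 n).aemeasurable]
  refine lintegral_congr_ae ?_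
  filter_upwards [ae_regular] with e he
  simp_rw [← mul_assoc]
  rw [ENNReal.tsum_mul_right, he.tsum_occupation (hu.trans hs.1.le)]

/-- The process `exp (-t) * Z t` is a martingale, in integrated form. -/
lemma lintegral_yule_indicator {u t : ℝ} (hu : 0 ≤ u) (hut : u ≤ t) {v : ι → ℝ}
    (hv : ∀ i, v i ≤ u) (A : Set (ι → ℕ)) :
    ∫⁻ e, (yule e t : ℝ≥0∞) * A.indicator 1 (fun i => yule e (v i)) ∂holdingTimes =
      ENNReal.ofReal (Real.exp (t - u)) *
        ∫⁻ e, (yule e u : ℝ≥0∞) * A.indicator 1 (fun i => yule e (v i)) ∂holdingTimes := by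
  have hpop : ∀ s, 0 ≤ s →
      ∫⁻ e, (yule e s : ℝ≥0∞) * A.indicator 1 (fun i => yule e (v i)) ∂holdingTimes =
      ∫⁻ e, population e s * A.indicator 1 (fun i => yule e (v i)) ∂holdingTimes := by
    intro s hs
    refine lintegral_congr_ae ?_
    filter_upwards [ae_regular] with e he
    rw [he.yule_eq_population hs]
  rw [hpop t (hu.trans hut), hpop u hu]
  refine eq_exp_mul_of_lintegral_eq (F := fun s =>
    ∫⁻ e, population e s * A.indicator 1 (fun i => yule e (v i)) ∂holdingTimes) ?_ ?_ ?_ hut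
  · intro a _ b _ hab
    exact lintegral_mono fun e => mul_le_mul_left (population_mono e hab) _
  · intro s hs
    refine ne_top_of_le_ne_top (b := ∫⁻ e, population e s ∂holdingTimes) ?_ ?_
    · rw [lintegral_population (hu.trans hs)]
      exact ENNReal.ofReal_ne_top
    · refine lintegral_mono fun e => ?_
      refine mul_le_of_le_one_right' ?_
      simp only [Set.indicator]; split_ifs <;> simp
  · intro s hs
    exact lintegral_population_indicator_eq hu hs hv A

end ReinforcedLevy

/-! ### Functionals of the Yule past and moments of fractional order -/

namespace ReinforcedLevy

section
variable {ι : Type*} [Finite ι]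

/-- The laws of the past weighted by `Z t` and by `Z u` are proportional as measures on a countable
space. Hence the identity holds for every `g`, with no integrability requirement: both integrals
take the default value together. -/
lemma integral_yule_mul {u t : ℝ} (hu : 0 ≤ u) (hut : u ≤ t) {v : ι → ℝ}
    (hv : ∀ i, v i ≤ u) (g : (ι → ℕ) → ℂ) :
    ∫ e, (yule e t : ℂ) * g (fun i => yule e (v i)) ∂holdingTimes =
      Real.exp (t - u) * ∫ e, (yule e u : ℂ) * g (fun i => yule e (v i)) ∂holdingTimes := by
  have hV : Measurable (fun (e : ℕ → ℝ) i => yule e (v i)) :=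
    measurable_pi_lambda _ fun i => measurable_yule (v i)
  have hg : Measurable g := measurable_of_countable g
  have hd : ∀ s, Measurable (fun e => (yule e s : ℝ≥0∞)) := fun s =>
    measurable_from_top.comp (measurable_yule s)
  set μ : ℝ → Measure (ι → ℕ) := fun s =>
    (holdingTimes.withDensity (fun e => (yule e s : ℝ≥0∞))).map
      (fun (e : ℕ → ℝ) i => yule e (v i)) with hμ
  have h1 : ∀ s, ∫ e, (yule e s : ℂ) * g (fun i => yule e (v i)) ∂holdingTimes =
      ∫ y, g y ∂(μ s) := by
    intro s
    rw [hμ]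
    simp only
    rw [integral_map hV.aemeasurable hg.aestronglyMeasurable,
      integral_withDensity_eq_integral_toReal_smul (hd s) (ae_of_all _ fun e => by simp)]
    refine integral_congr_ae (ae_of_all _ fun e => ?_)
    simp
  have h2 : ∀ s (A : Set (ι → ℕ)), μ s A =
      ∫⁻ e, (yule e s : ℝ≥0∞) * A.indicator 1 (fun i => yule e (v i)) ∂holdingTimes := by
    intro s A
    have hA : MeasurableSet A := A.to_countable.measurableSet
    rw [hμ]
    simp only
    rw [Measure.map_apply hV hA, withDensity_apply _ (hV hA), ← lintegral_indicator (hV hA)]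
    refine lintegral_congr fun e => ?_
    by_cases h : (fun i => yule e (v i)) ∈ A
    · rw [Set.indicator_of_mem h, Set.indicator_of_mem (Set.mem_preimage.2 h)]
      simp
    · rw [Set.indicator_of_notMem h, Set.indicator_of_notMem (mt Set.mem_preimage.1 h), mul_zero]
  have h3 : μ t = ENNReal.ofReal (Real.exp (t - u)) • μ u := by
    ext A _
    rw [Measure.smul_apply, h2, h2, smul_eq_mul]
    exact lintegral_yule_indicator hu hut hv A
  rw [h1, h1, h3, integral_smul_measure, ENNReal.toReal_ofReal (Real.exp_pos _).le]
  simp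

end

/-- Interpolation at the scale `m = exp t` of the mean: `z ^ r ≤ m ^ r` below `m`, and `z ^ r ≤ m ^
(r - 2) * z ^ 2` above it since `r ≤ 2`. The second moment bound `2 m ^ 2` then yields the constant
`3`. -/
lemma lintegral_yule_rpow_le {t r : ℝ} (ht : 0 ≤ t) (hr0 : 0 ≤ r) (hr : r ≤ 2) :
    ∫⁻ e, ENNReal.ofReal ((yule e t : ℝ) ^ r) ∂holdingTimes ≤
      ENNReal.ofReal (3 * Real.exp t ^ r) := by
  set m := Real.exp t with hm
  have hm0 : 0 < m := Real.exp_pos t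
  have h1 : ∀ z : ℝ, 0 ≤ z → z ^ r ≤ m ^ (r - 2) * z ^ 2 + m ^ r := by
    intro z hz
    rcases le_total z m with h | h
    · have := Real.rpow_le_rpow hz h hr0
      have : 0 ≤ m ^ (r - 2) * z ^ 2 := by positivity
      linarith
    · have hz0 : 0 < z := hm0.trans_le h
      have h2 : z ^ (r - 2) ≤ m ^ (r - 2) :=
        Real.rpow_le_rpow_of_nonpos hm0 h (by linarith)
      have h3 : z ^ r = z ^ (r - 2) * z ^ 2 := by
        rw [← Real.rpow_natCast z 2, ← Real.rpow_add hz0]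
        congr 1; push_cast; ring
      have : 0 ≤ m ^ r := by positivity
      have := mul_le_mul_of_nonneg_right h2 (sq_nonneg z)
      linarith
  calc ∫⁻ e, ENNReal.ofReal ((yule e t : ℝ) ^ r) ∂holdingTimes
      ≤ ∫⁻ e, (ENNReal.ofReal (m ^ (r - 2)) * (yule e t : ℝ≥0∞) ^ 2 +
          ENNReal.ofReal (m ^ r)) ∂holdingTimes := by
        refine lintegral_mono fun e => ?_
        refine (ENNReal.ofReal_le_ofReal (h1 _ (Nat.cast_nonneg _))).trans (le_of_eq ?_)
        rw [ENNReal.ofReal_add (by positivity) (by positivity),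
          ENNReal.ofReal_mul (by positivity), ENNReal.ofReal_pow (by positivity),
          ENNReal.ofReal_natCast]
    _ = ENNReal.ofReal (m ^ (r - 2)) * ∫⁻ e, (yule e t : ℝ≥0∞) ^ 2 ∂holdingTimes +
          ENNReal.ofReal (m ^ r) := by
        rw [lintegral_add_right _ measurable_const,
          lintegral_const_mul' _ _ ENNReal.ofReal_ne_top]
        simp
    _ ≤ ENNReal.ofReal (m ^ (r - 2)) * ENNReal.ofReal (2 * m ^ 2) + ENNReal.ofReal (m ^ r) := by
        gcongr
        exact lintegral_yule_sq_le ht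
    _ = ENNReal.ofReal (3 * m ^ r) := by
        rw [← ENNReal.ofReal_mul (by positivity), ← ENNReal.ofReal_add (by positivity)
          (by positivity)]
        congr 1
        have h3 : m ^ r = m ^ (r - 2) * m ^ 2 := by
          rw [← Real.rpow_natCast m 2, ← Real.rpow_add hm0]
          congr 1; push_cast; ring
        rw [h3]; ring

/-! ### Yule–Simon processes -/

instance : IsProbabilityMeasure (volume.restrict (Set.Icc (0 : ℝ) 1)) :=
  ⟨by simp⟩

instance : IsProbabilityMeasure yuleSimonMeasure := by
  unfold yuleSimonMeasure; infer_instance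

/-- A sample point where the Yule–Simon process has its usual path properties. -/
def GoodPoint (w : ℝ × (ℕ → ℝ)) : Prop := 0 < w.1 ∧ w.1 ≤ 1 ∧ Regular w.2

lemma ae_goodPoint : ∀ᵐ w ∂yuleSimonMeasure, GoodPoint w := by
  have h1 : ∀ᵐ x ∂(volume.restrict (Set.Icc (0 : ℝ) 1)), 0 < x ∧ x ≤ 1 := by
    rw [restrict_Ioc_eq_restrict_Icc.symm]
    exact (ae_restrict_iff' measurableSet_Ioc).2 (ae_of_all _ fun x hx => hx)
  have h2 := (Measure.quasiMeasurePreserving_fst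
    (μ := volume.restrict (Set.Icc (0 : ℝ) 1)) (ν := holdingTimes)).ae h1
  have h3 := (Measure.quasiMeasurePreserving_snd
    (μ := volume.restrict (Set.Icc (0 : ℝ) 1)) (ν := holdingTimes)).ae ae_regular
  unfold yuleSimonMeasure
  filter_upwards [h2, h3] with w hw1 hw2 using ⟨hw1.1, hw1.2, hw2⟩

lemma measurable_yuleSimon (p t : ℝ) : Measurable (yuleSimon p t) := by
  unfold yuleSimon
  refine Measurable.ite (measurableSet_le measurable_fst measurable_const) ?_ measurable_const
  have h1 : Measurable (fun w : ℝ × (ℕ → ℝ) => (w.2, p * (Real.log t - Real.log w.1))) :=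
    measurable_snd.prodMk
      (((Real.measurable_log.comp measurable_fst).const_sub _).const_mul p)
  have h2 := measurable_yule_prod.comp h1
  exact h2

lemma measurable_yuleSimon_cast (p t : ℝ) : Measurable (fun w => (yuleSimon p t w : ℝ)) :=
  measurable_from_top.comp (measurable_yuleSimon p t)

lemma yule_time_nonneg {p x t : ℝ} (hp : 0 ≤ p) (hx : 0 < x) (hxt : x ≤ t) :
    0 ≤ p * (Real.log t - Real.log x) :=
  mul_nonneg hp (sub_nonneg.2 (Real.log_le_log hx hxt))

lemma GoodPoint.yuleSimon_mono {w : ℝ × (ℕ → ℝ)} (hw : GoodPoint w) {p s t : ℝ} (hp : 0 ≤ p)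
    (hst : s ≤ t) : yuleSimon p s w ≤ yuleSimon p t w := by
  unfold yuleSimon
  by_cases h1 : w.1 ≤ s
  · rw [if_pos h1, if_pos (h1.trans hst)]
    refine hw.2.2.yule_mono (yule_time_nonneg hp hw.1 h1) ?_
    have := Real.log_le_log (hw.1.trans_le h1) hst
    gcongr
  · rw [if_neg h1]; exact Nat.zero_le _

lemma GoodPoint.one_le_yuleSimon {w : ℝ × (ℕ → ℝ)} (hw : GoodPoint w) (p : ℝ) :
    1 ≤ yuleSimon p 1 w := by
  unfold yuleSimon
  rw [if_pos hw.2.1]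
  exact one_le_yule _ _

lemma GoodPoint.yuleSimon_eventuallyEq {w : ℝ × (ℕ → ℝ)} (hw : GoodPoint w) {p t : ℝ}
    (hp : 0 ≤ p) (ht : 0 < t) : ∀ᶠ s in 𝓝[≥] t, yuleSimon p s w = yuleSimon p t w := by
  unfold yuleSimon
  by_cases h1 : w.1 ≤ t
  · have h2 : Tendsto (fun s => p * (Real.log s - Real.log w.1)) (𝓝[≥] t)
        (𝓝[≥] (p * (Real.log t - Real.log w.1))) := by
      refine tendsto_nhdsWithin_iff.2 ⟨?_, ?_⟩
      · exact (((Real.continuousAt_log ht.ne').sub continuousAt_const).const_mul p).tendsto.mono_left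
          nhdsWithin_le_nhds
      · filter_upwards [self_mem_nhdsWithin] with s hs
        have := Real.log_le_log ht hs
        simp only [Set.mem_Ici]
        gcongr
    filter_upwards [h2.eventually (hw.2.2.yule_eventuallyEq (yule_time_nonneg hp hw.1 h1)),
      self_mem_nhdsWithin] with s hs hs2
    rw [if_pos h1, if_pos (h1.trans hs2), hs]
  · filter_upwards [mem_nhdsWithin_of_mem_nhds (Iio_mem_nhds (not_le.1 h1))] with s hs
    rw [if_neg h1, if_neg (not_le.2 hs)]

/-- Given `U = x`, the Yule process has run for the time `-p log x`, so the conditional moment is at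
most `3 x ^ (-p r)`. This is integrable at `0` because `p * r < 1`, which is how admissibility
enters. -/
lemma integrable_yuleSimon_rpow {p r : ℝ} (hp : 0 ≤ p) (hr0 : 0 ≤ r) (hr : r ≤ 2)
    (hpr : p * r < 1) :
    Integrable (fun w => (yuleSimon p 1 w : ℝ) ^ r) yuleSimonMeasure := by
  have hm : Measurable (fun w => (yuleSimon p 1 w : ℝ) ^ r) :=
    (measurable_yuleSimon_cast p 1).pow_const r
  refine ⟨hm.aestronglyMeasurable, ?_⟩
  rw [hasFiniteIntegral_iff_ofReal (ae_of_all _ fun w => by positivity)]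
  unfold yuleSimonMeasure
  rw [lintegral_prod _ hm.ennreal_ofReal.aemeasurable]
  have h1 : ∫⁻ x in Set.Icc (0 : ℝ) 1, ∫⁻ e, ENNReal.ofReal ((yuleSimon p 1 (x, e) : ℝ) ^ r)
      ∂(Measure.infinitePi holdingLaw) ≤
      ∫⁻ x in Set.Icc (0 : ℝ) 1, ENNReal.ofReal (3 * x ^ (-(p * r))) := by
    rw [restrict_Ioc_eq_restrict_Icc.symm]
    refine setLIntegral_mono' measurableSet_Ioc fun x hx => ?_
    have h2 := lintegral_yule_rpow_le (yule_time_nonneg hp hx.1 hx.2) hr0 hr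
    have h3 : Real.exp (p * (Real.log 1 - Real.log x)) ^ r = x ^ (-(p * r)) := by
      rw [← Real.exp_mul, Real.rpow_def_of_pos hx.1, Real.log_one]
      congr 1; ring
    rw [h3] at h2
    refine le_trans (le_of_eq ?_) h2
    refine lintegral_congr fun e => ?_
    simp only [yuleSimon, if_pos hx.2]
  refine h1.trans_lt ?_
  have h4 : IntegrableOn (fun x : ℝ => 3 * x ^ (-(p * r))) (Set.Icc 0 1) := by
    rw [integrableOn_Icc_iff_integrableOn_Ioc, ← intervalIntegrable_iff_integrableOn_Ioc_of_le
      zero_le_one]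
    exact (intervalIntegral.intervalIntegrable_rpow' (by linarith)).const_mul 3
  have h5 := h4.hasFiniteIntegral
  rw [hasFiniteIntegral_iff_ofReal ((ae_restrict_iff' measurableSet_Icc).2
    (ae_of_all _ fun x hx => by have := hx.1; simp only [Pi.zero_apply]; positivity))] at h5
  exact h5

section
variable {ι : Type*} [Fintype ι]

/-- The process `t ^ (-p) * Y t` is a martingale after time `U`, in integrated form. -/
lemma integral_yuleSimon_mul {p s : ℝ} (hp : 0 ≤ p) (hs0 : 0 < s) (hs1 : s ≤ 1) {r : ι → ℝ}
    (hr0 : ∀ i, 0 < r i) (hrs : ∀ i, r i ≤ s) (c : ι → ℝ) {g : ℝ → ℂ} (hg0 : g 0 = 0)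
    (hint1 : Integrable (fun w => (yuleSimon p 1 w : ℂ) *
      g (∑ i, c i * (yuleSimon p (r i) w : ℝ))) yuleSimonMeasure)
    (hints : Integrable (fun w => (yuleSimon p s w : ℂ) *
      g (∑ i, c i * (yuleSimon p (r i) w : ℝ))) yuleSimonMeasure) :
    ∫ w, (yuleSimon p 1 w : ℂ) * g (∑ i, c i * (yuleSimon p (r i) w : ℝ)) ∂yuleSimonMeasure =
      ((s ^ (-p) : ℝ) : ℂ) * ∫ w, (yuleSimon p s w : ℂ) *
        g (∑ i, c i * (yuleSimon p (r i) w : ℝ)) ∂yuleSimonMeasure := by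
  unfold yuleSimonMeasure at *
  rw [integral_prod _ hint1, integral_prod _ hints, ← integral_const_mul,
    restrict_Ioc_eq_restrict_Icc.symm]
  refine setIntegral_congr_fun measurableSet_Ioc fun x hx => ?_
  by_cases hxs : x ≤ s
  · have h1 := integral_yule_mul (t := p * (Real.log 1 - Real.log x))
      (u := p * (Real.log s - Real.log x))
      (v := fun i => p * (Real.log (r i) - Real.log x)) (yule_time_nonneg hp hx.1 hxs)
      (by have := Real.log_le_log hs0 hs1; gcongr)
      (fun i => by have := Real.log_le_log (hr0 i) (hrs i); gcongr)
      -- For fixed `x` the indicators `x ≤ r i` are constants, so the integrand is a function of the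
      -- Yule values alone. Those at negative times are multiplied by zero.
      (fun V => g (∑ i, c i * ((if x ≤ r i then V i else 0 : ℕ) : ℝ)))
    have h2 : Real.exp (p * (Real.log 1 - Real.log x) - p * (Real.log s - Real.log x)) =
        s ^ (-p) := by
      rw [Real.rpow_def_of_pos hs0, Real.log_one]
      congr 1; ring
    rw [h2] at h1
    simp only [yuleSimon, if_pos hxs, if_pos hx.2]
    exact h1
  -- When `U = x > s`, the variable `Y 1` need not vanish but all the `Y (r i)` do, and `g 0 = 0`
  -- annihilates both sides.
  · have h3 : ∀ i (e : ℕ → ℝ), yuleSimon p (r i) (x, e) = 0 := by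
      intro i e
      unfold yuleSimon
      rw [if_neg]
      exact fun h => hxs (h.trans (hrs i))
    simp [h3, hg0]

end

end ReinforcedLevy

namespace ReinforcedLevy

/-! ### The compensated exponential -/

/-- The function `y ↦ exp (i y) - 1 - i y`. -/
noncomputable def compExp (y : ℝ) : ℂ := Complex.exp (Complex.I * y) - 1 - Complex.I * y

/-- The function `min |x| (|x| ^ r)`, which is integrable against the Lévy measure. -/
noncomputable def minPow (r x : ℝ) : ℝ := min |x| (|x| ^ r)

lemma continuous_compExp : Continuous compExp := by unfold compExp; fun_prop

lemma measurable_minPow (r : ℝ) : Measurable (minPow r) := by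
  unfold minPow
  exact measurable_norm.min (measurable_norm.pow_const r)

lemma minPow_nonneg (r x : ℝ) : 0 ≤ minPow r x := le_min (abs_nonneg _) (by positivity)

lemma minPow_of_abs_le_one {r x : ℝ} (hr : 1 ≤ r) (hx : |x| ≤ 1) : minPow r x = |x| ^ r := by
  refine min_eq_right ?_
  rcases (abs_nonneg x).eq_or_lt with h | h
  · rw [← h, Real.zero_rpow (by linarith)]
  · simpa using Real.rpow_le_rpow_of_exponent_ge h hx hr

lemma minPow_of_one_le_abs {r x : ℝ} (hr : 1 ≤ r) (hx : 1 ≤ |x|) : minPow r x = |x| :=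
  min_eq_left (by simpa using Real.rpow_le_rpow_of_exponent_le hx hr)

lemma minPow_mul_le {r : ℝ} (z x : ℝ) :
    minPow r (z * x) ≤ (|z| + |z| ^ r) * minPow r x := by
  have h1 : 0 ≤ |z| ^ r := by positivity
  have h2 := abs_nonneg z
  have h3 := minPow_nonneg r x
  unfold minPow at *
  rw [abs_mul, Real.mul_rpow (abs_nonneg _) (abs_nonneg _), add_mul]
  rcases le_total |x| (|x| ^ r) with h | h
  · rw [min_eq_left h] at *
    have := min_le_left (|z| * |x|) (|z| ^ r * |x| ^ r)
    nlinarith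
  · rw [min_eq_right h] at *
    have := min_le_right (|z| * |x|) (|z| ^ r * |x| ^ r)
    nlinarith

lemma norm_exp_I_mul_le (y : ℝ) : ‖Complex.exp (Complex.I * y) - 1‖ ≤ 2 := by
  refine (norm_sub_le _ _).trans ?_
  rw [mul_comm, Complex.norm_exp_ofReal_mul_I]
  norm_num

/-- Near `0` the second-order Taylor remainder is at most `|y| ^ 2 ≤ |y| ^ r`; away from `0` the
growth is linear. -/
lemma norm_compExp_le {r : ℝ} (hr : 1 ≤ r) (hr2 : r ≤ 2) (y : ℝ) :
    ‖compExp y‖ ≤ 3 * minPow r y := by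
  have hn : ‖Complex.I * (y : ℂ)‖ = |y| := by simp
  rcases le_total |y| 1 with h | h
  · rw [minPow_of_abs_le_one hr h]
    have h1 := Complex.norm_exp_sub_one_sub_id_le (x := Complex.I * y) (by rwa [hn])
    rw [hn] at h1
    have h2 : |y| ^ 2 ≤ |y| ^ r := by
      rcases (abs_nonneg y).eq_or_lt with h0 | h0
      · rw [← h0, Real.zero_rpow (by linarith)]; norm_num
      · rw [← Real.rpow_natCast]
        exact Real.rpow_le_rpow_of_exponent_ge h0 h (by exact_mod_cast hr2)
    have h3 : 0 ≤ |y| ^ r := by positivity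
    unfold compExp
    linarith
  · rw [minPow_of_one_le_abs hr h]
    unfold compExp
    refine (norm_sub_le _ _).trans ?_
    have := norm_exp_I_mul_le y
    rw [hn]
    linarith

/-- Since `r - 1` lies in `[0, 1]`, the bounds `|y|` and `2` for `|exp (i y) - 1|` interpolate to `2
|y| ^ (r - 1)`, which serves small jumps. For large jumps the bound `2` is enough. -/
lemma abs_mul_norm_exp_sub_one_le {r : ℝ} (hr : 1 ≤ r) (hr2 : r ≤ 2) (z x : ℝ) :
    |x| * ‖Complex.exp (Complex.I * (z * x : ℝ)) - 1‖ ≤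
      2 * (1 + |z| ^ (r - 1)) * minPow r x := by
  have hz : 0 ≤ |z| ^ (r - 1) := by positivity
  rcases le_total |x| 1 with h | h
  · rw [minPow_of_abs_le_one hr h]
    have h1 : ‖Complex.exp (Complex.I * (z * x : ℝ)) - 1‖ ≤ 2 * |z * x| ^ (r - 1) := by
      rcases le_total |z * x| 1 with h2 | h2
      · have h3 := Real.norm_exp_I_mul_ofReal_sub_one_le (x := z * x)
        rw [Real.norm_eq_abs] at h3
        have h4 : |z * x| ≤ |z * x| ^ (r - 1) := by
          rcases (abs_nonneg (z * x)).eq_or_lt with h0 | h0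
          · rw [← h0]; positivity
          · simpa using Real.rpow_le_rpow_of_exponent_ge h0 h2 (show r - 1 ≤ 1 by linarith)
        have := abs_nonneg (z * x)
        linarith
      · have h3 := norm_exp_I_mul_le (z * x)
        have h4 : 1 ≤ |z * x| ^ (r - 1) := Real.one_le_rpow h2 (by linarith)
        linarith
    rw [abs_mul, Real.mul_rpow (abs_nonneg _) (abs_nonneg _)] at h1
    rcases (abs_nonneg x).eq_or_lt with h0 | h0
    · rw [← h0, Real.zero_rpow (by linarith)]; simp
    · have h5 : |x| ^ r = |x| * |x| ^ (r - 1) := by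
        rw [← Real.rpow_one_add' (abs_nonneg _) (by linarith)]
        congr 1; ring
      rw [h5]
      have h6 : 0 ≤ |x| * |x| ^ (r - 1) := by positivity
      calc |x| * ‖Complex.exp (Complex.I * (z * x : ℝ)) - 1‖
          ≤ |x| * (2 * (|z| ^ (r - 1) * |x| ^ (r - 1))) := by gcongr
        _ ≤ _ := by nlinarith
  · rw [minPow_of_one_le_abs hr h]
    have := norm_exp_I_mul_le (z * x)
    have h2 := abs_nonneg x
    nlinarith [mul_nonneg h2 hz]

/-! ### A kernel comparing first moments with characteristic functions -/

/-- The function `x ↦ ∫ l in 0..1, (1 - cos (l x)) / l ^ 2`. -/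
noncomputable def cosKernel (x : ℝ) : ℝ≥0∞ :=
  ∫⁻ l in Set.Ioc (0 : ℝ) 1, ENNReal.ofReal ((1 - Real.cos (l * x)) / l ^ 2)

lemma one_sub_cos_div_le (l x : ℝ) : (1 - Real.cos (l * x)) / l ^ 2 ≤ x ^ 2 / 2 := by
  rcases eq_or_ne l 0 with rfl | hl
  · simp; positivity
  · rw [div_le_iff₀ (by positivity)]
    have := Real.one_sub_sq_div_two_le_cos (x := l * x)
    nlinarith

lemma cosKernel_le_sq (x : ℝ) : cosKernel x ≤ ENNReal.ofReal (x ^ 2 / 2) := by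
  unfold cosKernel
  calc ∫⁻ l in Set.Ioc (0 : ℝ) 1, ENNReal.ofReal ((1 - Real.cos (l * x)) / l ^ 2)
      ≤ ∫⁻ _ in Set.Ioc (0 : ℝ) 1, ENNReal.ofReal (x ^ 2 / 2) :=
        lintegral_mono fun l => ENNReal.ofReal_le_ofReal (one_sub_cos_div_le l x)
    _ = _ := by simp

/-- Split at `l = 1 / |x|`: below it the integrand is at most `x ^ 2`, above it at most `2 / l ^ 2`.
The two pieces contribute `|x|` and `2 |x|`. -/
lemma cosKernel_le_abs {x : ℝ} (hx : x ≠ 0) : cosKernel x ≤ ENNReal.ofReal (3 * |x|) := by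
  have hx0 : 0 < |x| := abs_pos.2 hx
  have hc : 0 < |x|⁻¹ := inv_pos.2 hx0
  unfold cosKernel
  calc ∫⁻ l in Set.Ioc (0 : ℝ) 1, ENNReal.ofReal ((1 - Real.cos (l * x)) / l ^ 2)
      ≤ ∫⁻ l in Set.Ioc (0 : ℝ) |x|⁻¹ ∪ Set.Ioi |x|⁻¹,
          ENNReal.ofReal ((1 - Real.cos (l * x)) / l ^ 2) :=
        lintegral_mono_set fun l hl => by
          rcases le_or_gt l |x|⁻¹ with h | h
          · exact Or.inl ⟨hl.1, h⟩
          · exact Or.inr h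
    _ ≤ (∫⁻ l in Set.Ioc (0 : ℝ) |x|⁻¹, ENNReal.ofReal ((1 - Real.cos (l * x)) / l ^ 2)) +
          ∫⁻ l in Set.Ioi |x|⁻¹, ENNReal.ofReal ((1 - Real.cos (l * x)) / l ^ 2) :=
        lintegral_union_le _ _ _
    _ ≤ ENNReal.ofReal |x| + ENNReal.ofReal (2 * |x|) := by
        gcongr
        · calc ∫⁻ l in Set.Ioc (0 : ℝ) |x|⁻¹, ENNReal.ofReal ((1 - Real.cos (l * x)) / l ^ 2)
              ≤ ∫⁻ _ in Set.Ioc (0 : ℝ) |x|⁻¹, ENNReal.ofReal (x ^ 2) :=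
                lintegral_mono fun l => ENNReal.ofReal_le_ofReal
                  ((one_sub_cos_div_le l x).trans (by nlinarith [sq_nonneg x]))
            _ = ENNReal.ofReal |x| := by
                rw [setLIntegral_const, Real.volume_Ioc, ← ENNReal.ofReal_mul (by positivity)]
                congr 1
                rw [sub_zero, ← sq_abs]
                field_simp
        · calc ∫⁻ l in Set.Ioi |x|⁻¹, ENNReal.ofReal ((1 - Real.cos (l * x)) / l ^ 2)
              ≤ ∫⁻ l in Set.Ioi |x|⁻¹, ENNReal.ofReal (2 * l ^ (-2 : ℝ)) := by
                refine setLIntegral_mono' measurableSet_Ioi fun l hl => ?_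
                refine ENNReal.ofReal_le_ofReal ?_
                have hl0 : 0 < l := hc.trans hl
                rw [Real.rpow_neg hl0.le, ← div_eq_mul_inv]
                norm_cast
                gcongr
                linarith [Real.neg_one_le_cos (l * x)]
            _ = ENNReal.ofReal (2 * |x|) := by
                rw [← ofReal_integral_eq_lintegral_ofReal
                  ((integrableOn_Ioi_rpow_of_lt (by norm_num) hc).const_mul 2)
                  ((ae_restrict_iff' measurableSet_Ioi).2 (ae_of_all _ fun l hl => by
                    have hl0 : 0 < l := hc.trans hl
                    simp only [Pi.zero_apply]
                    positivity)), integral_const_mul, integral_Ioi_rpow_of_lt (by norm_num) hc]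
                congr 1
                norm_num
                rw [Real.rpow_neg_one, inv_inv]
    _ = ENNReal.ofReal (3 * |x|) := by
        rw [← ENNReal.ofReal_add (by positivity) (by positivity)]
        congr 1; ring

lemma cosKernel_le_minPow {r : ℝ} (hr : 1 ≤ r) (hr2 : r ≤ 2) (x : ℝ) :
    cosKernel x ≤ ENNReal.ofReal (3 * minPow r x) := by
  rcases le_total |x| 1 with h | h
  · refine (cosKernel_le_sq x).trans (ENNReal.ofReal_le_ofReal ?_)
    rw [minPow_of_abs_le_one hr h, ← sq_abs]
    have h2 : |x| ^ 2 ≤ |x| ^ r := by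
      rcases (abs_nonneg x).eq_or_lt with h0 | h0
      · rw [← h0, Real.zero_rpow (by linarith)]; norm_num
      · rw [← Real.rpow_natCast]
        exact Real.rpow_le_rpow_of_exponent_ge h0 h (by exact_mod_cast hr2)
    have h3 : 0 ≤ |x| ^ 2 := by positivity
    linarith
  · rw [minPow_of_one_le_abs hr h]
    exact cosKernel_le_abs (by rintro rfl; norm_num at h)

/-- For `|x| ≥ 1` the range `l ≤ 1 / |x|` suffices: there `1 - cos (l x) ≥ (l x) ^ 2 / 4`, which
integrates to `|x| / 4`. -/
lemma abs_le_cosKernel (x : ℝ) : ENNReal.ofReal |x| ≤ 1 + 4 * cosKernel x := by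
  rcases le_total |x| 1 with h | h
  · exact (ENNReal.ofReal_le_one.2 h).trans le_self_add
  · refine le_trans ?_ le_add_self
    have hx0 : 0 < |x| := by linarith
    have h1 : ENNReal.ofReal (|x| / 4) ≤ cosKernel x := by
      unfold cosKernel
      calc ENNReal.ofReal (|x| / 4)
          = ∫⁻ _ in Set.Ioc (0 : ℝ) |x|⁻¹, ENNReal.ofReal (x ^ 2 / 4) := by
            rw [setLIntegral_const, Real.volume_Ioc, ← ENNReal.ofReal_mul (by positivity)]
            congr 1
            rw [sub_zero, ← sq_abs]
            field_simp
        _ ≤ ∫⁻ l in Set.Ioc (0 : ℝ) |x|⁻¹, ENNReal.ofReal ((1 - Real.cos (l * x)) / l ^ 2) := by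
            refine setLIntegral_mono' measurableSet_Ioc fun l hl => ENNReal.ofReal_le_ofReal ?_
            have hl0 := hl.1
            rw [le_div_iff₀ (by positivity)]
            have h2 : |l * x| ≤ 1 := by
              rw [abs_mul, abs_of_pos hl.1]
              calc l * |x| ≤ |x|⁻¹ * |x| := by gcongr; exact hl.2
                _ = 1 := inv_mul_cancel₀ hx0.ne'
            have h3 := (abs_le.1 (Real.cos_bound h2)).2
            have h4 : |l * x| ^ 4 ≤ (l * x) ^ 2 := by
              rw [← sq_abs (l * x)]
              exact pow_le_pow_of_le_one (abs_nonneg _) h2 (by norm_num)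
            nlinarith
        _ ≤ _ := lintegral_mono_set (Set.Ioc_subset_Ioc_right (inv_le_one_of_one_le₀ h))
    calc ENNReal.ofReal |x| = 4 * ENNReal.ofReal (|x| / 4) := by
          rw [show (4 : ℝ≥0∞) = ENNReal.ofReal 4 by norm_num, ← ENNReal.ofReal_mul (by norm_num)]
          congr 1; ring
      _ ≤ 4 * cosKernel x := by gcongr

end ReinforcedLevy

/-! ### Growth and differentiability of the characteristic exponent -/

namespace ReinforcedLevy

/-- The analytic properties of the characteristic exponent of a centred Lévy process whose
jumps have finite `r`-variation. -/
structure IsTameExponent (Ψ : ℝ → ℂ) (r C : ℝ) : Prop where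
  one_lt : 1 < r
  le_two : r ≤ 2
  nonneg : 0 ≤ C
  differentiable : Differentiable ℝ Ψ
  deriv_zero : deriv Ψ 0 = 0
  norm_deriv_le : ∀ z, ‖deriv Ψ z‖ ≤ C * (1 + |z| ^ (r - 1))
  norm_le : ∀ z, ‖Ψ z‖ ≤ C * (|z| + |z| ^ r)
  re_nonpos : ∀ z, (Ψ z).re ≤ 0
  lintegral_re_le : ∀ y, ∫⁻ l in Set.Ioc (0 : ℝ) 1, ENNReal.ofReal (-(Ψ (l * y)).re / l ^ 2) ≤
    ENNReal.ofReal (C * (|y| + |y| ^ r))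

/-- Needed for Tonelli against the jump measure. By Markov's inequality each superlevel set of `min
1 (x ^ 2)` has finite mass, and these sets miss only the null point `0`. -/
lemma LevyTriplet.sigmaFinite (T : LevyTriplet) : SigmaFinite T.Λ := by
  set S : Set (Set ℝ) := insert {0} (Set.range fun n : ℕ =>
    {x : ℝ | ENNReal.ofReal (1 / ((n : ℝ) + 1)) ≤ ENNReal.ofReal (min 1 (x ^ 2))}) with hS
  refine Measure.sigmaFinite_of_countable (S := S) ((Set.countable_range _).insert _) ?_ ?_
  · rintro s (rfl | ⟨n, rfl⟩)
    · rw [T.Λ_zero]; exact ENNReal.zero_lt_top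
    · refine (meas_ge_le_lintegral_div (by fun_prop) ?_ ENNReal.ofReal_ne_top).trans_lt ?_
      · rw [Ne, ENNReal.ofReal_eq_zero, not_le]; positivity
      · refine ENNReal.div_lt_top T.lintegral_min_lt_top.ne ?_
        rw [Ne, ENNReal.ofReal_eq_zero, not_le]; positivity
  · refine Set.eq_univ_of_forall fun x => ?_
    rcases eq_or_ne x 0 with rfl | hx
    · exact ⟨{0}, Set.mem_insert _ _, rfl⟩
    · have hpos : 0 < min 1 (x ^ 2) := lt_min one_pos (by positivity)
      obtain ⟨n, hn⟩ := exists_nat_one_div_lt hpos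
      exact ⟨_, Set.mem_insert_of_mem _ ⟨n, rfl⟩, ENNReal.ofReal_le_ofReal hn.le⟩

lemma abs_rpow_antitone {r s x : ℝ} (hr : 0 < r) (hrs : r ≤ s) (hx : |x| ≤ 1) :
    |x| ^ s ≤ |x| ^ r := by
  rcases (abs_nonneg x).eq_or_lt with h0 | h0
  · rw [← h0, Real.zero_rpow hr.ne', Real.zero_rpow (hr.trans_le hrs).ne']
  · exact Real.rpow_le_rpow_of_exponent_ge h0 hx hrs

lemma LevyTriplet.lintegral_sq_lt_top (T : LevyTriplet) :
    ∫⁻ x in Set.Icc (-1 : ℝ) 1, ENNReal.ofReal (|x| ^ (2 : ℝ)) ∂T.Λ < ∞ := by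
  refine lt_of_le_of_lt ?_ T.lintegral_min_lt_top
  refine (setLIntegral_mono' measurableSet_Icc fun x hx => ?_).trans (setLIntegral_le_lintegral _ _)
  refine ENNReal.ofReal_le_ofReal ?_
  have h1 : |x| ≤ 1 := abs_le.2 hx
  rw [Real.rpow_two, sq_abs]
  refine le_min ?_ le_rfl
  rw [← sq_abs]
  exact pow_le_one₀ (abs_nonneg _) h1

lemma LevyTriplet.lintegral_rpow_mono (T : LevyTriplet) {r s : ℝ} (hr : 0 < r) (hrs : r ≤ s)
    (h : ∫⁻ x in Set.Icc (-1 : ℝ) 1, ENNReal.ofReal (|x| ^ r) ∂T.Λ < ∞) :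
    ∫⁻ x in Set.Icc (-1 : ℝ) 1, ENNReal.ofReal (|x| ^ s) ∂T.Λ < ∞ :=
  lt_of_le_of_lt (setLIntegral_mono' measurableSet_Icc fun _ hx =>
    ENNReal.ofReal_le_ofReal (abs_rpow_antitone hr hrs (abs_le.2 hx))) h

/-- Admissibility provides an exponent `r < 1 / p` for which the jumps have finite
`r`-variation. -/
lemma LevyTriplet.Admissible.exists_exponent {T : LevyTriplet} {p : ℝ} (h : T.Admissible p) :
    ∃ r, 1 < r ∧ r ≤ 2 ∧ p * r < 1 ∧ (T.q = 0 ∨ r = 2) ∧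
      ∫⁻ x in Set.Icc (-1 : ℝ) 1, ENNReal.ofReal (|x| ^ r) ∂T.Λ < ∞ := by
  obtain ⟨hp0, hp1, hpb⟩ := h
  unfold LevyTriplet.bgIndex at hpb
  split_ifs at hpb with hq
  · have hq' : T.q = 0 := by simpa using hq
    have hlt : bgIndexMeasure T.Λ < 1 / p := by rw [lt_div_iff₀ hp0]; linarith
    unfold bgIndexMeasure at hlt
    obtain ⟨s, ⟨hs0, hs⟩, hsp⟩ := exists_lt_of_csInf_lt
      (s := {r : ℝ | 0 < r ∧ ∫⁻ x in Set.Icc (-1 : ℝ) 1, ENNReal.ofReal (|x| ^ r) ∂T.Λ < ∞})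
      (Set.nonempty_of_mem (x := 2) ⟨two_pos, T.lintegral_sq_lt_top⟩) hlt
    have h1p : 1 < 1 / p := by rw [lt_div_iff₀ hp0]; linarith
    obtain ⟨m, hm1, hm2⟩ := exists_between h1p
    -- The maximum is above `1` because of `m` and still below `1 / p`. If it exceeds `2`, then `2 <
    -- 1 / p`, and the exponent `2` works for every Lévy measure.
    by_cases hs2 : max s m ≤ 2
    · refine ⟨max s m, lt_max_of_lt_right hm1, hs2, ?_, Or.inl hq',
        T.lintegral_rpow_mono hs0 (le_max_left _ _) hs⟩
      rw [mul_comm, ← lt_div_iff₀ hp0]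
      exact max_lt hsp hm2
    · refine ⟨2, one_lt_two, le_rfl, ?_, Or.inl hq', T.lintegral_sq_lt_top⟩
      rw [mul_comm, ← lt_div_iff₀ hp0]
      exact (not_le.1 hs2).trans (max_lt hsp hm2)
  · exact ⟨2, one_lt_two, le_rfl, hpb, Or.inr rfl, T.lintegral_sq_lt_top⟩

section

variable {T : LevyTriplet} {r : ℝ}

lemma LevyTriplet.integrable_minPow
    (hT : ∫⁻ x in Set.Icc (-1 : ℝ) 1, ENNReal.ofReal (|x| ^ r) ∂T.Λ < ∞)
    (hint : IntegrableOn (fun x : ℝ => x) {x : ℝ | 1 ≤ |x|} T.Λ) :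
    Integrable (minPow r) T.Λ := by
  rw [← integrableOn_univ, show (Set.univ : Set ℝ) = Set.Icc (-1 : ℝ) 1 ∪ {x : ℝ | 1 ≤ |x|} by
    ext x; simpa [← abs_le] using le_total |x| 1]
  refine IntegrableOn.union ?_ ?_
  · refine ⟨(measurable_minPow r).aestronglyMeasurable, ?_⟩
    rw [hasFiniteIntegral_iff_ofReal (ae_of_all _ (minPow_nonneg r))]
    refine lt_of_le_of_lt (setLIntegral_mono' measurableSet_Icc fun x hx => ?_) hT
    exact ENNReal.ofReal_le_ofReal (min_le_right _ _)
  · refine Integrable.mono hint (measurable_minPow r).aestronglyMeasurable (ae_of_all _ fun x => ?_)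
    rw [Real.norm_of_nonneg (minPow_nonneg r x)]
    exact min_le_left _ _

lemma LevyTriplet.integrable_compExp (hr : 1 ≤ r) (hr2 : r ≤ 2)
    (hD : Integrable (minPow r) T.Λ) (z : ℝ) :
    Integrable (fun x => compExp (z * x)) T.Λ := by
  refine (hD.const_mul (3 * (|z| + |z| ^ r))).mono'
    (continuous_compExp.comp (by fun_prop)).aestronglyMeasurable (ae_of_all _ fun x => ?_)
  have := norm_compExp_le hr hr2 (z * x)
  have := minPow_mul_le (r := r) z x
  linarith

/-- The characteristic exponent with all jumps compensated. -/
noncomputable def LevyTriplet.centredExponent (T : LevyTriplet) (z : ℝ) : ℂ :=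
  -((T.q : ℂ) ^ 2 / 2 * (z : ℂ) ^ 2) + ∫ x, compExp (z * x) ∂T.Λ

/-- Compensating the large jumps too changes the exponent only by a drift, namely the integral of
`x` over `|x| > 1`, finite by assumption. -/
lemma LevyTriplet.exists_exponent_eq (hr : 1 ≤ r) (hr2 : r ≤ 2)
    (hD : Integrable (minPow r) T.Λ)
    (hint : IntegrableOn (fun x : ℝ => x) {x : ℝ | 1 ≤ |x|} T.Λ) :
    ∃ b : ℝ, ∀ z : ℝ, T.exponent z = T.centredExponent z + Complex.I * b * z := by
  set J : ℝ → ℝ := {x : ℝ | 1 < |x|}.indicator (fun x => x) with hJ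
  have hmeas : MeasurableSet {x : ℝ | 1 < |x|} := measurableSet_lt measurable_const measurable_norm
  have hJi : Integrable J T.Λ := by
    rw [hJ, integrable_indicator_iff hmeas]
    exact hint.mono_set (Set.ofPred_subset_ofPred.2 fun x hx => le_of_lt hx)
  refine ⟨T.a + ∫ x, J x ∂T.Λ, fun z => ?_⟩
  have h1 : ∀ x : ℝ, Complex.exp (Complex.I * z * x) - 1 -
      ({x : ℝ | |x| ≤ 1}.indicator (fun x : ℝ => Complex.I * x * z) x) =
      compExp (z * x) + Complex.I * z * (J x : ℂ) := by
    intro x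
    unfold compExp
    by_cases hx : |x| ≤ 1
    · simp [hJ, Set.indicator, hx, not_lt.2 hx]
      ring_nf
    · simp [hJ, Set.indicator, hx, not_le.1 hx]
      ring_nf
  unfold LevyTriplet.exponent LevyTriplet.centredExponent
  simp_rw [h1]
  have h2 : Integrable (fun x => Complex.I * z * (J x : ℂ)) T.Λ := hJi.ofReal.const_mul _
  rw [integral_add (T.integrable_compExp hr hr2 hD z) h2,
    integral_const_mul, integral_complex_ofReal]
  push_cast
  ring

/-- The derivative of the centred exponent. -/
noncomputable def LevyTriplet.centredExponentDeriv (T : LevyTriplet) (z : ℝ) : ℂ :=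
  -((T.q : ℂ) ^ 2 * z) + ∫ x : ℝ, Complex.I * x * (Complex.exp (Complex.I * (z * x : ℝ)) - 1) ∂T.Λ

lemma hasDerivAt_compExp_mul (x z : ℝ) : HasDerivAt (fun z : ℝ => compExp (z * x))
    (Complex.I * x * (Complex.exp (Complex.I * (z * x : ℝ)) - 1)) z := by
  have h1 : HasDerivAt (fun z : ℝ => Complex.I * ((z * x : ℝ) : ℂ)) (Complex.I * x) z := by
    have := ((hasDerivAt_id z).mul_const x).ofReal_comp.const_mul Complex.I
    simpa using this
  have h2 := (h1.cexp.sub_const 1).sub h1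
  exact h2.congr_deriv (by ring)

lemma norm_deriv_compExp_le (hr : 1 ≤ r) (hr2 : r ≤ 2) (x z : ℝ) :
    ‖Complex.I * x * (Complex.exp (Complex.I * (z * x : ℝ)) - 1)‖ ≤
      2 * (1 + |z| ^ (r - 1)) * minPow r x := by
  rw [norm_mul, norm_mul, Complex.norm_I, one_mul, Complex.norm_real, Real.norm_eq_abs]
  exact abs_mul_norm_exp_sub_one_le hr hr2 z x

lemma LevyTriplet.hasDerivAt_centredExponent (hr : 1 ≤ r) (hr2 : r ≤ 2)
    (hD : Integrable (minPow r) T.Λ) (z : ℝ) :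
    HasDerivAt T.centredExponent (T.centredExponentDeriv z) z := by
  refine HasDerivAt.add ?_ ?_
  · have h : HasDerivAt (fun z : ℝ => (z : ℂ)) 1 z := (hasDerivAt_id z).ofReal_comp
    have := ((h.pow 2).const_mul ((T.q : ℂ) ^ 2 / 2)).neg
    convert! this using 1
    simp
    ring
  · refine (hasDerivAt_integral_of_dominated_loc_of_deriv_le
      (bound := fun x => 2 * (1 + (|z| + 1) ^ (r - 1)) * minPow r x)
      (F := fun z x => compExp (z * x))
      (F' := fun z x => Complex.I * x * (Complex.exp (Complex.I * (z * x : ℝ)) - 1))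
      (Metric.ball_mem_nhds z one_pos) (Eventually.of_forall fun y =>
        (T.integrable_compExp hr hr2 hD y).aestronglyMeasurable)
      (T.integrable_compExp hr hr2 hD z) ?_ ?_ (hD.const_mul _) ?_).2
    · exact (Continuous.aestronglyMeasurable (by fun_prop))
    · refine ae_of_all _ fun x y hy => (norm_deriv_compExp_le hr hr2 x y).trans ?_
      have h1 : |y| ≤ |z| + 1 := by
        have h2 := abs_sub_abs_le_abs_sub y z
        rw [Metric.mem_ball, Real.dist_eq] at hy
        linarith
      have := minPow_nonneg r x
      have : 0 ≤ r - 1 := by linarith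
      gcongr
    · exact ae_of_all _ fun x y _ => hasDerivAt_compExp_mul x y

/-- The Gaussian part fits the growth of order `r` only because `r = 2` whenever it is present. -/
lemma sq_mul_abs_le {q y : ℝ} (hq : q = 0 ∨ r = 2) : q ^ 2 * |y| ^ 2 ≤ q ^ 2 * |y| ^ r := by
  rcases hq with rfl | rfl
  · simp
  · rw [Real.rpow_two]

lemma re_compExp (y : ℝ) : (compExp y).re = -(1 - Real.cos y) := by
  unfold compExp
  rw [mul_comm]
  simp [Complex.exp_ofReal_mul_I_re]

lemma LevyTriplet.re_centredExponent (hr : 1 ≤ r) (hr2 : r ≤ 2)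
    (hD : Integrable (minPow r) T.Λ) (z : ℝ) :
    -(T.centredExponent z).re = T.q ^ 2 / 2 * z ^ 2 + ∫ x, (1 - Real.cos (z * x)) ∂T.Λ := by
  unfold LevyTriplet.centredExponent
  have h1 : (∫ x, compExp (z * x) ∂T.Λ).re = ∫ x, (compExp (z * x)).re ∂T.Λ :=
    (integral_re (𝕜 := ℂ) (T.integrable_compExp hr hr2 hD z)).symm
  have h2 : (((T.q : ℂ) ^ 2 / 2 * (z : ℂ) ^ 2)).re = T.q ^ 2 / 2 * z ^ 2 := by
    norm_cast
  rw [Complex.add_re, Complex.neg_re, h2, h1]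
  simp_rw [re_compExp]
  rw [integral_neg]
  ring

lemma LevyTriplet.integrable_one_sub_cos (hr : 1 ≤ r) (hr2 : r ≤ 2)
    (hD : Integrable (minPow r) T.Λ) (z : ℝ) :
    Integrable (fun x => 1 - Real.cos (z * x)) T.Λ := by
  have := (T.integrable_compExp hr hr2 hD z).re.neg
  convert this using 1
  funext x
  simp [re_compExp]

/-- By Tonelli the jump part becomes the integral of `cosKernel (y * x)` over the jumps, controlled
by `minPow`. In the Gaussian part the factor `l ^ 2` cancels. -/
lemma LevyTriplet.lintegral_re_centredExponent_le (hr : 1 ≤ r) (hr2 : r ≤ 2)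
    (hq : T.q = 0 ∨ r = 2) (hD : Integrable (minPow r) T.Λ) (y : ℝ) :
    ∫⁻ l in Set.Ioc (0 : ℝ) 1, ENNReal.ofReal (-(T.centredExponent (l * y)).re / l ^ 2) ≤
      ENNReal.ofReal ((T.q ^ 2 + 3 * ∫ x, minPow r x ∂T.Λ) * (|y| + |y| ^ r)) := by
  have := T.sigmaFinite
  have hI : 0 ≤ ∫ x, minPow r x ∂T.Λ := integral_nonneg (minPow_nonneg r)
  have h1 : ∀ l ∈ Set.Ioc (0 : ℝ) 1, ENNReal.ofReal (-(T.centredExponent (l * y)).re / l ^ 2) =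
      ENNReal.ofReal (T.q ^ 2 / 2 * y ^ 2) +
        ∫⁻ x, ENNReal.ofReal ((1 - Real.cos (l * (y * x))) / l ^ 2) ∂T.Λ := by
    intro l hl
    have hl0 := hl.1
    have hi := (T.integrable_one_sub_cos hr hr2 hD (l * y)).div_const (l ^ 2)
    have hnn : ∀ x : ℝ, 0 ≤ (1 - Real.cos (l * y * x)) / l ^ 2 := fun x =>
      div_nonneg (by linarith [Real.cos_le_one (l * y * x)]) (by positivity)
    simp_rw [← mul_assoc]
    rw [← ofReal_integral_eq_lintegral_ofReal hi (ae_of_all _ hnn),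
      ← ENNReal.ofReal_add (by positivity) (integral_nonneg hnn), integral_div,
      T.re_centredExponent hr hr2 hD, add_div]
    congr 2
    field_simp
  rw [setLIntegral_congr_fun measurableSet_Ioc h1, lintegral_add_left measurable_const,
    lintegral_lintegral_swap (by fun_prop)]
  have h2 : ∫⁻ x, (∫⁻ l in Set.Ioc (0 : ℝ) 1,
      ENNReal.ofReal ((1 - Real.cos (l * (y * x))) / l ^ 2)) ∂T.Λ ≤
      ENNReal.ofReal (3 * (|y| + |y| ^ r) * ∫ x, minPow r x ∂T.Λ) := by
    rw [← integral_const_mul, ofReal_integral_eq_lintegral_ofReal (hD.const_mul _)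
      (ae_of_all _ fun x => mul_nonneg (by positivity) (minPow_nonneg r x))]
    refine lintegral_mono fun x => (cosKernel_le_minPow hr hr2 (y * x)).trans ?_
    refine ENNReal.ofReal_le_ofReal ?_
    have := minPow_mul_le (r := r) y x
    linarith
  calc _ ≤ ENNReal.ofReal (T.q ^ 2 / 2 * y ^ 2) +
        ENNReal.ofReal (3 * (|y| + |y| ^ r) * ∫ x, minPow r x ∂T.Λ) := by
        gcongr
        simp
    _ = ENNReal.ofReal (T.q ^ 2 / 2 * y ^ 2 + 3 * (|y| + |y| ^ r) * ∫ x, minPow r x ∂T.Λ) :=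
        (ENNReal.ofReal_add (by positivity) (by positivity)).symm
    _ ≤ _ := by
        refine ENNReal.ofReal_le_ofReal ?_
        have h3 := sq_mul_abs_le (y := y) hq
        rw [sq_abs] at h3
        have h4 : 0 ≤ T.q ^ 2 * |y| := by positivity
        have h5 : 0 ≤ T.q ^ 2 * |y| ^ r := by positivity
        nlinarith

/-- The fully compensated exponent has zero derivative at `0`, so the hypothesis on `T.exponent`
forces the residual drift `b` to vanish. The two exponents then coincide, and all bounds are those
of the compensated one. -/
lemma LevyTriplet.isTameExponent (hr : 1 < r) (hr2 : r ≤ 2) (hq : T.q = 0 ∨ r = 2)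
    (hT : ∫⁻ x in Set.Icc (-1 : ℝ) 1, ENNReal.ofReal (|x| ^ r) ∂T.Λ < ∞)
    (hint : IntegrableOn (fun x : ℝ => x) {x : ℝ | 1 ≤ |x|} T.Λ)
    (hderiv : HasDerivAt T.exponent 0 0) :
    ∃ C, IsTameExponent T.exponent r C := by
  have hD := T.integrable_minPow hT hint
  have hI : 0 ≤ ∫ x, minPow r x ∂T.Λ := integral_nonneg (minPow_nonneg r)
  obtain ⟨b, hb⟩ := T.exists_exponent_eq hr.le hr2 hD hint
  have hd := T.hasDerivAt_centredExponent hr.le hr2 hD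
  have hd0 : T.centredExponentDeriv 0 = 0 := by simp [LevyTriplet.centredExponentDeriv]
  have hE : T.exponent = T.centredExponent := by
    have h1 : HasDerivAt T.exponent (T.centredExponentDeriv 0 + Complex.I * b * 1) 0 := by
      rw [show T.exponent = fun z => T.centredExponent z + Complex.I * b * z from funext hb]
      exact (hd 0).add ((hasDerivAt_id (0 : ℝ)).ofReal_comp.const_mul _)
    have h2 := h1.unique hderiv
    rw [hd0] at h2
    have h3 : (b : ℂ) = 0 := by simpa using h2
    funext z
    rw [hb z, h3]
    simp
  have hder : ∀ z, deriv T.centredExponent z = T.centredExponentDeriv z := fun z => (hd z).deriv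
  refine ⟨T.q ^ 2 + 3 * ∫ x, minPow r x ∂T.Λ, ?_⟩
  rw [hE]
  refine ⟨hr, hr2, by positivity, fun z => (hd z).differentiableAt, by rw [hder, hd0], fun z => ?_,
    fun z => ?_, fun z => ?_, T.lintegral_re_centredExponent_le hr.le hr2 hq hD⟩
  · rw [hder]
    unfold LevyTriplet.centredExponentDeriv
    have h1 : ‖∫ x : ℝ, Complex.I * x * (Complex.exp (Complex.I * (z * x : ℝ)) - 1) ∂T.Λ‖ ≤
        2 * (1 + |z| ^ (r - 1)) * ∫ x, minPow r x ∂T.Λ := by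
      rw [← integral_const_mul]
      exact norm_integral_le_of_norm_le (hD.const_mul _)
        (ae_of_all _ fun x => norm_deriv_compExp_le hr.le hr2 x z)
    have h2 : ‖-((T.q : ℂ) ^ 2 * z)‖ ≤ T.q ^ 2 * |z| ^ (r - 1) := by
      rw [norm_neg, norm_mul, norm_pow, Complex.norm_real, Complex.norm_real, Real.norm_eq_abs,
        Real.norm_eq_abs, sq_abs]
      rcases hq with h | rfl
      · simp [h]
      · norm_num
    refine (norm_add_le _ _).trans ((add_le_add h2 h1).trans ?_)
    have h3 : 0 ≤ |z| ^ (r - 1) := by positivity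
    nlinarith [mul_nonneg h3 hI, sq_nonneg T.q, mul_nonneg h3 (sq_nonneg T.q)]
  · unfold LevyTriplet.centredExponent
    have h1 : ‖∫ x, compExp (z * x) ∂T.Λ‖ ≤ 3 * (|z| + |z| ^ r) * ∫ x, minPow r x ∂T.Λ := by
      rw [← integral_const_mul]
      refine norm_integral_le_of_norm_le (hD.const_mul _) (ae_of_all _ fun x => ?_)
      have := norm_compExp_le hr.le hr2 (z * x)
      have := minPow_mul_le (r := r) z x
      linarith
    have h2 : ‖-((T.q : ℂ) ^ 2 / 2 * (z : ℂ) ^ 2)‖ ≤ T.q ^ 2 * |z| ^ r := by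
      rw [norm_neg, norm_mul, norm_div, norm_pow, norm_pow, Complex.norm_real, Complex.norm_real,
        Real.norm_eq_abs, Real.norm_eq_abs, sq_abs]
      have h3 := sq_mul_abs_le (y := z) hq
      have h4 : 0 ≤ T.q ^ 2 * |z| ^ 2 := by positivity
      norm_num
      norm_num at h3 h4
      linarith
    refine (norm_add_le _ _).trans ((add_le_add h2 h1).trans ?_)
    have h3 : 0 ≤ T.q ^ 2 * |z| := by positivity
    linarith
  · have h1 := T.re_centredExponent hr.le hr2 hD z
    have h2 : 0 ≤ ∫ x, (1 - Real.cos (z * x)) ∂T.Λ :=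
      integral_nonneg fun x => by simpa using Real.cos_le_one (z * x)
    have h3 : 0 ≤ T.q ^ 2 / 2 * z ^ 2 := by positivity
    linarith

end

end ReinforcedLevy

namespace ReinforcedLevy

/-! ### Integrability from the characteristic function -/

lemma one_sub_re_exp_le {z : ℂ} (hz : z.re ≤ 0) : 1 - (Complex.exp z).re ≤ -z.re + ‖z‖ ^ 2 / 2 := by
  rw [Complex.exp_re]
  have h1 := Real.add_one_le_exp z.re
  have h2 : Real.exp z.re ≤ 1 := Real.exp_le_one_iff.2 hz
  have h3 := Real.one_sub_sq_div_two_le_cos (x := z.im)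
  have h4 : z.im ^ 2 ≤ ‖z‖ ^ 2 := by
    rw [← sq_abs]
    exact pow_le_pow_left₀ (abs_nonneg _) (Complex.abs_im_le_norm z) 2
  have h5 := Real.exp_pos z.re
  have h6 : Real.exp z.re * (1 - Real.cos z.im) ≤ 1 - Real.cos z.im :=
    mul_le_of_le_one_left (by linarith [Real.cos_le_one z.im]) h2
  linarith

variable {Ω : Type*} [MeasurableSpace Ω] {P : Measure Ω} [IsProbabilityMeasure P]

lemma integrable_exp_mul_I {X : Ω → ℝ} (hX : Measurable X) :
    Integrable (fun ω => Complex.exp (Complex.I * (X ω : ℂ))) P := by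
  refine (integrable_const (1 : ℝ)).mono' (Measurable.aestronglyMeasurable (by fun_prop))
    (ae_of_all _ fun ω => ?_)
  rw [mul_comm, Complex.norm_exp_ofReal_mul_I]

/-- A criterion for integrability in terms of the logarithm of the characteristic function. -/
lemma integrable_of_charFun_eq_exp {X : Ω → ℝ} (hX : Measurable X) {η : ℝ → ℂ} {B : ℝ}
    (hη : ∀ l : ℝ, ∫ ω, Complex.exp (Complex.I * ((l * X ω : ℝ) : ℂ)) ∂P = Complex.exp (η l))
    (hre : ∀ l, (η l).re ≤ 0) (hB : ∀ l ∈ Set.Ioc (0 : ℝ) 1, ‖η l‖ ≤ B * l)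
    (hfin : ∫⁻ l in Set.Ioc (0 : ℝ) 1, ENNReal.ofReal (-(η l).re / l ^ 2) < ∞) :
    Integrable X P := by
  refine ⟨hX.aestronglyMeasurable, ?_⟩
  rw [hasFiniteIntegral_iff_norm]
  -- By Tonelli this is the integral of `(1 - Re φ(l)) / l ^ 2` over `(0, 1]`, with `φ = exp ∘ η`.
  -- Its numerator is at most `-Re η + |η| ^ 2 / 2`; the first term is integrable by `hfin` and the
  -- second, after division by `l ^ 2`, is at most `B ^ 2 / 2`.
  have hK : ∫⁻ ω, cosKernel (X ω) ∂P < ∞ := by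
    unfold cosKernel
    rw [lintegral_lintegral_swap (Measurable.aemeasurable (by fun_prop))]
    have h1 : ∀ l ∈ Set.Ioc (0 : ℝ) 1,
        ∫⁻ ω, ENNReal.ofReal ((1 - Real.cos (l * X ω)) / l ^ 2) ∂P ≤
        ENNReal.ofReal (-(η l).re / l ^ 2) + ENNReal.ofReal (B ^ 2 / 2) := by
      intro l hl
      have hl0 := hl.1
      have hcos : ∀ ω, Real.cos (l * X ω) =
          (Complex.exp (Complex.I * ((l * X ω : ℝ) : ℂ))).re := fun ω => by
        rw [mul_comm Complex.I, Complex.exp_ofReal_mul_I_re]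
      have hi := integrable_exp_mul_I (P := P) (X := fun ω => l * X ω) (hX.const_mul l)
      have hc : Integrable (fun ω => Real.cos (l * X ω)) P := by
        simp_rw [hcos]; exact hi.re
      have hci : ∫ ω, Real.cos (l * X ω) ∂P = (Complex.exp (η l)).re := by
        rw [← hη l]
        simp_rw [hcos]
        exact integral_re (𝕜 := ℂ) hi
      have hnn : ∀ ω, 0 ≤ (1 - Real.cos (l * X ω)) / l ^ 2 := fun ω =>
        div_nonneg (by linarith [Real.cos_le_one (l * X ω)]) (by positivity)
      have hi2 : Integrable (fun ω => (1 - Real.cos (l * X ω)) / l ^ 2) P :=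
        ((integrable_const 1).sub hc).div_const _
      rw [← ofReal_integral_eq_lintegral_ofReal hi2 (ae_of_all _ hnn), integral_div,
        integral_sub (integrable_const 1) hc, hci,
        ← ENNReal.ofReal_add (div_nonneg (by linarith [hre l]) (by positivity)) (by positivity)]
      refine ENNReal.ofReal_le_ofReal ?_
      have h2 := one_sub_re_exp_le (hre l)
      have h3 : ‖η l‖ ^ 2 ≤ (B * l) ^ 2 := pow_le_pow_left₀ (norm_nonneg _) (hB l hl) 2
      rw [div_add' _ _ _ (by positivity)]
      gcongr
      simp
      nlinarith
    refine lt_of_le_of_lt (setLIntegral_mono' measurableSet_Ioc h1) ?_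
    rw [lintegral_add_right _ measurable_const]
    refine ENNReal.add_lt_top.2 ⟨hfin, ?_⟩
    simp
  calc ∫⁻ ω, ENNReal.ofReal ‖X ω‖ ∂P ≤ ∫⁻ ω, (1 + 4 * cosKernel (X ω)) ∂P :=
        lintegral_mono fun ω => abs_le_cosKernel (X ω)
    _ = 1 + 4 * ∫⁻ ω, cosKernel (X ω) ∂P := by
        rw [lintegral_add_left measurable_const, lintegral_const_mul' _ _ (by simp)]
        simp
    _ < ∞ := ENNReal.add_lt_top.2 ⟨by simp, ENNReal.mul_lt_top (by simp) hK⟩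

/-! ### Linear combinations of the Yule–Simon process -/

/-- The linear combination `∑ c s * Y (s / t)`. -/
noncomputable def yuleSimonSum (p : ℝ) (I : Finset ℝ≥0) (c : ℝ≥0 → ℝ) (t : ℝ≥0)
    (w : ℝ × (ℕ → ℝ)) : ℝ := ∑ s ∈ I, c s * (yuleSimon p ((s : ℝ) / (t : ℝ)) w : ℝ)

lemma measurable_yuleSimonSum (p : ℝ) (I : Finset ℝ≥0) (c : ℝ≥0 → ℝ) (t : ℝ≥0) :
    Measurable (yuleSimonSum p I c t) :=
  Finset.measurable_fun_sum _ fun s _ => (measurable_yuleSimon_cast p _).const_mul (c s)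

lemma GoodPoint.yuleSimon_div_le {w : ℝ × (ℕ → ℝ)} (hw : GoodPoint w) {p : ℝ} (hp : 0 ≤ p)
    {s t : ℝ≥0} (hst : s ≤ t) :
    (yuleSimon p ((s : ℝ) / (t : ℝ)) w : ℝ) ≤ (yuleSimon p 1 w : ℝ) := by
  exact_mod_cast hw.yuleSimon_mono hp (div_le_one_of_le₀ (by exact_mod_cast hst) t.2)

lemma GoodPoint.abs_yuleSimonSum_le {w : ℝ × (ℕ → ℝ)} (hw : GoodPoint w) {p : ℝ} (hp : 0 ≤ p)
    {I : Finset ℝ≥0} {t : ℝ≥0} (hI : ∀ s ∈ I, s ≤ t) (c : ℝ≥0 → ℝ) :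
    |yuleSimonSum p I c t w| ≤ (∑ s ∈ I, |c s|) * yuleSimon p 1 w := by
  unfold yuleSimonSum
  rw [Finset.sum_mul]
  refine (Finset.abs_sum_le_sum_abs _ _).trans (Finset.sum_le_sum fun s hs => ?_)
  rw [abs_mul, Nat.abs_cast]
  exact mul_le_mul_of_nonneg_left (hw.yuleSimon_div_le hp (hI s hs)) (abs_nonneg _)

/-! ### Integration and differentiation of the exponent along Yule–Simon variables -/

section
variable {Ψ : ℝ → ℂ} {r C p : ℝ}

lemma IsTameExponent.integrable_rpow (hΨ : IsTameExponent Ψ r C) (hp : 0 ≤ p) (hpr : p * r < 1) :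
    Integrable (fun w => (yuleSimon p 1 w : ℝ) ^ r) yuleSimonMeasure :=
  integrable_yuleSimon_rpow hp (by linarith [hΨ.one_lt]) hΨ.le_two hpr

lemma IsTameExponent.integrable_yuleSimon (hΨ : IsTameExponent Ψ r C) (hp : 0 ≤ p)
    (hpr : p * r < 1) : Integrable (fun w => (yuleSimon p 1 w : ℝ)) yuleSimonMeasure := by
  have := integrable_yuleSimon_rpow (r := 1) hp zero_le_one one_le_two
    (by nlinarith [hΨ.one_lt])
  simpa using this

lemma IsTameExponent.norm_le_of_abs_le (hΨ : IsTameExponent Ψ r C) {S y z : ℝ} (hS : 0 ≤ S)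
    (hy : 0 ≤ y) (hz : |z| ≤ S * y) : ‖Ψ z‖ ≤ C * S * y + C * S ^ r * y ^ r := by
  have h0 := hΨ.nonneg
  have hr := hΨ.one_lt
  calc ‖Ψ z‖ ≤ C * (|z| + |z| ^ r) := hΨ.norm_le z
    _ ≤ C * (S * y + (S * y) ^ r) := by gcongr
    _ = _ := by rw [Real.mul_rpow hS hy]; ring

lemma IsTameExponent.integrable_comp (hΨ : IsTameExponent Ψ r C) (hp : 0 ≤ p) (hpr : p * r < 1)
    {A : ℝ × (ℕ → ℝ) → ℝ} (hA : Measurable A) {S : ℝ} (hS : 0 ≤ S)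
    (hAS : ∀ᵐ w ∂yuleSimonMeasure, |A w| ≤ S * yuleSimon p 1 w) :
    Integrable (fun w => Ψ (A w)) yuleSimonMeasure := by
  refine (((hΨ.integrable_yuleSimon hp hpr).const_mul (C * S)).add
    ((hΨ.integrable_rpow hp hpr).const_mul (C * S ^ r))).mono'
    (hΨ.differentiable.continuous.measurable.comp hA).aestronglyMeasurable ?_
  filter_upwards [hAS] with w hw
  exact hΨ.norm_le_of_abs_le hS (Nat.cast_nonneg _) hw

/-- The derivative grows with power `r - 1`, and the factor `y'` supplies the missing power. The
assumption `1 ≤ y` absorbs the additive constant, so a multiple of `Y 1 ^ r` dominates. -/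
lemma IsTameExponent.norm_deriv_mul_le (hΨ : IsTameExponent Ψ r C) {S y y' z : ℝ} (hS : 0 ≤ S)
    (hy : 1 ≤ y) (hy' : |y'| ≤ y) (hz : |z| ≤ S * y) :
    ‖deriv Ψ z * (y' : ℂ)‖ ≤ C * (1 + S ^ (r - 1)) * y ^ r := by
  have h0 := hΨ.nonneg
  have hr := hΨ.one_lt
  have hr1 : 0 ≤ r - 1 := by linarith
  have hy0 : 0 ≤ y := by linarith
  rw [norm_mul, Complex.norm_real, Real.norm_eq_abs]
  have h1 : y ^ r = y ^ (r - 1) * y := by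
    rw [← Real.rpow_add_one' hy0 (by linarith)]
    congr 1; ring
  have h2 : 1 ≤ y ^ (r - 1) := Real.one_le_rpow hy hr1
  calc ‖deriv Ψ z‖ * |y'| ≤ (C * (1 + |z| ^ (r - 1))) * y := by
        gcongr
        exact hΨ.norm_deriv_le z
    _ ≤ (C * (1 + (S * y) ^ (r - 1))) * y := by gcongr
    _ ≤ (C * (y ^ (r - 1) + (S * y) ^ (r - 1))) * y := by gcongr
    _ = _ := by rw [Real.mul_rpow hS hy0, h1]; ring

lemma IsTameExponent.integrable_deriv_mul (hΨ : IsTameExponent Ψ r C) (hp : 0 ≤ p)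
    (hpr : p * r < 1) {A Y : ℝ × (ℕ → ℝ) → ℝ} (hA : Measurable A) (hY : Measurable Y) {S : ℝ}
    (hS : 0 ≤ S) (hAS : ∀ w, GoodPoint w → |A w| ≤ S * yuleSimon p 1 w)
    (hYS : ∀ w, GoodPoint w → |Y w| ≤ yuleSimon p 1 w) :
    Integrable (fun w => deriv Ψ (A w) * (Y w : ℂ)) yuleSimonMeasure := by
  refine ((hΨ.integrable_rpow hp hpr).const_mul (C * (1 + S ^ (r - 1)))).mono'
    (Measurable.aestronglyMeasurable
      (((measurable_deriv Ψ).comp hA).mul (Complex.measurable_ofReal.comp hY))) ?_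
  filter_upwards [ae_goodPoint] with w hw
  exact hΨ.norm_deriv_mul_le hS (by exact_mod_cast hw.one_le_yuleSimon p) (hYS w hw) (hAS w hw)

lemma IsTameExponent.hasDerivAt_integral (hΨ : IsTameExponent Ψ r C) (hp : 0 ≤ p)
    (hpr : p * r < 1) {A Y : ℝ × (ℕ → ℝ) → ℝ} (hA : Measurable A) (hY : Measurable Y) {S : ℝ}
    (hS : 0 ≤ S) (hAS : ∀ w, GoodPoint w → |A w| ≤ S * yuleSimon p 1 w)
    (hYS : ∀ w, GoodPoint w → |Y w| ≤ yuleSimon p 1 w) :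
    HasDerivAt (fun h : ℝ => ∫ w, Ψ (A w + h * Y w) ∂yuleSimonMeasure)
      (∫ w, deriv Ψ (A w) * (Y w : ℂ) ∂yuleSimonMeasure) 0 := by
  have hm : ∀ h : ℝ, Measurable (fun w => A w + h * Y w) := fun h => hA.add (hY.const_mul h)
  -- A perturbation with `|h| < 1` costs at most one more multiple of `Y 1`, whence `S + 1`.
  have hb : ∀ h ∈ Metric.ball (0 : ℝ) 1, ∀ w, GoodPoint w →
      |A w + h * Y w| ≤ (S + 1) * yuleSimon p 1 w := by
    intro h hh w hw
    have h1 : |h| ≤ 1 := by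
      rw [mem_ball_zero_iff, Real.norm_eq_abs] at hh
      exact hh.le
    have h2 := hAS w hw
    have h3 := hYS w hw
    calc |A w + h * Y w| ≤ |A w| + |h| * |Y w| := by
          rw [← abs_mul]; exact abs_add_le _ _
      _ ≤ S * yuleSimon p 1 w + 1 * yuleSimon p 1 w := by gcongr
      _ = _ := by ring
  have key := (hasDerivAt_integral_of_dominated_loc_of_deriv_le
    (μ := yuleSimonMeasure) (F := fun (h : ℝ) w => Ψ (A w + h * Y w))
    (F' := fun h w => deriv Ψ (A w + h * Y w) * (Y w : ℂ)) (x₀ := 0)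
    (bound := fun w => C * (1 + (S + 1) ^ (r - 1)) * (yuleSimon p 1 w : ℝ) ^ r)
    (Metric.ball_mem_nhds 0 one_pos) (Eventually.of_forall fun h =>
      (hΨ.differentiable.continuous.measurable.comp (hm h)).aestronglyMeasurable)
    (hΨ.integrable_comp hp hpr (hm 0) (S := S + 1) (by linarith) ?_)
    (Measurable.aestronglyMeasurable
      (((measurable_deriv Ψ).comp (hm 0)).mul (Complex.measurable_ofReal.comp hY))) ?_
    ((hΨ.integrable_rpow hp hpr).const_mul _) ?_).2
  · simpa using key
  · filter_upwards [ae_goodPoint] with w hw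
    exact hb 0 (Metric.mem_ball_self one_pos) w hw
  · filter_upwards [ae_goodPoint] with w hw h hh
    exact hΨ.norm_deriv_mul_le (by linarith) (by exact_mod_cast hw.one_le_yuleSimon p) (hYS w hw)
      (hb h hh w hw)
  · refine ae_of_all _ fun w h _ => ?_
    have h1 : HasDerivAt (fun h : ℝ => A w + h * Y w) (Y w) h := by
      simpa using ((hasDerivAt_id h).mul_const (Y w)).const_add (A w)
    have h2 := (hΨ.differentiable (A w + h * Y w)).hasDerivAt.scomp h h1
    refine h2.congr_deriv ?_
    rw [Complex.real_smul, mul_comm]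

end

end ReinforcedLevy

/-! ### Integrability of the process and orthogonality of its rescaled increments -/

namespace ReinforcedLevy

lemma scaledProcess_of_pos {Ω : Type*} (p : ℝ) (ξ : ℝ≥0 → Ω → ℝ) {t : ℝ≥0} (ht : 0 < t) :
    scaledProcess p ξ t = fun ω => (t : ℝ) ^ (-p) * ξ t ω := by
  funext ω
  simp [scaledProcess, ht.ne']

lemma scaledProcess_zero {Ω : Type*} (p : ℝ) (ξ : ℝ≥0 → Ω → ℝ) :
    scaledProcess p ξ 0 = fun _ => 0 := by
  funext ω
  simp [scaledProcess]

variable {Ω : Type*} [MeasurableSpace Ω] {P : Measure Ω}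
  {Ψ : ℝ → ℂ} {r C p : ℝ} {ξ : ℝ≥0 → Ω → ℝ}

/-- The finite-dimensional distributions of a noise reinforced Lévy process with characteristic
exponent `Ψ`, indexed by finite sets of times. -/
structure HasReinforcedLaw (Ψ : ℝ → ℂ) (p : ℝ) (ξ : ℝ≥0 → Ω → ℝ) (P : Measure Ω) : Prop where
  measurable : ∀ t, Measurable (ξ t)
  charFun_eq : ∀ (I : Finset ℝ≥0) (c : ℝ≥0 → ℝ) (t : ℝ≥0), (∀ s ∈ I, 0 < s ∧ s ≤ t) →
    ∫ ω, Complex.exp (Complex.I * ((∑ s ∈ I, c s * ξ s ω : ℝ) : ℂ)) ∂P =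
      Complex.exp ((1 - (p : ℂ)) * ((t : ℝ) : ℂ) *
        ∫ w, Ψ (yuleSimonSum p I c t w) ∂yuleSimonMeasure)

lemma IsNoiseReinforcedLevy.hasReinforcedLaw {T : LevyTriplet}
    (h : IsNoiseReinforcedLevy T p ξ P) : HasReinforcedLaw T.exponent p ξ P := by
  refine ⟨h.measurable, fun I c t hI => ?_⟩
  have hsum : ∀ f : ℝ≥0 → ℝ, ∑ i, f (I.orderEmbOfFin rfl i) = ∑ s ∈ I, f s := by
    intro f
    conv_rhs => rw [← Finset.map_orderEmbOfFin_univ I rfl]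
    rw [Finset.sum_map]
    rfl
  have h1 := h.charFun_eq I.card (I.orderEmbOfFin rfl) (fun i => c (I.orderEmbOfFin rfl i)) t
    (I.orderEmbOfFin rfl).strictMono (fun i => (hI _ (I.orderEmbOfFin_mem rfl i)).1)
    (fun i => (hI _ (I.orderEmbOfFin_mem rfl i)).2)
  have h2 : ∀ ω, ∑ i, c (I.orderEmbOfFin rfl i) * ξ (I.orderEmbOfFin rfl i) ω =
      ∑ s ∈ I, c s * ξ s ω := fun ω => hsum fun s => c s * ξ s ω
  have h3 : ∀ w, ∑ i, c (I.orderEmbOfFin rfl i) *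
      (yuleSimon p ((I.orderEmbOfFin rfl i : ℝ) / (t : ℝ)) w : ℝ) = yuleSimonSum p I c t w :=
    fun w => hsum fun s => c s * (yuleSimon p ((s : ℝ) / (t : ℝ)) w : ℝ)
  simp_rw [h2, h3] at h1
  exact h1

variable [IsProbabilityMeasure P]

/-- With the horizon equal to `t` itself, the logarithm of the characteristic function is `(1 - p) t
E[Ψ (l * Y 1)]`. The hypotheses of the integrability criterion reduce, by Tonelli, to finite moments
of `Y 1` of orders `1` and `r`. -/
lemma HasReinforcedLaw.integrable (h : HasReinforcedLaw Ψ p ξ P) (hΨ : IsTameExponent Ψ r C)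
    (hp : 0 ≤ p) (hp1 : p ≤ 1) (hpr : p * r < 1) {t : ℝ≥0} (ht : 0 < t) :
    Integrable (ξ t) P := by
  have hC := hΨ.nonneg
  have hr := hΨ.one_lt
  have ht0 : (0 : ℝ) < t := ht
  have hΨm : Measurable Ψ := hΨ.differentiable.continuous.measurable
  set Y : ℝ × (ℕ → ℝ) → ℝ := fun w => (yuleSimon p 1 w : ℝ) with hY
  have hYm : Measurable Y := measurable_yuleSimon_cast p 1
  have hYi : Integrable Y yuleSimonMeasure := hΨ.integrable_yuleSimon hp hpr
  have hYr : Integrable (fun w => Y w ^ r) yuleSimonMeasure := hΨ.integrable_rpow hp hpr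
  have hY0 : ∀ w, 0 ≤ Y w := fun w => Nat.cast_nonneg _
  set κ : ℝ := (1 - p) * t with hκ
  have hκ0 : 0 ≤ κ := mul_nonneg (by linarith) ht0.le
  have hi : ∀ l : ℝ, Integrable (fun w => Ψ (l * Y w)) yuleSimonMeasure := fun l =>
    hΨ.integrable_comp hp hpr (hYm.const_mul l) (abs_nonneg l)
      (ae_of_all _ fun w => by rw [abs_mul, abs_of_nonneg (hY0 w)])
  set η : ℝ → ℂ := fun l => (κ : ℂ) * ∫ w, Ψ (l * Y w) ∂yuleSimonMeasure with hη
  have hηre : ∀ l, -(η l).re = ∫ w, -(κ * (Ψ (l * Y w)).re) ∂yuleSimonMeasure := by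
    intro l
    rw [hη]
    simp only
    rw [Complex.re_ofReal_mul, integral_neg, integral_const_mul]
    congr 2
    exact (integral_re (𝕜 := ℂ) (hi l)).symm
  have hre0 : ∀ y, 0 ≤ -(κ * (Ψ y).re) := fun y => by
    have := mul_nonneg hκ0 (neg_nonneg.2 (hΨ.re_nonpos y))
    linarith
  refine integrable_of_charFun_eq_exp (h.measurable t) (η := η)
    (B := κ * ∫ w, (C * (Y w + Y w ^ r)) ∂yuleSimonMeasure) (fun l => ?_) (fun l => ?_)
    (fun l hl => ?_) ?_
  · have h1 := h.charFun_eq {t} (fun _ => l) t (by simpa using ht)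
    simp only [yuleSimonSum, Finset.sum_singleton, div_self ht0.ne'] at h1
    rw [h1, hη, hκ]
    congr 2
    push_cast
    ring
  · have : 0 ≤ ∫ w, -(κ * (Ψ (l * Y w)).re) ∂yuleSimonMeasure :=
      integral_nonneg fun w => hre0 (l * Y w)
    rw [← hηre] at this
    linarith
  · rw [hη]
    simp only
    rw [norm_mul, Complex.norm_real, Real.norm_of_nonneg hκ0, mul_assoc κ]
    refine mul_le_mul_of_nonneg_left ?_ hκ0
    rw [← integral_mul_const]
    refine norm_integral_le_of_norm_le (((hYi.add hYr).const_mul C).mul_const l)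
      (ae_of_all _ fun w => ?_)
    refine (hΨ.norm_le _).trans ?_
    rw [abs_mul, abs_of_pos hl.1, abs_of_nonneg (hY0 w), Real.mul_rpow hl.1.le (hY0 w)]
    have h1 : l ^ r ≤ l := by
      simpa using Real.rpow_le_rpow_of_exponent_ge hl.1 hl.2 hr.le
    have h2 : 0 ≤ Y w ^ r := Real.rpow_nonneg (hY0 w) r
    rw [mul_assoc]
    refine mul_le_mul_of_nonneg_left ?_ hC
    nlinarith
  · have h1 : ∀ l ∈ Set.Ioc (0 : ℝ) 1, ENNReal.ofReal (-(η l).re / l ^ 2) =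
        ENNReal.ofReal κ * ∫⁻ w, ENNReal.ofReal (-(Ψ (l * Y w)).re / l ^ 2) ∂yuleSimonMeasure := by
      intro l hl
      have hnn : ∀ w, 0 ≤ -(κ * (Ψ (l * Y w)).re) / l ^ 2 := fun w =>
        div_nonneg (hre0 _) (by positivity)
      have h4 : Integrable (fun w => -(κ * (Ψ (l * Y w)).re) / l ^ 2) yuleSimonMeasure :=
        ((hi l).re.const_mul κ).neg.div_const _
      rw [hηre, ← integral_div, ofReal_integral_eq_lintegral_ofReal h4 (ae_of_all _ hnn),
        ← lintegral_const_mul' _ _ ENNReal.ofReal_ne_top]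
      refine lintegral_congr fun w => ?_
      rw [← ENNReal.ofReal_mul hκ0]
      congr 1
      ring
    have hjm : Measurable (fun q : ℝ × (ℝ × (ℕ → ℝ)) =>
        ENNReal.ofReal (-(Ψ (q.1 * Y q.2)).re / q.1 ^ 2)) := by
      have : Measurable (fun q : ℝ × (ℝ × (ℕ → ℝ)) => Ψ (q.1 * Y q.2)) :=
        hΨm.comp (measurable_fst.mul (hYm.comp measurable_snd))
      exact ((Complex.measurable_re.comp this).neg.div (measurable_fst.pow_const 2)).ennreal_ofReal
    rw [setLIntegral_congr_fun measurableSet_Ioc h1,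
      lintegral_const_mul' _ _ ENNReal.ofReal_ne_top,
      lintegral_lintegral_swap hjm.aemeasurable]
    refine ENNReal.mul_lt_top ENNReal.ofReal_lt_top ?_
    have h5 : Integrable (fun w => C * (Y w + Y w ^ r)) yuleSimonMeasure :=
      (hYi.add hYr).const_mul C
    refine lt_of_le_of_lt (lintegral_mono fun w => hΨ.lintegral_re_le (Y w)) ?_
    simp_rw [abs_of_nonneg (hY0 _)]
    have h6 := h5.hasFiniteIntegral
    rwa [hasFiniteIntegral_iff_ofReal (ae_of_all _ fun w => by
      have := hY0 w
      simp only [Pi.zero_apply]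
      positivity)] at h6

/-- Differentiating the joint characteristic function in one of its variables. -/
lemma HasReinforcedLaw.integral_mul_exp (h : HasReinforcedLaw Ψ p ξ P)
    (hΨ : IsTameExponent Ψ r C) (hp : 0 ≤ p) (hp1 : p ≤ 1) (hpr : p * r < 1) {I : Finset ℝ≥0}
    (c : ℝ≥0 → ℝ) {t : ℝ≥0} (hI : ∀ s ∈ I, 0 < s ∧ s ≤ t) {u : ℝ≥0} (hu : u ∈ I) :
    Complex.I * ∫ ω, (ξ u ω : ℂ) * Complex.exp (Complex.I * ((∑ s ∈ I, c s * ξ s ω : ℝ) : ℂ)) ∂P =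
      Complex.exp ((1 - (p : ℂ)) * ((t : ℝ) : ℂ) *
        ∫ w, Ψ (yuleSimonSum p I c t w) ∂yuleSimonMeasure) * ((1 - (p : ℂ)) * ((t : ℝ) : ℂ) *
        ∫ w, deriv Ψ (yuleSimonSum p I c t w) * ((yuleSimon p ((u : ℝ) / t) w : ℝ) : ℂ)
          ∂yuleSimonMeasure) := by
  classical
  set S : Ω → ℝ := fun ω => ∑ s ∈ I, c s * ξ s ω with hS
  have hSm : Measurable S := Finset.measurable_fun_sum _ fun s _ => (h.measurable s).const_mul _
  have hXi := h.integrable hΨ hp hp1 hpr (hI u hu).1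
  have hXm := h.measurable u
  have h1 : ∀ l : ℝ, ∫ ω, Complex.exp (Complex.I * ((S ω + l * ξ u ω : ℝ) : ℂ)) ∂P =
      Complex.exp ((1 - (p : ℂ)) * ((t : ℝ) : ℂ) * ∫ w, Ψ (yuleSimonSum p I c t w +
        l * (yuleSimon p ((u : ℝ) / t) w : ℝ)) ∂yuleSimonMeasure) := by
    intro l
    -- Only the coefficient of `u` is perturbed; since `u ∈ I`, the set of times does not change.
    have h2 := h.charFun_eq I (fun s => c s + if s = u then l else 0) t hI
    have h3 : ∀ f : ℝ≥0 → ℝ, ∑ s ∈ I, (c s + if s = u then l else 0) * f s =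
        ∑ s ∈ I, c s * f s + l * f u := by
      intro f
      simp_rw [add_mul, Finset.sum_add_distrib, ite_mul, zero_mul]
      rw [Finset.sum_ite_eq' I u, if_pos hu]
    simp only [yuleSimonSum, h3] at h2
    exact h2
  have hleft : HasDerivAt
      (fun l : ℝ => ∫ ω, Complex.exp (Complex.I * ((S ω + l * ξ u ω : ℝ) : ℂ)) ∂P)
      (∫ ω, Complex.exp (Complex.I * ((S ω + 0 * ξ u ω : ℝ) : ℂ)) *
        (Complex.I * (ξ u ω : ℂ)) ∂P) 0 := by
    have hmm : ∀ l : ℝ, Measurable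
        (fun ω => Complex.exp (Complex.I * ((S ω + l * ξ u ω : ℝ) : ℂ))) := fun l => by fun_prop
    refine (hasDerivAt_integral_of_dominated_loc_of_deriv_le (μ := P)
      (F := fun (l : ℝ) ω => Complex.exp (Complex.I * ((S ω + l * ξ u ω : ℝ) : ℂ)))
      (F' := fun (l : ℝ) ω => Complex.exp (Complex.I * ((S ω + l * ξ u ω : ℝ) : ℂ)) *
        (Complex.I * (ξ u ω : ℂ))) (bound := fun ω => ‖ξ u ω‖) univ_mem
      (Eventually.of_forall fun l => (hmm l).aestronglyMeasurable)
      (integrable_exp_mul_I (by fun_prop))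
      (Measurable.aestronglyMeasurable ((hmm 0).mul (by fun_prop)))
      (ae_of_all _ fun ω l _ => ?_) hXi.norm (ae_of_all _ fun ω l _ => ?_)).2
    · rw [norm_mul, mul_comm Complex.I ((S ω + l * ξ u ω : ℝ) : ℂ),
        Complex.norm_exp_ofReal_mul_I, norm_mul, Complex.norm_I, Complex.norm_real]
      simp
    · have h4 : HasDerivAt (fun l : ℝ => S ω + l * ξ u ω) (ξ u ω) l := by
        simpa using ((hasDerivAt_id l).mul_const (ξ u ω)).const_add (S ω)
      exact (h4.ofReal_comp.const_mul Complex.I).cexp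
  have hright : HasDerivAt (fun l : ℝ => ∫ w, Ψ (yuleSimonSum p I c t w +
        l * (yuleSimon p ((u : ℝ) / t) w : ℝ)) ∂yuleSimonMeasure)
      (∫ w, deriv Ψ (yuleSimonSum p I c t w) * ((yuleSimon p ((u : ℝ) / t) w : ℝ) : ℂ)
        ∂yuleSimonMeasure) 0 :=
    hΨ.hasDerivAt_integral hp hpr (measurable_yuleSimonSum p I c t)
      (measurable_yuleSimon_cast p _) (S := ∑ s ∈ I, |c s|)
      (Finset.sum_nonneg fun _ _ => abs_nonneg _)
      (fun w hw => hw.abs_yuleSimonSum_le hp (fun s hs => (hI s hs).2) c)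
      (fun w hw => by rw [Nat.abs_cast]; exact hw.yuleSimon_div_le hp (hI u hu).2)
  have hright' := (hright.const_mul ((1 - (p : ℂ)) * ((t : ℝ) : ℂ))).cexp
  simp_rw [← h1] at hright'
  -- Both are derivatives at `0` of the same function, one computed under `P`, the other under the
  -- Yule–Simon law.
  have h5 := hleft.unique hright'
  simp only [zero_mul, add_zero] at h5
  rw [h.charFun_eq I c t hI] at h5
  rw [← h5, ← integral_const_mul]
  refine integral_congr_ae (ae_of_all _ fun ω => ?_)
  simp only [hS]
  ring

lemma HasReinforcedLaw.integrable_scaled (h : HasReinforcedLaw Ψ p ξ P)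
    (hΨ : IsTameExponent Ψ r C) (hp : 0 ≤ p) (hp1 : p ≤ 1) (hpr : p * r < 1) (t : ℝ≥0) :
    Integrable (scaledProcess p ξ t) P := by
  rcases eq_zero_or_pos t with rfl | ht
  · rw [scaledProcess_zero]; exact integrable_zero _ _ _
  · rw [scaledProcess_of_pos p ξ ht]
    exact (h.integrable hΨ hp hp1 hpr ht).const_mul _

/-- The increments of the rescaled process are orthogonal to its past. -/
lemma HasReinforcedLaw.integral_increment_mul_exp (h : HasReinforcedLaw Ψ p ξ P)
    (hΨ : IsTameExponent Ψ r C) (hp : 0 ≤ p) (hp1 : p ≤ 1) (hpr : p * r < 1) {I : Finset ℝ≥0}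
    (c : ℝ≥0 → ℝ) {s t : ℝ≥0} (hst : s < t) (hI : ∀ u ∈ I, 0 < u ∧ u ≤ s) :
    ∫ ω, ((scaledProcess p ξ t ω - scaledProcess p ξ s ω : ℝ) : ℂ) *
      Complex.exp (Complex.I * ((∑ u ∈ I, c u * ξ u ω : ℝ) : ℂ)) ∂P = 0 := by
  classical
  have ht : 0 < t := zero_le.trans_lt hst
  have ht0 : (0 : ℝ) < t := ht
  rcases eq_zero_or_pos s with rfl | hs
  -- At `s = 0` the past is trivial, and the claim is that `ξ t` has mean zero, which is `Ψ'(0) =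
  -- 0`.
  · have hI0 : I = ∅ := Finset.eq_empty_of_forall_notMem fun u hu =>
      absurd (hI u hu).2 (not_le.2 (hI u hu).1)
    subst hI0
    have h1 := h.integral_mul_exp hΨ hp hp1 hpr (I := {t}) (fun _ => 0) (t := t)
      (by simpa using ht) (u := t) (by simp)
    simp [yuleSimonSum, hΨ.deriv_zero] at h1
    rw [scaledProcess_of_pos p ξ ht, scaledProcess_zero]
    simp only [sub_zero, Finset.sum_empty, Complex.ofReal_zero, mul_zero, Complex.exp_zero, mul_one,
      Complex.ofReal_mul]
    rw [integral_const_mul]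
    simp [h1]
  · have hs0 : (0 : ℝ) < s := hs
    have hsI : ∀ u ∈ I, u ≠ t := fun u hu => ((hI u hu).2.trans_lt hst).ne
    -- The times `s` and `t` join the family with coefficient zero, unless already in `I`:
    -- derivatives may be taken at them while the exponential is unaffected.
    set J := insert s (insert t I) with hJ
    set c' : ℝ≥0 → ℝ := fun u => if u ∈ I then c u else 0 with hc'
    have hJm : ∀ u ∈ J, 0 < u ∧ u ≤ t := by
      intro u hu
      simp only [hJ, Finset.mem_insert] at hu
      rcases hu with rfl | rfl | hu
      · exact ⟨hs, hst.le⟩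
      · exact ⟨ht, le_rfl⟩
      · exact ⟨(hI u hu).1, (hI u hu).2.trans hst.le⟩
    have hsum : ∀ f : ℝ≥0 → ℝ, ∑ u ∈ J, c' u * f u = ∑ u ∈ I, c u * f u := by
      intro f
      have hIJ : I ⊆ J := fun u hu => by simp [hJ, hu]
      rw [← Finset.sum_subset hIJ (f := fun u => c' u * f u)]
      · exact Finset.sum_congr rfl fun u hu => by simp [hc', hu]
      · intro u _ hu
        simp [hc', hu]
    have e1 := h.integral_mul_exp hΨ hp hp1 hpr c' hJm (u := t) (by simp [hJ])
    have e2 := h.integral_mul_exp hΨ hp hp1 hpr c' hJm (u := s) (by simp [hJ])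
    have hY : ∀ w, yuleSimonSum p J c' t w = yuleSimonSum p I c t w := fun w =>
      hsum fun u => (yuleSimon p ((u : ℝ) / t) w : ℝ)
    simp_rw [hsum, hY] at e1 e2
    rw [div_self ht0.ne'] at e1
    have hst0 : 0 < (s : ℝ) / t := div_pos hs0 ht0
    have hst1 : (s : ℝ) / t ≤ 1 := div_le_one_of_le₀ (by exact_mod_cast hst.le) ht0.le
    have hcoe : ∀ w, yuleSimonSum p I c t w =
        ∑ u : I, c u * (yuleSimon p (((u : ℝ≥0) : ℝ) / t) w : ℝ) := fun w =>
      (Finset.sum_coe_sort I fun u => c u * (yuleSimon p ((u : ℝ) / t) w : ℝ)).symm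
    have hint : ∀ v : ℝ, v ≤ 1 → Integrable (fun w => (yuleSimon p v w : ℂ) *
        deriv Ψ (∑ u : I, c u * (yuleSimon p (((u : ℝ≥0) : ℝ) / t) w : ℝ))) yuleSimonMeasure := by
      intro v hv
      have := hΨ.integrable_deriv_mul hp hpr (measurable_yuleSimonSum p I c t)
        (measurable_yuleSimon_cast p v) (S := ∑ s ∈ I, |c s|)
        (Finset.sum_nonneg fun _ _ => abs_nonneg _)
        (fun w hw => hw.abs_yuleSimonSum_le hp (fun u hu => (hI u hu).2.trans hst.le) c)
        (fun w hw => by rw [Nat.abs_cast]; exact_mod_cast hw.yuleSimon_mono hp hv)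
      refine this.congr (ae_of_all _ fun w => ?_)
      simp only [hcoe]
      push_cast
      ring
    -- The Yule–Simon martingale identity between the rescaled times `s / t` and `1`, with `g = Ψ'`.
    have e3 := integral_yuleSimon_mul (ι := I) hp hst0 hst1
      (r := fun u => ((u : ℝ≥0) : ℝ) / t) (fun u => div_pos (hI u u.2).1 ht0)
      (fun u => by have := (hI u u.2).2; gcongr) (fun u => c u) (g := deriv Ψ) hΨ.deriv_zero
      (hint 1 le_rfl) (hint _ hst1)
    have e4 : ∫ w, deriv Ψ (yuleSimonSum p I c t w) * ((yuleSimon p 1 w : ℝ) : ℂ)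
          ∂yuleSimonMeasure = ((((s : ℝ) / t) ^ (-p) : ℝ) : ℂ) *
        ∫ w, deriv Ψ (yuleSimonSum p I c t w) * ((yuleSimon p ((s : ℝ) / t) w : ℝ) : ℂ)
          ∂yuleSimonMeasure := by
      simp only [hcoe, Complex.ofReal_natCast, mul_comm (deriv Ψ _)]
      exact e3
    rw [e4] at e1
    set Z : Ω → ℂ := fun ω => Complex.exp (Complex.I * ((∑ u ∈ I, c u * ξ u ω : ℝ) : ℂ)) with hZ
    have e5 : ∫ ω, (ξ t ω : ℂ) * Z ω ∂P =
        ((((s : ℝ) / t) ^ (-p) : ℝ) : ℂ) * ∫ ω, (ξ s ω : ℂ) * Z ω ∂P := by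
      apply mul_left_cancel₀ Complex.I_ne_zero
      rw [mul_left_comm, e1, e2]
      ring
    have hZm : Measurable Z := by
      have : Measurable (fun ω => ∑ u ∈ I, c u * ξ u ω) :=
        Finset.measurable_fun_sum _ fun s _ => (h.measurable s).const_mul _
      fun_prop
    have hZ1 : ∀ ω, ‖Z ω‖ ≤ 1 := fun ω => by
      change ‖Complex.exp (Complex.I * _)‖ ≤ 1
      rw [mul_comm, Complex.norm_exp_ofReal_mul_I]
    have hiZ : ∀ u : ℝ≥0, 0 < u → Integrable (fun ω => (((u : ℝ) ^ (-p) : ℝ) : ℂ) *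
        ((ξ u ω : ℂ) * Z ω)) P := fun u hu =>
      ((h.integrable hΨ hp hp1 hpr hu).ofReal.mul_bdd hZm.aestronglyMeasurable
        (ae_of_all _ hZ1)).const_mul _
    rw [scaledProcess_of_pos p ξ ht, scaledProcess_of_pos p ξ hs]
    have e6 : ∀ ω, (((t : ℝ) ^ (-p) * ξ t ω - (s : ℝ) ^ (-p) * ξ s ω : ℝ) : ℂ) * Z ω =
        (((t : ℝ) ^ (-p) : ℝ) : ℂ) * ((ξ t ω : ℂ) * Z ω) -
        (((s : ℝ) ^ (-p) : ℝ) : ℂ) * ((ξ s ω : ℂ) * Z ω) := by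
      intro ω
      push_cast
      ring
    refine (integral_congr_ae (ae_of_all _ e6)).trans ?_
    -- The powers match because `t ^ (-p) * (s / t) ^ (-p) = s ^ (-p)`.
    rw [integral_sub (hiZ t ht) (hiZ s hs), integral_const_mul, integral_const_mul, e5,
      ← mul_assoc, ← Complex.ofReal_mul, ← Real.mul_rpow ht0.le hst0.le,
      mul_div_cancel₀ _ ht0.ne', sub_self]

end ReinforcedLevy

/-! ### From Fourier orthogonality to the martingale property -/

namespace ReinforcedLevy

variable {Ω : Type*} [mΩ : MeasurableSpace Ω] {P : Measure Ω}

/-- An integrable variable whose joint Fourier transform with a finite family vanishes has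
vanishing integrals over the events determined by that family. -/
lemma withDensity_map_eq_of_fourier {ι : Type*} [Fintype ι] {D : Ω → ℝ} (hD : Integrable D P)
    (hDm : Measurable D) {V : Ω → ι → ℝ} (hV : Measurable V)
    (h : ∀ c : ι → ℝ, ∫ ω, (D ω : ℂ) * Complex.exp (Complex.I * ((∑ i, c i * V ω i : ℝ) : ℂ)) ∂P
      = 0) :
    (P.withDensity fun ω => ENNReal.ofReal (D ω)).map V =
      (P.withDensity fun ω => ENNReal.ofReal (-D ω)).map V := by
  classical
  have hfin : ∀ {f : Ω → ℝ}, Integrable f P →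
      IsFiniteMeasure (P.withDensity fun ω => ENNReal.ofReal (f ω)) := fun hf =>
    isFiniteMeasure_withDensity_ofReal hf.hasFiniteIntegral
  have := hfin hD
  have := hfin hD.fun_neg
  -- Fourier uniqueness is applied to the positive and negative parts of `D` as finite measures; the
  -- difference of their transforms is the integral assumed to vanish.
  refine Measure.ext_of_charFunDual (funext fun L => ?_)
  set c : ι → ℝ := fun i => L (fun j => if i = j then 1 else 0) with hc
  have hL : ∀ y, L y = ∑ i, c i * y i := by
    intro y
    have := L.toLinearMap.pi_apply_eq_sum_univ y
    simpa [hc, mul_comm] using this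
  set Z : Ω → ℂ := fun ω => Complex.exp (L (V ω) * Complex.I) with hZ
  have hLV : Measurable (fun ω => L (V ω)) := L.continuous.measurable.comp hV
  have hZm : Measurable Z := by fun_prop
  have hZ1 : ∀ ω, ‖Z ω‖ ≤ 1 := fun ω => (Complex.norm_exp_ofReal_mul_I _).le
  have key : ∀ f : Ω → ℝ, Measurable f →
      charFunDual ((P.withDensity fun ω => ENNReal.ofReal (f ω)).map V) L =
      ∫ ω, ((max (f ω) 0 : ℝ) : ℂ) * Z ω ∂P := by
    intro f hf
    rw [charFunDual_apply, integral_map hV.aemeasurable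
      (Measurable.aestronglyMeasurable (by fun_prop)),
      integral_withDensity_eq_integral_toReal_smul hf.ennreal_ofReal
        (ae_of_all _ fun _ => ENNReal.ofReal_lt_top)]
    refine integral_congr_ae (ae_of_all _ fun ω => ?_)
    change (ENNReal.ofReal (f ω)).toReal • Z ω = _
    rw [ENNReal.toReal_ofReal', Complex.real_smul]
  rw [key D hDm, key (fun ω => -D ω) hDm.neg]
  have hi : ∀ {f : Ω → ℝ}, Integrable f P →
      Integrable (fun ω => ((max (f ω) 0 : ℝ) : ℂ) * Z ω) P := fun hf =>
    hf.pos_part.ofReal.mul_bdd hZm.aestronglyMeasurable (ae_of_all _ hZ1)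
  rw [← sub_eq_zero, ← integral_sub (hi hD) (hi hD.fun_neg), ← h c]
  refine integral_congr_ae (ae_of_all _ fun ω => ?_)
  simp only
  rw [← sub_mul, ← Complex.ofReal_sub, max_zero_sub_max_neg_zero_eq_self]
  simp only [hZ]
  rw [hL, mul_comm Complex.I]

/-- Events determined by finitely many of the variables form a π-system generating the past, and on
it the positive and negative parts of `D` have equal mass. -/
lemma setIntegral_eq_zero_of_fourier {ι : Type*} {D : Ω → ℝ} (hD : Integrable D P)
    (hDm : Measurable D) {X : ι → Ω → ℝ} (hX : ∀ i, Measurable (X i)) {S : Set ι}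
    (h : ∀ I : Finset ι, ↑I ⊆ S → ∀ c : ι → ℝ,
      ∫ ω, (D ω : ℂ) * Complex.exp (Complex.I * ((∑ i ∈ I, c i * X i ω : ℝ) : ℂ)) ∂P = 0)
    {A : Set Ω} (hA : MeasurableSet[⨆ i ∈ S, MeasurableSpace.comap (X i) inferInstance] A) :
    ∫ ω in A, D ω ∂P = 0 := by
  classical
  have hle : (⨆ i ∈ S, MeasurableSpace.comap (X i) inferInstance) ≤ mΩ :=
    iSup₂_le fun i _ => (hX i).comap_le
  have hfin : ∀ {f : Ω → ℝ}, Integrable f P →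
      IsFiniteMeasure (P.withDensity fun ω => ENNReal.ofReal (f ω)) := fun hf =>
    isFiniteMeasure_withDensity_ofReal hf.hasFiniteIntegral
  have := hfin hD
  have := hfin hD.fun_neg
  have hcyl : ∀ I : Finset ι, ↑I ⊆ S → ∀ B : Set (I → ℝ), MeasurableSet B →
      (P.withDensity fun ω => ENNReal.ofReal (D ω)) ((fun ω (i : I) => X i ω) ⁻¹' B) =
      (P.withDensity fun ω => ENNReal.ofReal (-D ω)) ((fun ω (i : I) => X i ω) ⁻¹' B) := by
    intro I hI B hB
    have hV : Measurable (fun ω (i : I) => X i ω) := measurable_pi_lambda _ fun i => hX i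
    have h1 := withDensity_map_eq_of_fourier hD hDm hV (fun c => by
      have h2 := h I hI (fun i => if hi : i ∈ I then c ⟨i, hi⟩ else 0)
      have h3 : ∀ ω, ∑ i ∈ I, (if hi : i ∈ I then c ⟨i, hi⟩ else 0) * X i ω =
          ∑ i : I, c i * X i ω := by
        intro ω
        rw [← Finset.sum_coe_sort]
        exact Finset.sum_congr rfl fun i _ => by simp
      simp_rw [h3] at h2
      exact h2)
    rw [← Measure.map_apply hV hB, h1, Measure.map_apply hV hB]
  have hAeq : (P.withDensity fun ω => ENNReal.ofReal (D ω)) A =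
      (P.withDensity fun ω => ENNReal.ofReal (-D ω)) A := by
    refine ext_on_measurableSpace_of_generate_finite mΩ
      (piiUnionInter (fun i => {s | MeasurableSet[MeasurableSpace.comap (X i) inferInstance] s}) S)
      ?_ hle (generateFrom_piiUnionInter_measurableSet _ S).symm
      (isPiSystem_piiUnionInter _ (fun i => @MeasurableSpace.isPiSystem_measurableSet Ω
        (MeasurableSpace.comap (X i) inferInstance)) S) ?_ hA
    · rintro _ ⟨I, hI, f, hf, rfl⟩
      choose! B hB hBf using hf
      have h4 : (⋂ x ∈ I, f x) = (fun ω (i : I) => X i ω) ⁻¹' {y | ∀ i : I, y i ∈ B i} := by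
        ext ω
        simp only [Set.mem_iInter, Set.mem_preimage, Set.mem_ofPred_eq, Subtype.forall]
        refine forall₂_congr fun i hi => ?_
        rw [← hBf i hi]
        rfl
      rw [h4]
      refine hcyl I hI _ ?_
      rw [show {y : I → ℝ | ∀ i : I, y i ∈ B i} = ⋂ i : I, (fun y => y i) ⁻¹' B i by
        ext y; simp]
      exact MeasurableSet.iInter fun i => measurable_pi_apply i (hB i i.2)
    -- Equality of total masses is the case of the empty family.
    · exact hcyl ∅ (by simp) Set.univ MeasurableSet.univ
  have hAm : MeasurableSet A := hle A hA
  rw [withDensity_apply _ hAm, withDensity_apply _ hAm] at hAeq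
  rw [integral_eq_lintegral_pos_part_sub_lintegral_neg_part hD.integrableOn, hAeq, sub_self]

variable [IsProbabilityMeasure P] {Ψ : ℝ → ℂ} {r C p : ℝ} {ξ : ℝ≥0 → Ω → ℝ}

lemma HasReinforcedLaw.martingale_scaled (h : HasReinforcedLaw Ψ p ξ P)
    (hΨ : IsTameExponent Ψ r C) (hp : 0 ≤ p) (hp1 : p ≤ 1) (hpr : p * r < 1) :
    Martingale (scaledProcess p ξ) (Filtration.natural (scaledProcess p ξ)
      (scaledProcess_stronglyMeasurable p h.measurable)) P := by
  classical
  have hsm := scaledProcess_stronglyMeasurable p h.measurable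
  have hi := h.integrable_scaled hΨ hp hp1 hpr
  refine ⟨Filtration.stronglyAdapted_natural hsm, fun s t hst => ?_⟩
  refine (ae_eq_condExp_of_forall_setIntegral_eq (Filtration.le _ _) (hi t)
    (fun A _ _ => (hi s).integrableOn) (fun A hA _ => ?_)
    ((Filtration.stronglyAdapted_natural hsm) s).aestronglyMeasurable).symm
  rcases hst.eq_or_lt with rfl | hst
  · rfl
  rw [← sub_eq_zero, ← neg_eq_zero, neg_sub,
    ← integral_sub (hi t).integrableOn (hi s).integrableOn]
  refine setIntegral_eq_zero_of_fourier ((hi t).sub (hi s))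
    ((hsm t).measurable.sub (hsm s).measurable) (fun u => (hsm u).measurable) (S := Set.Iic s)
    (fun I hI c => ?_) hA
  -- Time `0` is discarded, as `M 0 = 0` and the law is prescribed at positive times only; the
  -- scaling `u ^ (-p)` moves into the coefficients.
  have h1 := h.integral_increment_mul_exp hΨ hp hp1 hpr (I := I.filter (0 < ·))
    (fun u => c u * (u : ℝ) ^ (-p)) hst (fun u hu => by
      rw [Finset.mem_filter] at hu
      exact ⟨hu.2, hI hu.1⟩)
  have h2 : ∀ ω, ∑ u ∈ I, c u * scaledProcess p ξ u ω =
      ∑ u ∈ I.filter (0 < ·), c u * (u : ℝ) ^ (-p) * ξ u ω := by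
    intro ω
    rw [Finset.sum_filter]
    refine Finset.sum_congr rfl fun u _ => ?_
    rcases eq_zero_or_pos u with rfl | hu
    · simp [scaledProcess]
    · rw [if_pos hu, scaledProcess_of_pos p ξ hu, mul_assoc]
  simp_rw [h2]
  exact h1

end ReinforcedLevy

namespace ReinforcedLevy

/-! ### Dyadic times -/

/-- The `k`-th point of the dyadic grid of mesh `2 ^ (-m)`. -/
noncomputable def gridPoint (m k : ℕ) : ℝ≥0 := (k : ℝ≥0) / 2 ^ m

/-- The set of dyadic times. -/
def dyadics : Set ℝ≥0 := {d | ∃ m k, d = gridPoint m k}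

lemma gridPoint_mem (m k : ℕ) : gridPoint m k ∈ dyadics := ⟨m, k, rfl⟩

lemma gridPoint_mono (m : ℕ) : Monotone (gridPoint m) := fun i j hij => by
  unfold gridPoint; gcongr

lemma gridPoint_lt_iff {m i j : ℕ} : gridPoint m i < gridPoint m j ↔ i < j := by
  unfold gridPoint
  rw [div_lt_div_iff_of_pos_right (by positivity), Nat.cast_lt]

lemma gridPoint_le_iff {m i j : ℕ} : gridPoint m i ≤ gridPoint m j ↔ i ≤ j := by
  unfold gridPoint
  rw [div_le_div_iff_of_pos_right (by positivity), Nat.cast_le]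

lemma gridPoint_mul_two_pow (m k : ℕ) : gridPoint m (k * 2 ^ m) = k := by
  unfold gridPoint
  push_cast
  exact mul_div_cancel_right₀ _ (by positivity)

lemma exists_gridPoint_of_le {m n : ℕ} (h : m ≤ n) (k : ℕ) :
    gridPoint m k = gridPoint n (k * 2 ^ (n - m)) := by
  unfold gridPoint
  obtain ⟨j, rfl⟩ := Nat.exists_eq_add_of_le h
  rw [Nat.add_sub_cancel_left]
  push_cast
  rw [pow_add, mul_div_mul_right _ _ (by positivity)]

lemma eventually_exists_gridPoint {d : ℝ≥0} (hd : d ∈ dyadics) :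
    ∀ᶠ m in atTop, ∃ k, d = gridPoint m k := by
  obtain ⟨m, k, rfl⟩ := hd
  filter_upwards [eventually_ge_atTop m] with n hn using ⟨_, exists_gridPoint_of_le hn k⟩

/-- Dyadic times decreasing to `t`. -/
noncomputable def dyadicAbove (t : ℝ≥0) (m : ℕ) : ℝ≥0 := gridPoint m (⌊t * 2 ^ m⌋₊ + 1)

lemma lt_dyadicAbove (t : ℝ≥0) (m : ℕ) : t < dyadicAbove t m := by
  unfold dyadicAbove gridPoint
  rw [lt_div_iff₀ (by positivity)]
  push_cast
  exact Nat.lt_floor_add_one _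

lemma dyadicAbove_le (t : ℝ≥0) (m : ℕ) : dyadicAbove t m ≤ t + (1 / 2) ^ m := by
  unfold dyadicAbove gridPoint
  rw [div_le_iff₀ (by positivity), add_mul, ← mul_pow]
  push_cast
  rw [one_div_mul_cancel two_ne_zero, one_pow]
  gcongr
  exact Nat.floor_le (by positivity)

lemma tendsto_dyadicAbove (t : ℝ≥0) :
    Tendsto (dyadicAbove t) atTop (𝓝[>] t ⊓ 𝓟 dyadics) := by
  refine tendsto_inf.2 ⟨tendsto_nhdsWithin_iff.2 ⟨?_, Eventually.of_forall (lt_dyadicAbove t)⟩,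
    tendsto_principal.2 (Eventually.of_forall fun m => gridPoint_mem _ _)⟩
  refine tendsto_of_tendsto_of_tendsto_of_le_of_le tendsto_const_nhds ?_
    (fun m => (lt_dyadicAbove t m).le) (dyadicAbove_le t)
  have : Tendsto (fun m : ℕ => t + (1 / 2 : ℝ≥0) ^ m) atTop (𝓝 (t + 0)) :=
    tendsto_const_nhds.add (NNReal.tendsto_pow_atTop_nhds_zero_of_lt_one (by
      rw [one_div]; exact inv_lt_one_of_one_lt₀ one_lt_two))
  simpa using this

instance (t : ℝ≥0) : NeBot (𝓝[>] t ⊓ 𝓟 dyadics) := (tendsto_dyadicAbove t).neBot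

/-! ### Regular paths along the dyadics -/

section Path

variable {Ω : Type*} {M : ℝ≥0 → Ω → ℝ} {ω : Ω}

/-- The process sampled on a dyadic grid. -/
noncomputable def sampled (M : ℝ≥0 → Ω → ℝ) (m k : ℕ) (ω : Ω) : ℝ := M (gridPoint m k) ω

/-- The number of upcrossings of `[a, b]` strictly before `x` on the grid of mesh `2 ^ (-m)`. -/
noncomputable def gridUpcrossings (M : ℝ≥0 → Ω → ℝ) (a b : ℝ) (m : ℕ) (x : ℝ≥0) (ω : Ω) : ℕ :=
  upcrossingsBefore a b (sampled M m) ⌈x * 2 ^ m⌉₊ ω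

lemma gridUpcrossings_mono {a b : ℝ} (hab : a < b) (m : ℕ) {x y : ℝ≥0} (hxy : x ≤ y) :
    gridUpcrossings M a b m x ω ≤ gridUpcrossings M a b m y ω :=
  upcrossingsBefore_mono hab (Nat.ceil_mono (by gcongr)) ω

/-- On all fine enough grids `s` and `t` are grid points, so the descent below `a` at `s` followed
by the value above `b` at `t` adds one upcrossing to those completed before `x`. Counting is strict,
hence `t < y`. -/
lemma eventually_succ_le_gridUpcrossings {a b : ℝ} (hab : a < b) {K : ℕ} {x s t y : ℝ≥0}
    (hs : s ∈ dyadics) (ht : t ∈ dyadics) (hxs : x ≤ s) (hst : s < t) (hty : t < y)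
    (ha : M s ω < a) (hb : b < M t ω)
    (hK : ∀ᶠ m in atTop, K ≤ gridUpcrossings M a b m x ω) :
    ∀ᶠ m in atTop, K + 1 ≤ gridUpcrossings M a b m y ω := by
  filter_upwards [hK, eventually_exists_gridPoint hs, eventually_exists_gridPoint ht]
    with m hm ⟨i, hi⟩ ⟨j, hj⟩
  rw [hi, hj, gridPoint_lt_iff] at hst
  have h1 : ⌈x * 2 ^ m⌉₊ ≤ i := by
    refine Nat.ceil_le.2 ?_
    rw [hi] at hxs
    exact (le_div_iff₀ (by positivity)).1 hxs
  have h2 : j + 1 ≤ ⌈y * 2 ^ m⌉₊ := by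
    refine Nat.succ_le_of_lt (Nat.lt_ceil.2 ?_)
    rw [hj] at hty
    exact (div_lt_iff₀ (by positivity)).1 hty
  have h3 := upcrossingsBefore_lt_of_exists_upcrossing (f := sampled M m) (ω := ω) hab h1
    (by unfold sampled; rwa [← hi]) hst.le (by unfold sampled; rwa [← hj])
  have h4 := upcrossingsBefore_mono (f := sampled M m) hab h2 ω
  exact Nat.succ_le_of_lt (hm.trans_lt (h3.trans_le h4))

/-- The path is bounded on bounded sets of dyadics, and has bounded numbers of upcrossings. -/
def RegularPath (M : ℝ≥0 → Ω → ℝ) (ω : Ω) : Prop :=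
  (∀ N : ℕ, ∃ K : ℝ, ∀ d ∈ dyadics, d ≤ N → |M d ω| ≤ K) ∧
    ∀ (N : ℕ) (a b : ℚ), a < b → ∃ K : ℕ, ∃ᶠ m in atTop, gridUpcrossings M a b m N ω ≤ K

lemma frequently_and_mem {F : Filter ℝ≥0} {A B : ℝ≥0 → Prop} (h1 : ∃ᶠ d in F, A d)
    (h2 : ∀ᶠ d in F, B d) : ∃ d, A d ∧ B d := (h1.and_eventually h2).exists

/-- Oscillation to the right of `t` produces arbitrarily many upcrossings before every `x > t`:
choose `v < x` above `b`, then `u < v` below `a`, and apply induction before `u`. This contradicts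
the bound up to an integer beyond `t`. -/
lemma RegularPath.not_frequently_right (h : RegularPath M ω) (t : ℝ≥0) {a b : ℚ} (hab : a < b) :
    ¬((∃ᶠ d in 𝓝[>] t ⊓ 𝓟 dyadics, M d ω < a) ∧ ∃ᶠ d in 𝓝[>] t ⊓ 𝓟 dyadics, (b : ℝ) < M d ω) := by
  rintro ⟨ha, hb⟩
  have hab' : (a : ℝ) < b := by exact_mod_cast hab
  have hev : ∀ x, t < x → ∀ᶠ d in 𝓝[>] t ⊓ 𝓟 dyadics, d ∈ dyadics ∧ t < d ∧ d < x := by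
    intro x hx
    filter_upwards [mem_inf_of_left (Ioo_mem_nhdsGT hx),
      mem_inf_of_right (mem_principal_self dyadics)] with d h1 h2 using ⟨h2, h1.1, h1.2⟩
  have key : ∀ K : ℕ, ∀ x, t < x → ∀ᶠ m in atTop, K ≤ gridUpcrossings M a b m x ω := by
    intro K
    induction K with
    | zero => intro x _; exact Eventually.of_forall fun _ => Nat.zero_le _
    | succ K ih =>
      intro x hx
      obtain ⟨v, hv, hvD, htv, hvx⟩ := frequently_and_mem hb (hev x hx)
      obtain ⟨u, hu, huD, htu, huv⟩ := frequently_and_mem ha (hev v htv)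
      exact eventually_succ_le_gridUpcrossings hab' huD hvD le_rfl huv hvx hu hv (ih u htu)
  obtain ⟨N, hN⟩ := exists_nat_gt t
  obtain ⟨K, hK⟩ := h.2 N a b hab
  obtain ⟨m, h1, h2⟩ := (hK.and_eventually (key (K + 1) N hN)).exists
  omega

/-- Here upcrossings are accumulated forwards, so the induction carries a moving bound `x < t`
leaving room for the next one. -/
lemma RegularPath.not_frequently_left (h : RegularPath M ω) (t : ℝ≥0) {a b : ℚ} (hab : a < b) :
    ¬((∃ᶠ d in 𝓝[<] t ⊓ 𝓟 dyadics, M d ω < a) ∧ ∃ᶠ d in 𝓝[<] t ⊓ 𝓟 dyadics, (b : ℝ) < M d ω) := by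
  rintro ⟨ha, hb⟩
  have hab' : (a : ℝ) < b := by exact_mod_cast hab
  have hev : ∀ x, x < t → ∀ᶠ d in 𝓝[<] t ⊓ 𝓟 dyadics, d ∈ dyadics ∧ x < d ∧ d < t := by
    intro x hx
    filter_upwards [mem_inf_of_left (Ioo_mem_nhdsLT hx),
      mem_inf_of_right (mem_principal_self dyadics)] with d h1 h2 using ⟨h2, h1.1, h1.2⟩
  have ht : 0 < t := by
    rcases eq_zero_or_pos t with rfl | ht
    · have : 𝓝[<] (0 : ℝ≥0) = ⊥ := by
        rw [show Set.Iio (0 : ℝ≥0) = ∅ by ext x; simp]; simp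
      rw [this, bot_inf_eq] at ha
      exact absurd ha (by simp)
    · exact ht
  have key : ∀ K : ℕ, ∃ x, x < t ∧ ∀ᶠ m in atTop, K ≤ gridUpcrossings M a b m x ω := by
    intro K
    induction K with
    | zero => exact ⟨0, ht, Eventually.of_forall fun _ => Nat.zero_le _⟩
    | succ K ih =>
      obtain ⟨x, hx, hK⟩ := ih
      obtain ⟨u, hu, huD, hxu, hut⟩ := frequently_and_mem ha (hev x hx)
      obtain ⟨v, hv, hvD, huv, hvt⟩ := frequently_and_mem hb (hev u hut)
      obtain ⟨y, hvy, hyt⟩ := exists_between hvt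
      exact ⟨y, hyt, eventually_succ_le_gridUpcrossings hab' huD hvD hxu.le huv hvy hu hv hK⟩
  obtain ⟨N, hN⟩ := exists_nat_gt t
  obtain ⟨K, hK⟩ := h.2 N a b hab
  obtain ⟨x, hx, hx2⟩ := key (K + 1)
  obtain ⟨m, h1, h2⟩ := (hK.and_eventually hx2).exists
  have := gridUpcrossings_mono (M := M) (ω := ω) hab' m (hx.le.trans hN.le)
  omega

lemma RegularPath.exists_tendsto (h : RegularPath M ω) {F : Filter ℝ≥0} {N : ℕ}
    (hF : ∀ᶠ d in F, d ∈ dyadics ∧ d ≤ N)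
    (hcross : ∀ a b : ℚ, a < b → ¬((∃ᶠ d in F, M d ω < a) ∧ ∃ᶠ d in F, (b : ℝ) < M d ω)) :
    ∃ l, Tendsto (fun d => M d ω) F (𝓝 l) := by
  obtain ⟨K, hK⟩ := h.1 N
  refine tendsto_of_no_upcrossings (s := Set.range ((↑) : ℚ → ℝ)) Rat.denseRange_cast ?_ ?_ ?_
  · rintro _ ⟨a, rfl⟩ _ ⟨b, rfl⟩ hab
    exact hcross a b (by exact_mod_cast hab)
  · exact ⟨K, by
      rw [eventually_map]
      filter_upwards [hF] with d hd using (abs_le.1 (hK d hd.1 hd.2)).2⟩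
  · exact ⟨-K, by
      rw [eventually_map]
      filter_upwards [hF] with d hd using (abs_le.1 (hK d hd.1 hd.2)).1⟩

lemma RegularPath.exists_right_limit (h : RegularPath M ω) (t : ℝ≥0) :
    ∃ l, Tendsto (fun d => M d ω) (𝓝[>] t ⊓ 𝓟 dyadics) (𝓝 l) := by
  obtain ⟨N, hN⟩ := exists_nat_gt t
  refine h.exists_tendsto (N := N) ?_ fun a b hab => h.not_frequently_right t hab
  filter_upwards [mem_inf_of_left (Ioo_mem_nhdsGT hN),
    mem_inf_of_right (mem_principal_self dyadics)] with d h1 h2 using ⟨h2, h1.2.le⟩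

lemma RegularPath.exists_left_limit (h : RegularPath M ω) (t : ℝ≥0) :
    ∃ l, Tendsto (fun d => M d ω) (𝓝[<] t ⊓ 𝓟 dyadics) (𝓝 l) := by
  obtain ⟨N, hN⟩ := exists_nat_gt t
  refine h.exists_tendsto (N := N) ?_ fun a b hab => h.not_frequently_left t hab
  filter_upwards [mem_inf_of_left self_mem_nhdsWithin,
    mem_inf_of_right (mem_principal_self dyadics)] with d h1 h2 using ⟨h2, (h1.trans hN).le⟩

/-- The right limit along the dyadics. -/
noncomputable def rightLimit (M : ℝ≥0 → Ω → ℝ) (t : ℝ≥0) (ω : Ω) : ℝ :=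
  limUnder (𝓝[>] t ⊓ 𝓟 dyadics) fun d => M d ω

lemma RegularPath.tendsto_rightLimit (h : RegularPath M ω) (t : ℝ≥0) :
    Tendsto (fun d => M d ω) (𝓝[>] t ⊓ 𝓟 dyadics) (𝓝 (rightLimit M t ω)) :=
  tendsto_nhds_limUnder (h.exists_right_limit t)

/-- A closed neighbourhood containing the dyadic values on an interval also contains their right
limits there, so the limits along the dyadics pass to `rightLimit` itself. -/
lemma RegularPath.isRcll (h : RegularPath M ω) : IsRcll (fun t => rightLimit M t ω) := by
  have hmem : ∀ {W : Set ℝ} {s y : ℝ≥0}, IsClosed W → s < y →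
      (∀ d ∈ dyadics, s < d → d < y → M d ω ∈ W) → rightLimit M s ω ∈ W := by
    intro W s y hW hsy hd
    refine hW.mem_of_tendsto (h.tendsto_rightLimit s) ?_
    filter_upwards [mem_inf_of_left (Ioo_mem_nhdsGT hsy),
      mem_inf_of_right (mem_principal_self dyadics)] with d h1 h2 using hd d h2 h1.1 h1.2
  intro t
  constructor
  · refine ((closed_nhds_basis (rightLimit M t ω)).tendsto_right_iff).2 fun W hW => ?_
    have h1 := h.tendsto_rightLimit t hW.1
    rw [mem_map, mem_inf_principal] at h1
    obtain ⟨y, hy, hy2⟩ := (mem_nhdsGT_iff_exists_Ioo_subset' (lt_add_one t)).1 h1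
    filter_upwards [Ico_mem_nhdsGE hy] with s hs
    exact hmem hW.2 hs.2 fun d hd h2 h3 => hy2 ⟨hs.1.trans_lt h2, h3⟩ hd
  · obtain ⟨l, hl⟩ := h.exists_left_limit t
    refine ⟨l, ((closed_nhds_basis l).tendsto_right_iff).2 fun W hW => ?_⟩
    have h1 := hl hW.1
    rw [mem_map, mem_inf_principal] at h1
    rcases eq_zero_or_pos t with rfl | ht
    · have : 𝓝[<] (0 : ℝ≥0) = ⊥ := by
        rw [show Set.Iio (0 : ℝ≥0) = ∅ by ext x; simp]; simp
      rw [this]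
      exact eventually_bot
    · obtain ⟨y, hy, hy2⟩ := (mem_nhdsLT_iff_exists_Ioo_subset' ht).1 h1
      filter_upwards [Ioo_mem_nhdsLT hy] with s hs
      exact hmem hW.2 hs.2 fun d hd h2 h3 => hy2 ⟨hs.1.trans h2, h3⟩ hd

end Path

end ReinforcedLevy

namespace ReinforcedLevy

/-! ### Regularization of martingales -/

section Regularization

variable {Ω : Type*} {mΩ : MeasurableSpace Ω} {P : Measure Ω} {M : ℝ≥0 → Ω → ℝ}
  {𝓕 : Filtration ℝ≥0 mΩ}

/-- The restriction of a filtration to a dyadic grid. -/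
noncomputable def gridFiltration (𝓕 : Filtration ℝ≥0 mΩ) (m : ℕ) : Filtration ℕ mΩ where
  seq k := 𝓕 (gridPoint m k)
  mono' _ _ h := 𝓕.mono (gridPoint_mono m h)
  le' k := 𝓕.le (gridPoint m k)

lemma martingale_sampled (hM : Martingale M 𝓕 P) (m : ℕ) :
    Martingale (sampled M m) (gridFiltration 𝓕 m) P :=
  ⟨fun k => hM.1 (gridPoint m k), fun _ _ h => hM.2 _ _ (gridPoint_mono m h)⟩

lemma ceil_natCast_mul_two_pow (N m : ℕ) : ⌈((N : ℕ) : ℝ≥0) * 2 ^ m⌉₊ = N * 2 ^ m := by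
  have : ((N : ℕ) : ℝ≥0) * 2 ^ m = ((N * 2 ^ m : ℕ) : ℝ≥0) := by push_cast; rfl
  rw [this, Nat.ceil_natCast]

/-- Doob's bound on the mean number of upcrossings involves only `M N`, as `N` belongs to every
grid, so it is uniform in `m`. Fatou's lemma makes the lower limit almost surely finite, which is
all that regular paths require. -/
lemma ae_frequently_gridUpcrossings_le [IsProbabilityMeasure P] (hM : Martingale M 𝓕 P) (N : ℕ)
    {a b : ℝ} (hab : a < b) :
    ∀ᵐ ω ∂P, ∃ K : ℕ, ∃ᶠ m in atTop, gridUpcrossings M a b m N ω ≤ K := by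
  have hmeas : ∀ m, Measurable (gridUpcrossings M a b m N) := fun m =>
    (martingale_sampled hM m).stronglyAdapted.measurable_upcrossingsBefore hab
  have hmeas' : ∀ m, Measurable (fun ω => (gridUpcrossings M a b m N ω : ℝ≥0∞)) := fun m =>
    measurable_from_top.comp (hmeas m)
  set B : ℝ := (∫ ω, (M N ω - a)⁺ ∂P) / (b - a) with hB
  have hle : ∀ m, ∫⁻ ω, (gridUpcrossings M a b m N ω : ℝ≥0∞) ∂P ≤ ENNReal.ofReal B := by
    intro m
    have h0 := (martingale_sampled hM m).submartingale
    have h1 := h0.mul_integral_upcrossingsBefore_le_integral_pos_part a b (N * 2 ^ m)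
    have h2 : ∫ ω, (gridUpcrossings M a b m N ω : ℝ) ∂P ≤ B := by
      rw [hB, le_div_iff₀' (by linarith)]
      simpa [gridUpcrossings, ceil_natCast_mul_two_pow, sampled, gridPoint_mul_two_pow] using h1
    have h3 : Integrable (fun ω => (gridUpcrossings M a b m N ω : ℝ)) P :=
      (martingale_sampled hM m).stronglyAdapted.integrable_upcrossingsBefore hab
    have h4 := ofReal_integral_eq_lintegral_ofReal h3 (ae_of_all _ fun ω => Nat.cast_nonneg _)
    simp only [ENNReal.ofReal_natCast] at h4
    rw [← h4]
    exact ENNReal.ofReal_le_ofReal h2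
  have hfatou : ∫⁻ ω, liminf (fun m => (gridUpcrossings M a b m N ω : ℝ≥0∞)) atTop ∂P < ∞ := by
    refine (lintegral_liminf_le hmeas').trans_lt
      (lt_of_le_of_lt ?_ (ENNReal.ofReal_lt_top (r := B)))
    exact liminf_le_of_le (by isBoundedDefault) fun c hc => by
      obtain ⟨m, hm⟩ := hc.exists
      exact hm.trans (hle m)
  filter_upwards [ae_lt_top (.liminf hmeas') hfatou.ne] with ω hω
  obtain ⟨K, hK⟩ := ENNReal.exists_nat_gt hω.ne
  refine ⟨K, (frequently_lt_of_liminf_lt (by isBoundedDefault) hK).mono fun m hm => ?_⟩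
  exact_mod_cast hm.le

lemma mul_measure_exists_grid_ge_le [IsProbabilityMeasure P] (hM : Martingale M 𝓕 P)
    (N m : ℕ) (ε : ℝ≥0) :
    ε * P {ω | ∃ k ≤ N * 2 ^ m, (ε : ℝ) ≤ |sampled M m k ω|} ≤
      ENNReal.ofReal (∫ ω, |M N ω| ∂P) := by
  have hs : Submartingale (fun k ω => |sampled M m k ω|) (gridFiltration 𝓕 m) P := by
    have h1 := (martingale_sampled hM m).submartingale
    have h2 := (martingale_sampled hM m).neg.submartingale
    exact h1.sup h2
  have h := maximal_ineq hs (fun _ _ => abs_nonneg _) (ε := ε) (N * 2 ^ m)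
  have hset : {ω | (ε : ℝ) ≤ (Finset.range (N * 2 ^ m + 1)).sup' Finset.nonempty_range_add_one
      fun k => |sampled M m k ω|} = {ω | ∃ k ≤ N * 2 ^ m, (ε : ℝ) ≤ |sampled M m k ω|} := by
    ext ω
    simp [Finset.le_sup'_iff]
  rw [hset] at h
  refine h.trans (ENNReal.ofReal_le_ofReal ?_)
  have h3 : (fun ω => |sampled M m (N * 2 ^ m) ω|) = fun ω => |M N ω| := by
    funext ω; simp [sampled, gridPoint_mul_two_pow]
  simp only [h3]
  exact setIntegral_le_integral (hM.integrable N).abs (ae_of_all _ fun ω => abs_nonneg _)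

/-- The maximal inequality bounds `n` times the probability of reaching level `n` on a grid by the
mean of `|M N|`, uniformly in the mesh. Grids are nested, so the bound passes to all dyadics; then
`n` is arbitrary. -/
lemma ae_exists_bound_dyadics [IsProbabilityMeasure P] (hM : Martingale M 𝓕 P) (N : ℕ) :
    ∀ᵐ ω ∂P, ∃ K : ℝ, ∀ d ∈ dyadics, d ≤ N → |M d ω| ≤ K := by
  set A : ℕ → ℕ → Set Ω := fun n m => {ω | ∃ k ≤ N * 2 ^ m, ((n : ℝ≥0) : ℝ) ≤ |sampled M m k ω|}
    with hA
  have hmono : ∀ n, Monotone (A n) := by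
    rintro n i j hij ω ⟨k, hk, hk2⟩
    refine ⟨k * 2 ^ (j - i), ?_, ?_⟩
    · rw [← gridPoint_le_iff (m := j), ← exists_gridPoint_of_le hij, gridPoint_mul_two_pow,
        ← gridPoint_mul_two_pow i N]
      exact gridPoint_mono i hk
    · unfold sampled at hk2 ⊢
      rwa [← exists_gridPoint_of_le hij]
  have hle : ∀ n : ℕ, n * P (⋃ m, A n m) ≤ ENNReal.ofReal (∫ ω, |M N ω| ∂P) := by
    intro n
    rw [(hmono n).measure_iUnion, ENNReal.mul_iSup]
    exact iSup_le fun m => by exact_mod_cast mul_measure_exists_grid_ge_le hM N m n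
  have hzero : P (⋂ n, ⋃ m, A n m) = 0 := by
    by_contra h0
    have h1 : ∀ n : ℕ, (n : ℝ≥0∞) * P (⋂ n, ⋃ m, A n m) ≤ ENNReal.ofReal (∫ ω, |M N ω| ∂P) :=
      fun n => (mul_le_mul_right (measure_mono (Set.iInter_subset _ n)) _).trans (hle n)
    obtain ⟨n, hn⟩ := ENNReal.exists_nat_mul_gt h0 (b := ENNReal.ofReal (∫ ω, |M N ω| ∂P))
      ENNReal.ofReal_ne_top
    exact absurd (h1 n) (not_le.2 hn)
  have hae : ∀ᵐ ω ∂P, ω ∉ ⋂ n, ⋃ m, A n m := measure_eq_zero_iff_ae_notMem.1 hzero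
  filter_upwards [hae] with ω hω
  simp only [Set.mem_iInter, Set.mem_iUnion, not_forall, not_exists] at hω
  obtain ⟨n, hn⟩ := hω
  refine ⟨n, ?_⟩
  rintro _ ⟨m, k, rfl⟩ hd
  by_contra hlt
  refine hn m ⟨k, ?_, by simpa [sampled] using (not_le.1 hlt).le⟩
  rwa [← gridPoint_mul_two_pow m N, gridPoint_le_iff] at hd

lemma ae_regularPath [IsProbabilityMeasure P] (hM : Martingale M 𝓕 P) :
    ∀ᵐ ω ∂P, RegularPath M ω := by
  have h1 : ∀ᵐ ω ∂P, ∀ (N : ℕ) (a b : ℚ), a < b →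
      ∃ K : ℕ, ∃ᶠ m in atTop, gridUpcrossings M a b m N ω ≤ K := by
    rw [ae_all_iff]; intro N
    rw [ae_all_iff]; intro a
    rw [ae_all_iff]; intro b
    by_cases hab : a < b
    · filter_upwards [ae_frequently_gridUpcrossings_le hM N (a := a) (b := b)
        (by exact_mod_cast hab)] with ω hω _ using hω
    · exact ae_of_all _ fun ω h => absurd h hab
  filter_upwards [ae_all_iff.2 fun N => ae_exists_bound_dyadics hM N, h1] with ω h2 h3
    using ⟨h2, h3⟩

lemma ae_eq_zero_of_charFun_eq_one [IsProbabilityMeasure P] {D : Ω → ℝ} (hD : Measurable D)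
    (h : ∀ l : ℝ, ∫ ω, Complex.exp (Complex.I * ((l * D ω : ℝ) : ℂ)) ∂P = 1) : D =ᵐ[P] 0 := by
  have h1 : P.map D = Measure.dirac 0 := by
    have : IsProbabilityMeasure (P.map D) := Measure.isProbabilityMeasure_map hD.aemeasurable
    refine Measure.ext_of_charFun (funext fun l => ?_)
    rw [charFun_apply_real, integral_map hD.aemeasurable (by fun_prop)]
    simp only [charFun_dirac, inner_zero_left, Complex.ofReal_zero, zero_mul, Complex.exp_zero]
    rw [← h l]
    congr 1
    funext ω
    congr 1
    push_cast
    ring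
  have h2 : ∀ᵐ x ∂(P.map D), x = 0 := by
    rw [h1, ae_dirac_eq]
    rfl
  exact ae_of_ae_map hD.aemeasurable h2

/-- A martingale on `ℝ₊` that is right-continuous in law, in the sense that the increments
`M s - M t` vanish in law as `s ↓ t`, has an rcll modification. -/
theorem hasRcllModification_of_martingale [IsProbabilityMeasure P] (hM : Martingale M 𝓕 P)
    (hRC : ∀ (t : ℝ≥0) (l : ℝ), Tendsto
      (fun s => ∫ ω, Complex.exp (Complex.I * ((l * (M s ω - M t ω) : ℝ) : ℂ)) ∂P)
      (𝓝[>] t) (𝓝 1)) : HasRcllModification M P := by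
  classical
  have hMm : ∀ t, Measurable (M t) := fun t => ((hM.1 t).mono (𝓕.le t)).measurable
  have hreg := ae_regularPath hM
  rw [ae_iff] at hreg
  -- A measurable hull of the exceptional set is removed, so that the modification, set to `0` off
  -- `G`, is measurable at each time without completing the σ-algebra.
  set G : Set Ω := (toMeasurable P {ω | ¬RegularPath M ω})ᶜ with hG
  have hGm : MeasurableSet G := (measurableSet_toMeasurable _ _).compl
  have hGreg : ∀ ω ∈ G, RegularPath M ω := fun ω hω => by
    by_contra h
    exact hω (subset_toMeasurable P _ h)
  have hGae : ∀ᵐ ω ∂P, ω ∈ G := by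
    rw [ae_iff]
    simp only [hG, Set.mem_compl_iff, not_not]
    exact (measure_toMeasurable _).trans hreg
  set N : ℝ≥0 → Ω → ℝ := fun t => G.indicator (rightLimit M t) with hN
  have hNm : ∀ t, Measurable (N t) := fun t => by
    refine measurable_of_tendsto_metrizable (f := fun n => G.indicator (M (dyadicAbove t n)))
      (fun n => (hMm _).indicator hGm) (tendsto_pi_nhds.2 fun ω => ?_)
    by_cases hω : ω ∈ G
    · simp only [hN, Set.indicator_of_mem hω]
      exact ((hGreg ω hω).tendsto_rightLimit t).comp (tendsto_dyadicAbove t)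
    · simp only [hN, Set.indicator_of_notMem hω]
      exact tendsto_const_nhds
  refine ⟨N, hNm, fun t => ?_, fun ω => ?_⟩
  · have hD : Measurable (fun ω => N t ω - M t ω) := (hNm t).sub (hMm t)
    have h1 : (fun ω => N t ω - M t ω) =ᵐ[P] 0 := by
      -- Along dyadics decreasing to `t`, dominated convergence sends the characteristic functions
      -- of the increments of `M` to that of `N t - M t`, while `hRC` sends them to `1`.
      refine ae_eq_zero_of_charFun_eq_one hD fun l => ?_
      have h2 : Tendsto (dyadicAbove t) atTop (𝓝[>] t) :=
        (tendsto_dyadicAbove t).mono_right inf_le_left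
      refine tendsto_nhds_unique ?_ ((hRC t l).comp h2)
      refine tendsto_integral_of_dominated_convergence (fun _ => (1 : ℝ)) (fun n => ?_)
        (integrable_const 1) (fun n => ae_of_all _ fun ω => ?_) ?_
      · have h3 := ((hMm (dyadicAbove t n)).sub (hMm t)).const_mul l
        exact Measurable.aestronglyMeasurable
          (((Complex.measurable_ofReal.comp h3).const_mul Complex.I).cexp)
      · rw [mul_comm, Complex.norm_exp_ofReal_mul_I]
      · filter_upwards [hGae] with ω hω
        have h4 := ((hGreg ω hω).tendsto_rightLimit t).comp (tendsto_dyadicAbove t)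
        simp only [hN, Set.indicator_of_mem hω]
        have hc : Continuous fun x : ℝ => Complex.exp (Complex.I * ((l * (x - M t ω) : ℝ) : ℂ)) := by
          fun_prop
        exact (hc.tendsto _).comp h4
    filter_upwards [h1] with ω hω
    exact sub_eq_zero.1 hω
  · by_cases hω : ω ∈ G
    · simp only [hN, Set.indicator_of_mem hω]
      exact (hGreg ω hω).isRcll
    · simp only [hN, Set.indicator_of_notMem hω]
      exact fun t => ⟨continuousWithinAt_const, 0, tendsto_const_nhds⟩

end Regularization

end ReinforcedLevy

namespace ReinforcedLevy

/-! ### Right continuity in law of the rescaled process -/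

variable {Ω : Type*} [MeasurableSpace Ω] {P : Measure Ω} {Ψ : ℝ → ℂ} {r C p : ℝ}
  {ξ : ℝ≥0 → Ω → ℝ}

lemma IsTameExponent.map_zero (hΨ : IsTameExponent Ψ r C) : Ψ 0 = 0 := by
  have h := hΨ.norm_le 0
  rw [abs_zero, Real.zero_rpow (by linarith [hΨ.one_lt]), add_zero, mul_zero] at h
  exact norm_le_zero_iff.1 h

lemma HasReinforcedLaw.integral_exp_scaled (h : HasReinforcedLaw Ψ p ξ P) {s : ℝ≥0}
    (hs : 0 < s) (l : ℝ) :
    ∫ ω, Complex.exp (Complex.I * ((l * scaledProcess p ξ s ω : ℝ) : ℂ)) ∂P =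
      Complex.exp ((1 - (p : ℂ)) * ((s : ℝ) : ℂ) *
        ∫ w, Ψ (l * (s : ℝ) ^ (-p) * yuleSimon p 1 w) ∂yuleSimonMeasure) := by
  have hs0 : (s : ℝ) ≠ 0 := by exact_mod_cast hs.ne'
  have h1 := h.charFun_eq {s} (fun _ => l * (s : ℝ) ^ (-p)) s (by simpa using hs)
  simp only [yuleSimonSum, Finset.sum_singleton, div_self hs0] at h1
  rw [← h1, scaledProcess_of_pos p ξ hs]
  simp only [mul_assoc]

/-- The exponent at time `s` is bounded by multiples of `s ^ (1 - p)` and `s ^ (1 - p * r)`, both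
with positive powers. -/
lemma HasReinforcedLaw.tendsto_charFun_zero (h : HasReinforcedLaw Ψ p ξ P)
    (hΨ : IsTameExponent Ψ r C) (hp : 0 ≤ p) (hp1 : p < 1) (hpr : p * r < 1) (l : ℝ) :
    Tendsto (fun s => ∫ ω, Complex.exp (Complex.I * ((l * scaledProcess p ξ s ω : ℝ) : ℂ)) ∂P)
      (𝓝[>] 0) (𝓝 1) := by
  have hr := hΨ.one_lt
  have hYi := hΨ.integrable_yuleSimon hp hpr
  have hYr := hΨ.integrable_rpow hp hpr
  set m₁ : ℝ := ∫ w, (yuleSimon p 1 w : ℝ) ∂yuleSimonMeasure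
  set m₂ : ℝ := ∫ w, (yuleSimon p 1 w : ℝ) ^ r ∂yuleSimonMeasure
  have hcoe : Tendsto (fun s : ℝ≥0 => (s : ℝ)) (𝓝[>] 0) (𝓝 0) :=
    (NNReal.continuous_coe.tendsto' 0 0 rfl).mono_left nhdsWithin_le_nhds
  have hpow : ∀ q : ℝ, 0 < q → Tendsto (fun s : ℝ≥0 => (s : ℝ) ^ q) (𝓝[>] 0) (𝓝 0) := fun q hq => by
    simpa [Real.zero_rpow hq.ne'] using hcoe.rpow_const (p := q) (Or.inr hq.le)
  have hlim : Tendsto (fun s : ℝ≥0 => (1 - (p : ℂ)) * ((s : ℝ) : ℂ) *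
      ∫ w, Ψ (l * (s : ℝ) ^ (-p) * yuleSimon p 1 w) ∂yuleSimonMeasure) (𝓝[>] 0) (𝓝 0) := by
    refine squeeze_zero_norm' (a := fun s : ℝ≥0 => ‖1 - (p : ℂ)‖ * (C * |l| * m₁ * (s : ℝ) ^ (1 - p) +
      C * |l| ^ r * m₂ * (s : ℝ) ^ (1 - p * r))) ?_ ?_
    · filter_upwards [self_mem_nhdsWithin] with s hs
      have hs0 : (0 : ℝ) < s := hs
      have e1 : (s : ℝ) * (s : ℝ) ^ (-p) = (s : ℝ) ^ (1 - p) := by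
        rw [sub_eq_add_neg, Real.rpow_add hs0, Real.rpow_one]
      have e2 : (s : ℝ) * ((s : ℝ) ^ (-p)) ^ r = (s : ℝ) ^ (1 - p * r) := by
        rw [← Real.rpow_mul hs0.le, sub_eq_add_neg, Real.rpow_add hs0, Real.rpow_one, neg_mul]
      set S : ℝ := |l| * (s : ℝ) ^ (-p) with hS
      have hS0 : 0 ≤ S := by positivity
      have hb : ‖∫ w, Ψ (l * (s : ℝ) ^ (-p) * yuleSimon p 1 w) ∂yuleSimonMeasure‖ ≤
          C * S * m₁ + C * S ^ r * m₂ := by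
        have h1 : Integrable (fun w => C * S * (yuleSimon p 1 w : ℝ)) yuleSimonMeasure :=
          hYi.const_mul _
        have h2 : Integrable (fun w => C * S ^ r * (yuleSimon p 1 w : ℝ) ^ r) yuleSimonMeasure :=
          hYr.const_mul _
        refine (norm_integral_le_of_norm_le (h1.add h2) (ae_of_all _ fun w =>
          hΨ.norm_le_of_abs_le hS0 (Nat.cast_nonneg (yuleSimon p 1 w)) ?_)).trans_eq ?_
        · rw [abs_mul, abs_mul, Nat.abs_cast, abs_of_pos (Real.rpow_pos_of_pos hs0 (-p))]
        · refine (integral_add h1 h2).trans ?_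
          rw [integral_const_mul, integral_const_mul]
      rw [norm_mul, norm_mul, Complex.norm_real, Real.norm_of_nonneg hs0.le, mul_assoc]
      refine mul_le_mul_of_nonneg_left ?_ (norm_nonneg _)
      refine (mul_le_mul_of_nonneg_left hb hs0.le).trans_eq ?_
      rw [← e1, ← e2, hS, Real.mul_rpow (abs_nonneg _) (by positivity)]
      ring
    · have := (((hpow (1 - p) (by linarith)).const_mul (C * |l| * m₁)).add
        ((hpow (1 - p * r) (by linarith)).const_mul (C * |l| ^ r * m₂))).const_mul ‖1 - (p : ℂ)‖
      simpa using this
  have h2 := hlim.cexp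
  rw [Complex.exp_zero] at h2
  refine h2.congr' ?_
  filter_upwards [self_mem_nhdsWithin] with s hs
  exact (h.integral_exp_scaled hs l).symm

/-- The horizon `u` stays free, so that it can be held fixed as `s ↓ t` and only the arguments of
`Y` move. -/
lemma HasReinforcedLaw.integral_exp_increment (h : HasReinforcedLaw Ψ p ξ P) {s t u : ℝ≥0}
    (ht : 0 < t) (hts : t < s) (hsu : s ≤ u) (l : ℝ) :
    ∫ ω, Complex.exp
      (Complex.I * ((l * (scaledProcess p ξ s ω - scaledProcess p ξ t ω) : ℝ) : ℂ)) ∂P =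
      Complex.exp ((1 - (p : ℂ)) * ((u : ℝ) : ℂ) *
        ∫ w, Ψ (l * ((s : ℝ) ^ (-p) * yuleSimon p ((s : ℝ) / u) w -
          (t : ℝ) ^ (-p) * yuleSimon p ((t : ℝ) / u) w)) ∂yuleSimonMeasure) := by
  have hs := ht.trans hts
  have h1 := h.charFun_eq {s, t} (fun v => if v = s then l * (s : ℝ) ^ (-p) else -(l * (t : ℝ) ^ (-p)))
    u (by
      intro v hv
      rcases Finset.mem_insert.1 hv with rfl | hv
      · exact ⟨hs, hsu⟩
      · rw [Finset.mem_singleton.1 hv]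
        exact ⟨ht, hts.le.trans hsu⟩)
  simp only [yuleSimonSum, Finset.sum_pair hts.ne', if_true, if_neg hts.ne] at h1
  convert! h1 using 1
  · refine integral_congr_ae (ae_of_all _ fun ω => ?_)
    rw [scaledProcess_of_pos p ξ hs, scaledProcess_of_pos p ξ ht]
    simp only
    congr 3
    ring
  · congr 2
    refine integral_congr_ae (ae_of_all _ fun w => ?_)
    simp only
    congr 1
    ring

/-- Paths of `Y` are locally constant to the right, so the argument of `Ψ` tends to `0` almost
surely; it is dominated by a multiple of `Y 1`, and `Ψ` is continuous with `Ψ 0 = 0`. -/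
lemma HasReinforcedLaw.tendsto_charFun_increment (h : HasReinforcedLaw Ψ p ξ P)
    (hΨ : IsTameExponent Ψ r C) (hp : 0 ≤ p) (hpr : p * r < 1) {t : ℝ≥0} (ht : 0 < t) (l : ℝ) :
    Tendsto (fun s => ∫ ω, Complex.exp
      (Complex.I * ((l * (scaledProcess p ξ s ω - scaledProcess p ξ t ω) : ℝ) : ℂ)) ∂P)
      (𝓝[>] t) (𝓝 1) := by
  have ht0 : (0 : ℝ) < t := ht
  set u : ℝ≥0 := t + 1 with hu
  have hu0 : (0 : ℝ) < u := by rw [hu]; positivity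
  have hnear : ∀ᶠ s in 𝓝[>] t, t < s ∧ s ≤ u := by
    filter_upwards [Ioc_mem_nhdsGT (lt_add_one t)] with s hs using hs
  set A : ℝ≥0 → ℝ × (ℕ → ℝ) → ℝ := fun s w => l * ((s : ℝ) ^ (-p) * yuleSimon p ((s : ℝ) / u) w -
    (t : ℝ) ^ (-p) * yuleSimon p ((t : ℝ) / u) w) with hA
  have hAm : ∀ s, Measurable (A s) := fun s =>
    (((measurable_yuleSimon_cast p _).const_mul _).sub
      ((measurable_yuleSimon_cast p _).const_mul _)).const_mul l
  set S : ℝ := |l| * (2 * (t : ℝ) ^ (-p)) with hS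
  have hS0 : 0 ≤ S := by positivity
  have hAS : ∀ᶠ s in 𝓝[>] t, ∀ w, GoodPoint w → |A s w| ≤ S * yuleSimon p 1 w := by
    filter_upwards [hnear] with s hs w hw
    have h1 := hw.yuleSimon_div_le hp hs.2
    have h2 := hw.yuleSimon_div_le hp (hs.1.le.trans hs.2)
    have h3 : (s : ℝ) ^ (-p) ≤ (t : ℝ) ^ (-p) :=
      Real.rpow_le_rpow_of_nonpos ht0 (by exact_mod_cast hs.1.le) (by linarith)
    have hs0 : (0 : ℝ) ≤ (s : ℝ) ^ (-p) := by positivity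
    have ht1 : (0 : ℝ) ≤ (t : ℝ) ^ (-p) := by positivity
    rw [hA, hS, abs_mul, mul_assoc]
    refine mul_le_mul_of_nonneg_left ?_ (abs_nonneg _)
    refine (abs_sub _ _).trans ?_
    rw [abs_of_nonneg (by positivity), abs_of_nonneg (by positivity)]
    calc _ ≤ (t : ℝ) ^ (-p) * yuleSimon p 1 w + (t : ℝ) ^ (-p) * yuleSimon p 1 w := by gcongr
      _ = _ := by ring
  have hA0 : ∀ w, GoodPoint w → Tendsto (fun s => A s w) (𝓝[>] t) (𝓝 0) := by
    intro w hw
    have hdiv : Tendsto (fun s : ℝ≥0 => (s : ℝ) / u) (𝓝[>] t) (𝓝[≥] ((t : ℝ) / u)) := by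
      refine tendsto_nhdsWithin_iff.2 ⟨?_, ?_⟩
      · have hc : Continuous fun s : ℝ≥0 => (s : ℝ) / u := by fun_prop
        exact (hc.tendsto t).mono_left nhdsWithin_le_nhds
      · filter_upwards [self_mem_nhdsWithin] with s hs
        have : (t : ℝ) ≤ s := by exact_mod_cast (Set.mem_Ioi.1 hs).le
        exact Set.mem_Ici.2 (by gcongr)
    have hev := hdiv.eventually (hw.yuleSimon_eventuallyEq hp (div_pos ht0 hu0))
    have hpow : Tendsto (fun s : ℝ≥0 => (s : ℝ) ^ (-p)) (𝓝[>] t) (𝓝 ((t : ℝ) ^ (-p))) :=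
      ((NNReal.continuous_coe.tendsto t).mono_left nhdsWithin_le_nhds).rpow_const
        (Or.inl ht0.ne')
    have h1 := ((hpow.mul_const (yuleSimon p ((t : ℝ) / u) w : ℝ)).sub_const
      ((t : ℝ) ^ (-p) * yuleSimon p ((t : ℝ) / u) w)).const_mul l
    rw [sub_self, mul_zero] at h1
    refine h1.congr' ?_
    filter_upwards [hev] with s hs
    simp only [hA, hs]
  have hlim : Tendsto (fun s => ∫ w, Ψ (A s w) ∂yuleSimonMeasure) (𝓝[>] t)
      (𝓝 (∫ _, 0 ∂yuleSimonMeasure)) := by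
    refine tendsto_integral_filter_of_dominated_convergence
      (fun w => C * S * (yuleSimon p 1 w : ℝ) + C * S ^ r * (yuleSimon p 1 w : ℝ) ^ r)
      (Eventually.of_forall fun s =>
        (hΨ.differentiable.continuous.measurable.comp (hAm s)).aestronglyMeasurable) ?_
      (((hΨ.integrable_yuleSimon hp hpr).const_mul _).add ((hΨ.integrable_rpow hp hpr).const_mul _))
      ?_
    · filter_upwards [hAS] with s hs
      filter_upwards [ae_goodPoint] with w hw
      exact hΨ.norm_le_of_abs_le hS0 (Nat.cast_nonneg _) (hs w hw)
    · filter_upwards [ae_goodPoint] with w hw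
      have h1 := (hΨ.differentiable.continuous.tendsto 0).comp (hA0 w hw)
      rw [hΨ.map_zero] at h1
      exact h1
  rw [integral_zero] at hlim
  have h2 := (hlim.const_mul ((1 - (p : ℂ)) * ((u : ℝ) : ℂ))).cexp
  rw [mul_zero, Complex.exp_zero] at h2
  refine h2.congr' ?_
  filter_upwards [hnear] with s hs
  exact (h.integral_exp_increment ht hs.1 hs.2 l).symm

lemma HasReinforcedLaw.tendsto_charFun_scaledProcess_sub (h : HasReinforcedLaw Ψ p ξ P)
    (hΨ : IsTameExponent Ψ r C) (hp : 0 ≤ p) (hp1 : p < 1) (hpr : p * r < 1) (t : ℝ≥0) (l : ℝ) :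
    Tendsto (fun s => ∫ ω, Complex.exp
      (Complex.I * ((l * (scaledProcess p ξ s ω - scaledProcess p ξ t ω) : ℝ) : ℂ)) ∂P)
      (𝓝[>] t) (𝓝 1) := by
  rcases eq_zero_or_pos t with rfl | ht
  · simp only [scaledProcess_zero, sub_zero]
    exact h.tendsto_charFun_zero hΨ hp hp1 hpr l
  · exact h.tendsto_charFun_increment hΨ hp hpr ht l

end ReinforcedLevy

open ReinforcedLevy in
theorem mainTheorem10 {Ω : Type*} [MeasurableSpace Ω] (P : Measure Ω) [IsProbabilityMeasure P]
    (T : LevyTriplet) (p : ℝ) (hp : T.Admissible p)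
    (hderiv : HasDerivAt T.exponent 0 0)
    (hint : IntegrableOn (fun x : ℝ => x) {x : ℝ | 1 ≤ |x|} T.Λ)
    (ξ : ℝ≥0 → Ω → ℝ) (hξ : IsNoiseReinforcedLevy T p ξ P) :
    Martingale (scaledProcess p ξ)
        (Filtration.natural (scaledProcess p ξ)
          (scaledProcess_stronglyMeasurable p hξ.measurable)) P ∧
      HasRcllModification (scaledProcess p ξ) P := by
  obtain ⟨r, hr, hr2, hpr, hq, hT⟩ := hp.exists_exponent
  obtain ⟨C, hΨ⟩ := T.isTameExponent hr hr2 hq hT hint hderiv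
  have h := hξ.hasReinforcedLaw
  have hM := h.martingale_scaled hΨ hp.1.le hp.2.1.le hpr
  exact ⟨hM, hasRcllModification_of_martingale hM
    (h.tendsto_charFun_scaledProcess_sub hΨ hp.1.le hp.2.1 hpr)⟩
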